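/- **Setting.** Let $n\equiv 3 \pmod 4$ with $n>3$. Let $\mathcal H_A,\mathcal H_B,\mathcal H_P$ be complex Hilbert spaces of arbitrary (possibly infinite) dimension (Alice, Bob, and a purifying system on which nobody acts), and let $|\Psi\rangle\in\mathcal H_A\otimes\mathcal H_B\otimes\mathcal H_P$ be a unit vector. An *observable* is a bounded self-adjoint operator $M$ with $M^2=I$. For $A\in\mathcal L(\mathcal H_A)$, $B\in\mathcal L(\mathcal H_B)$ write $\langle AB\rangle=\langle\Psi|A\otimes B\otimes I|\Psi\rangle$; operators on $\mathcal H_A$ or $\mathcal H_B$ act on $|\Psi\rangle$ tensored with identities. Indices range over $\{1,\dots,n\}$, and $y\pm s$ below is read modulo $n$. The observables in each of the following sets (those measured upon one input) are assumed to commute pairwise; nothing is assumed about observables in different sets of the same party. * Alice: $\{X_A^j\}_{j=1}^n$, $\{Y_A^j\}_{j=1}^n$, $\{Z_A^j\}_{j=1}^n$. * Bob, game rounds, for each $y$: $\{X_B^{\overline y},Y_B^{\overline y},Z_B^{\overline y}\}$. * Bob, local check rounds, for each $y$: $\{X_{B,y}^{y}\}\cup\{Z_{B,y}^{j}: j\neq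 y\}$. * Bob, pair check rounds, for each $y$: $\{X_B^{y-s,y+s}\}_{s=1}^{(n-1)/2}\cup\{Z_B^{y-s,y+s}\}_{s=1}^{(n-1)/2}$, where the order of the two superscripts is immaterial (so each unordered pair $\{i,j\}$, $i\ne j$, occurs for exactly one $y$). Suppose that for real numbers $\varepsilon_0,\varepsilon_1,\varepsilon_2$ the following correlations hold. * Game rounds, for all $k$: $$\Big\langle\prod_{j\ne k}X_A^j\; X_B^{\overline k}\Big\rangle\ge 1-\varepsilon_0,\qquad -\Big\langle\prod_{j\ne k}Y_A^j\; X_B^{\overline k}Z_B^{\overline k}\Big\rangle\ge 1-\varepsilon_0,\qquad \Big\langle\prod_{j\ne k}Z_A^j\; Z_B^{\overline k}\Big\rangle\ge 1-\varepsilon_0 .$$ * Local check rounds, for all $i\neq j$: $\langle X_A^iX_{B,i}^i\rangle\ge1-\varepsilon_1$ and $\langle Z_A^iZ_{B,j}^i\rangle\ge1-\varepsilon_1$. * Pair check rounds, for all $i\ne j$: $\langle X_A^iX_A^jX_B^{i,j}\rangle\ge1-\varepsilon_2$ and $\langle Z_A^iZ_A^jZ_B^{i,j}\rangle\ge1-\varepsilon_2$.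 Put $\varepsilon=\max\{\varepsilon_0,\varepsilon_1,\varepsilon_2\}$. **Theorem.** There is an absolute constant $C$ such that, for all $n$, Hilbert spaces, states, observables and $\varepsilon_0,\varepsilon_1,\varepsilon_2$ as above, and for every choice $(k_i)_{i=1}^n$ of elements of $\{1,\dots,n\}$ with $k_i\neq i$ for all $i$, there exist Hilbert spaces $\tilde{\mathcal H}_A,\tilde{\mathcal H}_B$, a junk state (unit vector) $|\xi\rangle\in\tilde{\mathcal H}_A\otimes\tilde{\mathcal H}_B\otimes\mathcal H_P$, and isometries $\Phi_D:\mathcal H_D\to(\mathbb C^2)^{\otimes n}\otimes\tilde{\mathcal H}_D$ ($D=A,B$) such that the local isometry $\Phi=\Phi_A\otimes\Phi_B\otimes I_P$ satisfies, for every $i\in\{1,\dots,n\}$, $$\begin{aligned} \big\|\Phi|\Psi\rangle-|\Phi^+\rangle_{AB}^{\otimes n}\otimes|\xi\rangle\big\|&\le C\,n^{5/2}\sqrt\varepsilon,\\ \big\|\Phi X_A^i|\Psi\rangle-\hat X_A^i|\Phi^+\rangle_{AB}^{\otimes n}\otimes|\xi\rangle\big\|&\le C\,n^{5/2}\sqrt\varepsilon,\\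 \big\|\Phi Z_A^i|\Psi\rangle-\hat Z_A^i|\Phi^+\rangle_{AB}^{\otimes n}\otimes|\xi\rangle\big\|&\le C\,n^{5/2}\sqrt\varepsilon,\\ \big\|\Phi X_{B,i}^i|\Psi\rangle-\hat X_B^i|\Phi^+\rangle_{AB}^{\otimes n}\otimes|\xi\rangle\big\|&\le C\,n^{5/2}\sqrt\varepsilon,\\ \big\|\Phi Z_{B,k_i}^i|\Psi\rangle-\hat Z_B^i|\Phi^+\rangle_{AB}^{\otimes n}\otimes|\xi\rangle\big\|&\le C\,n^{5/2}\sqrt\varepsilon . \end{aligned}$$ Here $|\Phi^+\rangle=(|00\rangle+|11\rangle)/\sqrt2$, each party holds one qubit of each of the $n$ copies, and $\hat X_D^i,\hat Z_D^i$ are the Pauli operators on the $i$th qubit of party $D$. -/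

import Mathlib

open scoped TensorProduct
open TensorProduct

universe u v w

noncomputable section

namespace BellSelfTest

/-! ### Tripartite Hilbert spaces and local operators -/

section Joint

variable (HA : Type u) (HB : Type v) (HP : Type w)
  [NormedAddCommGroup HA] [InnerProductSpace ℂ HA]
  [NormedAddCommGroup HB] [InnerProductSpace ℂ HB]
  [NormedAddCommGroup HP] [InnerProductSpace ℂ HP]

/-- The Hilbert space tensor product of the spaces of Alice, of Bob and of the purifying system:
the completion of the algebraic tensor product for the usual inner product. No dimension is
assumed to be finite. -/
abbrev Joint : Type (max u v w) :=
  UniformSpace.Completion ((HA ⊗[ℂ] HB) ⊗[ℂ] HP)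

end Joint

section Local

variable {HA : Type u} {HB : Type v} {KA : Type u} {KB : Type v} (HP : Type w)
  [NormedAddCommGroup HA] [InnerProductSpace ℂ HA]
  [NormedAddCommGroup HB] [InnerProductSpace ℂ HB]
  [NormedAddCommGroup KA] [InnerProductSpace ℂ KA]
  [NormedAddCommGroup KB] [InnerProductSpace ℂ KB]
  [NormedAddCommGroup HP] [InnerProductSpace ℂ HP]

/-- The bounded operator `A ⊗ B ⊗ I` on the joint Hilbert space. -/
def localOp (A : HA →L[ℂ] KA) (B : HB →L[ℂ] KB) : Joint HA HB HP →L[ℂ] Joint KA KB HP :=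
  (mapL (mapL A B) (ContinuousLinearMap.id ℂ HP)).completion

/-- `(A ⊗ B ⊗ I) (a ⊗ b ⊗ p) = A a ⊗ B b ⊗ p`. -/
theorem localOp_tmul (A : HA →L[ℂ] KA) (B : HB →L[ℂ] KB) (a : HA) (b : HB) (p : HP) :
    localOp HP A B (((a ⊗ₜ[ℂ] b) ⊗ₜ[ℂ] p : (HA ⊗[ℂ] HB) ⊗[ℂ] HP) : Joint HA HB HP)
      = (((A a ⊗ₜ[ℂ] B b) ⊗ₜ[ℂ] p : (KA ⊗[ℂ] KB) ⊗[ℂ] HP) : Joint KA KB HP) := by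
  simp [localOp]

/-- The expectation value `⟨Ψ| A ⊗ B ⊗ I |Ψ⟩`. Only Hermitian operators occur below, for which it
is real, so that taking the real part loses nothing. -/
def expect {HP : Type w} [NormedAddCommGroup HP] [InnerProductSpace ℂ HP]
    (Ψ : Joint HA HB HP) (A : HA →L[ℂ] HA) (B : HB →L[ℂ] HB) : ℝ :=
  (inner ℂ Ψ (localOp HP A B Ψ)).re

end Local

/-! ### Unknown observables -/

/-- A family of `±1`-valued observables (Hermitian operators with square `I`) that are measured
upon the same input, and hence commute pairwise. -/
def IsJointMeasurement {H : Type*} [NormedAddCommGroup H] [InnerProductSpace ℂ H] [CompleteSpace H]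
    (S : Set (H →L[ℂ] H)) : Prop :=
  (∀ M ∈ S, IsSelfAdjoint M ∧ M * M = 1) ∧ ∀ M ∈ S, ∀ N ∈ S, M * N = N * M

/-- The pairs `{y - s, y + s}`, `1 ≤ s ≤ (n - 1) / 2`, of qubits (labelled cyclically modulo `n`)
that are tested in a pair check round upon Bob's input `y`. -/
def checkedPairs {n : ℕ} (y : Fin n) : Set (Sym2 (Fin n)) :=
  {p | ∃ i j : Fin n, ∃ s : ℕ, 1 ≤ s ∧ s ≤ (n - 1) / 2 ∧
    ((i : ℕ) : ZMod n) = ((y : ℕ) : ZMod n) - (s : ZMod n) ∧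
    ((j : ℕ) : ZMod n) = ((y : ℕ) : ZMod n) + (s : ZMod n) ∧ p = s(i, j)}

/-- Alice's unknown observables: `n` of them for each of the inputs `1` (`X`), `2` (`Y`),
`3` (`Z`). -/
structure AliceObservables (n : ℕ) (HA : Type u)
    [NormedAddCommGroup HA] [InnerProductSpace ℂ HA] [CompleteSpace HA] where
  X : Fin n → HA →L[ℂ] HA
  Y : Fin n → HA →L[ℂ] HA
  Z : Fin n → HA →L[ℂ] HA
  input_one : IsJointMeasurement (Set.range X)
  input_two : IsJointMeasurement (Set.range Y)
  input_three : IsJointMeasurement (Set.range Z)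

/-- Bob's unknown observables. Game rounds: `gameX y`, `gameY y`, `gameZ y` upon input `y`.
Local check rounds: upon input `y`, `localX y` for qubit `y` and `localZ y j` for each qubit
`j ≠ y` (the values `localZ y y` play no role). Pair check rounds: upon input `y`, `pairX p` and
`pairZ p` for all unordered pairs `p` tested upon `y` (the values at `s(i, i)` play no role). -/
structure BobObservables (n : ℕ) (HB : Type v)
    [NormedAddCommGroup HB] [InnerProductSpace ℂ HB] [CompleteSpace HB] where
  gameX : Fin n → HB →L[ℂ] HB
  gameY : Fin n → HB →L[ℂ] HB
  gameZ : Fin n → HB →L[ℂ] HB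
  localX : Fin n → HB →L[ℂ] HB
  localZ : Fin n → Fin n → HB →L[ℂ] HB
  pairX : Sym2 (Fin n) → HB →L[ℂ] HB
  pairZ : Sym2 (Fin n) → HB →L[ℂ] HB
  game_input : ∀ y, IsJointMeasurement {gameX y, gameY y, gameZ y}
  local_input : ∀ y, IsJointMeasurement ({localX y} ∪ {M | ∃ j, j ≠ y ∧ M = localZ y j})
  pair_input : ∀ y, IsJointMeasurement (pairX '' checkedPairs y ∪ pairZ '' checkedPairs y)

/-- The product `∏_{j ≠ k} M j`, in ascending order of the indices. -/
def prodExcept {n : ℕ} {R : Type*} [Monoid R] (M : Fin n → R) (k : Fin n) : R :=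
  (((List.finRange n).filter (fun j => j ≠ k)).map M).prod

section Correlations

variable {n : ℕ} {HA : Type u} {HB : Type v} {HP : Type w}
  [NormedAddCommGroup HA] [InnerProductSpace ℂ HA] [CompleteSpace HA]
  [NormedAddCommGroup HB] [InnerProductSpace ℂ HB] [CompleteSpace HB]
  [NormedAddCommGroup HP] [InnerProductSpace ℂ HP]

/-- The correlations of game rounds, satisfied up to `ε`. -/
def GameCorrelations (Ψ : Joint HA HB HP) (a : AliceObservables n HA) (b : BobObservables n HB)
    (ε : ℝ) : Prop :=
  ∀ k : Fin n,
    1 - ε ≤ expect Ψ (prodExcept a.X k) (b.gameX k) ∧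
    1 - ε ≤ -expect Ψ (prodExcept a.Y k) (b.gameX k * b.gameZ k) ∧
    1 - ε ≤ expect Ψ (prodExcept a.Z k) (b.gameZ k)

/-- The correlations of local check rounds, satisfied up to `ε`. -/
def LocalCheckCorrelations (Ψ : Joint HA HB HP) (a : AliceObservables n HA)
    (b : BobObservables n HB) (ε : ℝ) : Prop :=
  ∀ i j : Fin n, i ≠ j →
    1 - ε ≤ expect Ψ (a.X i) (b.localX i) ∧
    1 - ε ≤ expect Ψ (a.Z i) (b.localZ j i)

/-- The correlations of pair check rounds, satisfied up to `ε`. -/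
def PairCheckCorrelations (Ψ : Joint HA HB HP) (a : AliceObservables n HA)
    (b : BobObservables n HB) (ε : ℝ) : Prop :=
  ∀ i j : Fin n, i ≠ j →
    1 - ε ≤ expect Ψ (a.X i * a.X j) (b.pairX s(i, j)) ∧
    1 - ε ≤ expect Ψ (a.Z i * a.Z j) (b.pairZ s(i, j))

end Correlations

/-! ### Reference states and reference observables -/

/-- The `n`-qubit space `(ℂ²)^{⊗ n}`, through its computational basis of bit strings. -/
abbrev Qubits (n : ℕ) : Type := EuclideanSpace ℂ (Fin n → Fin 2)

/-- The Pauli matrix `X`. -/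
def pauliX : Matrix (Fin 2) (Fin 2) ℂ := !![0, 1; 1, 0]

/-- The Pauli matrix `Z`. -/
def pauliZ : Matrix (Fin 2) (Fin 2) ℂ := !![1, 0; 0, -1]

/-- The operator `I ⊗ ⋯ ⊗ σ ⊗ ⋯ ⊗ I` on `n` qubits, with `σ` acting on qubit `i`. -/
def onQubit {n : ℕ} (σ : Matrix (Fin 2) (Fin 2) ℂ) (i : Fin n) : Qubits n →L[ℂ] Qubits n :=
  Matrix.toEuclideanCLM (𝕜 := ℂ) (n := Fin n → Fin 2)
    (Matrix.of fun s t => ∏ j, (if j = i then σ else 1) (s j) (t j))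

/-- The amplitude of the Bell state `|Φ⁺⟩ = (|00⟩ + |11⟩) / √2` at `|s⟩ ⊗ |t⟩`. -/
def bellAmplitude (s t : Fin 2) : ℂ := if s = t then 1 / (Real.sqrt 2 : ℂ) else 0

/-- The `n`-fold Bell state `|Φ⁺⟩^{⊗ n}`, one half of each copy being held by Alice and the other
one by Bob. -/
def bellStates (n : ℕ) : Qubits n ⊗[ℂ] Qubits n :=
  ∑ s : Fin n → Fin 2, ∑ t : Fin n → Fin 2,
    (∏ j, bellAmplitude (s j) (t j)) •
      (EuclideanSpace.single s (1 : ℂ) ⊗ₜ[ℂ] EuclideanSpace.single t (1 : ℂ))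

section Reference

variable (QA QB : Type) (KA : Type u) (KB : Type v) (HP : Type w)
  [NormedAddCommGroup QA] [InnerProductSpace ℂ QA]
  [NormedAddCommGroup QB] [InnerProductSpace ℂ QB]
  [NormedAddCommGroup KA] [InnerProductSpace ℂ KA]
  [NormedAddCommGroup KB] [InnerProductSpace ℂ KB]
  [NormedAddCommGroup HP] [InnerProductSpace ℂ HP]

/-- The rearrangement of tensor factors that brings together what is on Alice's side and what is
on Bob's side. -/
def interleave : (QA ⊗[ℂ] QB) ⊗[ℂ] (KA ⊗[ℂ] KB) ≃ₗᵢ[ℂ] (QA ⊗[ℂ] KA) ⊗[ℂ] (QB ⊗[ℂ] KB) :=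
  (assocIsometry ℂ QA QB (KA ⊗[ℂ] KB)).trans <|
    (LinearIsometryEquiv.lTensor QA <|
      (assocIsometry ℂ QB KA KB).symm.trans <|
        (LinearIsometryEquiv.rTensor KB (commIsometry ℂ QB KA)).trans <|
          assocIsometry ℂ KA QB KB).trans <|
      (assocIsometry ℂ QA KA (QB ⊗[ℂ] KB)).symm

theorem interleave_tmul (q : QA) (r : QB) (a : KA) (b : KB) :
    interleave QA QB KA KB ((q ⊗ₜ r) ⊗ₜ (a ⊗ₜ b)) = (q ⊗ₜ a) ⊗ₜ (r ⊗ₜ b) := by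
  simp [interleave]

variable {QA QB KA KB HP}

variable (KA KB HP) in
/-- For a reference state `φ` shared by Alice and Bob, the bounded operator `ξ ↦ φ ⊗ ξ` from the
junk space to the joint space in which the two halves of `φ` are local to Alice and to Bob. -/
def withJunkL (φ : QA ⊗[ℂ] QB) :
    Joint KA KB HP →L[ℂ] Joint (QA ⊗[ℂ] KA) (QB ⊗[ℂ] KB) HP :=
  (((assocIsometry ℂ (QA ⊗[ℂ] QB) (KA ⊗[ℂ] KB) HP).symm.trans
      ((interleave QA QB KA KB).rTensor HP)).toLinearIsometry.toContinuousLinearMap.comp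
    (mkL ℂ (QA ⊗[ℂ] QB) ((KA ⊗[ℂ] KB) ⊗[ℂ] HP) φ)).completion

/-- The state `φ ⊗ ξ`, with the two halves of `φ` on Alice's and on Bob's side. -/
def withJunk (φ : QA ⊗[ℂ] QB) (ξ : Joint KA KB HP) : Joint (QA ⊗[ℂ] KA) (QB ⊗[ℂ] KB) HP :=
  withJunkL KA KB HP φ ξ

theorem withJunk_tmul (q : QA) (r : QB) (a : KA) (b : KB) (p : HP) :
    withJunk (q ⊗ₜ[ℂ] r) (((a ⊗ₜ[ℂ] b) ⊗ₜ[ℂ] p : (KA ⊗[ℂ] KB) ⊗[ℂ] HP) : Joint KA KB HP)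
      = ((((q ⊗ₜ[ℂ] a) ⊗ₜ[ℂ] (r ⊗ₜ[ℂ] b)) ⊗ₜ[ℂ] p :
          ((QA ⊗[ℂ] KA) ⊗[ℂ] (QB ⊗[ℂ] KB)) ⊗[ℂ] HP) :
          Joint (QA ⊗[ℂ] KA) (QB ⊗[ℂ] KB) HP) := by
  simp [withJunk, withJunkL, interleave_tmul]

end Reference

/-- The state `σ_A^i |Φ⁺⟩^{⊗ n}`, with `σ` acting on Alice's `i`th qubit. -/
def bellStatesActA {n : ℕ} (σ : Matrix (Fin 2) (Fin 2) ℂ) (i : Fin n) :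
    Qubits n ⊗[ℂ] Qubits n :=
  mapL (onQubit σ i) (ContinuousLinearMap.id ℂ (Qubits n)) (bellStates n)

/-- The state `σ_B^i |Φ⁺⟩^{⊗ n}`, with `σ` acting on Bob's `i`th qubit. -/
def bellStatesActB {n : ℕ} (σ : Matrix (Fin 2) (Fin 2) ℂ) (i : Fin n) :
    Qubits n ⊗[ℂ] Qubits n :=
  mapL (ContinuousLinearMap.id ℂ (Qubits n)) (onQubit σ i) (bellStates n)

end BellSelfTest

end

/-!
The proof that the measured correlations force `n` Bell states has four steps. Write
`τ = √(2 ε)`, and compare unitaries `u`, `v` of Alice by the distance `‖u Ψ - v Ψ‖`.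

*Mirror images.* A correlation `⟨A B⟩ ≥ 1 - ε` of two `±1`-valued observables says that
`‖A Ψ - B Ψ‖ ≤ τ` (`mirrors_of_le_inner`). As operators of Bob commute with those of Alice, this has
two consequences: right multiplication by an operator of Alice that has such a mirror image almost
preserves distances (`Mirrors.almostRightInvariant`), and operators of Alice with commuting mirror
images almost commute on `Ψ` (`dist_mul_le_of_mirrors`). In this way the unknown observables of Bob
are eliminated: what remains is a set of approximate relations, `CheckRelations`, between words in
the observables of Alice.

*Words.* Let `x`, `y`, `z` map a bit string to the corresponding product of the `X_j`, `Y_j`, `Z_j`,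
and let `k̄` be the string that vanishes only at `k`. The game rounds give `y k̄ ≈ - z k̄ x k̄`.
Products of two of these relations express `y` on pairs by `x` and `z`, the two signs cancelling
(`CheckRelations.y_two`). Products of pairs give `y a ≈ z a x a` for strings `a` of weight four
(`CheckRelations.y_four`), and then of any weight divisible by four (`CheckRelations.y_sum`). As
`n ≡ 3 (mod 4)`, the complement of three indices has such a weight, and comparison with the game
round once more yields the anticommutation of `X_k` and `Z_k` up to `O(n² τ)`
(`CheckRelations.anticomm`). Together with the local checks this determines the commutation of
every `x a` with every `Z_j` (`CheckRelations.comm_signed`).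

*The isometries.* Let `φ_p`, for `p = (a, b)`, be the Bell basis of two copies of the `n`-qubit
space. Each party applies `v ↦ 2^{-n} ∑_p φ_p ⊗ U_p v`, which is an isometry for any unitaries `U_p`. For
Alice `U_p = z b x a`; for Bob the `U_p` are mirror images of the `x a z b`. Since the Pauli
operators permute the `φ_p` up to sign, and the `U_p` are permuted likewise up to the error of the word
relations, the isometry almost intertwines the observables with the Pauli operators
(`exists_isometry_left`, `exists_isometry_right`). The error for the superposition is at most the
largest one of its terms, because the `φ_p` are orthogonal.

*The junk state.* On the image `χ` of `Ψ` the Pauli operators of Alice thus almost agree with those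
of Bob. Every vector of the Bell basis except the Bell state itself is a `-1` eigenvector of some
`X_A X_B` or `Z_A Z_B`, so that summing the squares of the `2 n` errors bounds the part of `χ`
outside the Bell state (`exists_junk`). This sum costs the factor `√n` that turns `n²` into `n ^ (5 / 2)`.
-/

noncomputable section

namespace BellSelfTest

-- `inner ℂ x y` is to mean the inner product of an inner product space, also where a path through
-- Hilbert C⋆-modules is available.
attribute [local instance] InnerProductSpace.toInner

/-! ### Words in a group with a left invariant pseudometric -/

section Words

variable {G : Type*} [Group G] [PseudoMetricSpace G]

/-- Multiplication by `w` on the right increases distances by at most `2 c`. For the pseudometric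
`‖u Ψ - v Ψ‖` on the unitaries `u`, `v` of one party this holds when `w Ψ` is `c`-close to `w' Ψ`
for a unitary `w'` of the other party, because `w'` commutes with `u` and `v`. -/
def AlmostRightInvariant (c : ℝ) (w : G) : Prop :=
  ∀ u v : G, dist (u * w) (v * w) ≤ dist u v + 2 * c

theorem AlmostRightInvariant.dist_mul_right_le {c d : ℝ} {w u v : G}
    (hw : AlmostRightInvariant c w) (h : dist u v ≤ d) : dist (u * w) (v * w) ≤ d + 2 * c :=
  (hw u v).trans (by linarith)

theorem AlmostRightInvariant.mul {c d : ℝ} {w w' : G} (hw : AlmostRightInvariant c w)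
    (hw' : AlmostRightInvariant d w') : AlmostRightInvariant (c + d) (w * w') := by
  intro u v
  have h1 := hw' (u * w) (v * w)
  have h2 := hw u v
  rw [← mul_assoc, ← mul_assoc]
  linarith

theorem AlmostRightInvariant.one : AlmostRightInvariant 0 (1 : G) := by
  intro u v
  simp

/-- Cancellation of a right factor. -/
theorem AlmostRightInvariant.dist_le_of_mul_right {c d : ℝ} {w u v : G}
    (hw : AlmostRightInvariant c w⁻¹) (h : dist (u * w) (v * w) ≤ d) : dist u v ≤ d + 2 * c := by
  have := hw.dist_mul_right_le h
  simpa using this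

variable [IsIsometricSMul G G]

theorem dist_mul_left_le {d : ℝ} {u v : G} (w : G) (h : dist u v ≤ d) :
    dist (w * u) (w * v) ≤ d := by
  rwa [dist_mul_left]

end Words

/-! ### Exponent vectors -/

/-- The exponent vector with a single entry `1`, at `i`. -/
abbrev bit {n : ℕ} (i : Fin n) : Fin n → Fin 2 := Pi.single i 1

theorem bits_add_self {n : ℕ} (a : Fin n → Fin 2) : a + a = 0 := by
  funext i
  have : ∀ t : Fin 2, t + t = 0 := by decide
  exact this (a i)

/-- The exponent vector of the product over all indices except `k`. -/
abbrev allBut {n : ℕ} (k : Fin n) : Fin n → Fin 2 := (fun _ => 1) + bit k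

theorem bits_eq_of_add_eq_zero {n : ℕ} {a b : Fin n → Fin 2} (h : a + b = 0) : a = b := by
  have := congrArg (· + b) h
  simpa [add_assoc, bits_add_self] using this

theorem bits_eq_sum (a : Fin n → Fin 2) :
    a = ∑ i ∈ Finset.univ.filter (fun i => a i = 1), bit i := by
  funext j
  rw [Finset.sum_apply]
  by_cases hj : a j = 1
  · rw [Finset.sum_eq_single j] <;> simp +contextual [hj, eq_comm]
  · rw [Finset.sum_eq_zero]
    · revert hj; generalize a j = t; revert t; decide
    · intro i hi
      have : j ≠ i := by rintro rfl; simp_all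
      simp [this]

theorem sum_univ_bit {n : ℕ} : (∑ i : Fin n, bit i) = fun _ => (1 : Fin 2) := by
  funext j
  rw [Finset.sum_apply, Finset.sum_eq_single j] <;> simp +contextual [eq_comm]

section BitsMap

variable {n : ℕ} {G : Type*} [Group G] {x : (Fin n → Fin 2) → G}

theorem bits_map_zero (hx : ∀ a b, x (a + b) = x a * x b) : x 0 = 1 := by
  have := hx 0 0
  simpa using this

theorem bits_map_comm (hx : ∀ a b, x (a + b) = x a * x b)
    (a b : Fin n → Fin 2) : x a * x b = x b * x a := by
  rw [← hx, ← hx, add_comm]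

theorem bits_map_inv (hx : ∀ a b, x (a + b) = x a * x b)
    (a : Fin n → Fin 2) : (x a)⁻¹ = x a := by
  rw [inv_eq_iff_mul_eq_one, ← hx, bits_add_self, bits_map_zero hx]

theorem bits_map_mul_self (hx : ∀ a b, x (a + b) = x a * x b)
    (a : Fin n → Fin 2) : x a * x a = 1 := by
  rw [← hx, bits_add_self, bits_map_zero hx]

end BitsMap

/-! ### Approximate relations between the observables of one party -/

/-- Approximate relations between three commuting families `x a = ∏ X_j ^ a_j`, `y a`, `z a` of
products of involutions and a central involution `m` (the sign `-1`), with error `τ`: all that the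
correlations say about the observables of a single party. -/
structure CheckRelations {n : ℕ} {G : Type*} [Group G] [PseudoMetricSpace G] (τ : ℝ)
    (x y z : (Fin n → Fin 2) → G) (m : G) : Prop where
  x_add : ∀ a b, x (a + b) = x a * x b
  y_add : ∀ a b, y (a + b) = y a * y b
  z_add : ∀ a b, z (a + b) = z a * z b
  m_comm : ∀ g, m * g = g * m
  m_sq : m * m = 1
  x_bit : ∀ i, AlmostRightInvariant τ (x (bit i))
  z_bit : ∀ i, AlmostRightInvariant τ (z (bit i))
  x_allBut : ∀ i, AlmostRightInvariant τ (x (allBut i))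
  y_allBut : ∀ i, AlmostRightInvariant τ (y (allBut i))
  comm_local : ∀ i j, i ≠ j → dist (x (bit i) * z (bit j)) (z (bit j) * x (bit i)) ≤ 4 * τ
  comm_pair : ∀ i j, i ≠ j → dist (x (bit i + bit j) * z (bit i + bit j))
    (z (bit i + bit j) * x (bit i + bit j)) ≤ 4 * τ
  game_zx : ∀ k, dist (y (allBut k)) (m * z (allBut k) * x (allBut k)) ≤ 3 * τ
  game_xz : ∀ k, dist (y (allBut k)) (m * x (allBut k) * z (allBut k)) ≤ 3 * τ

namespace CheckRelations

variable {n : ℕ} {G : Type*} [Group G] [PseudoMetricSpace G] {τ : ℝ}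
  {x y z : (Fin n → Fin 2) → G} {m : G}

theorem tau_nonneg (h : CheckRelations τ x y z m) (hn : 0 < n) : 0 ≤ τ := by
  have := h.game_xz ⟨0, hn⟩
  linarith [this.trans' dist_nonneg]

theorem sum_bit_ari (hx : ∀ a b, x (a + b) = x a * x b)
    (hb : ∀ i, AlmostRightInvariant τ (x (bit i))) (S : Finset (Fin n)) :
    AlmostRightInvariant (S.card * τ) (x (∑ i ∈ S, bit i)) := by
  induction S using Finset.induction_on with
  | empty => simpa [bits_map_zero hx] using AlmostRightInvariant.one
  | insert i S hi ih =>
    rw [Finset.sum_insert hi, hx, Finset.card_insert_of_notMem hi]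
    have := (hb i).mul ih
    push_cast
    rwa [show ((S.card : ℝ) + 1) * τ = τ + S.card * τ by ring]

theorem map_ari (hx : ∀ a b, x (a + b) = x a * x b) (hτ : 0 ≤ τ)
    (hb : ∀ i, AlmostRightInvariant τ (x (bit i))) (a : Fin n → Fin 2) :
    AlmostRightInvariant (n * τ) (x a) := by
  have := sum_bit_ari hx hb (Finset.univ.filter (fun i => a i = 1))
  rw [← bits_eq_sum] at this
  intro u v
  refine (this u v).trans ?_
  have hc : ((Finset.univ.filter (fun i => a i = 1)).card : ℝ) ≤ n := by
    exact_mod_cast (Finset.card_le_univ _).trans (by simp)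
  gcongr

/-- The `Y`s are not checked individually, but `Y_k Y_l` is the quotient of two game rounds. -/
theorem y_two_ari (h : CheckRelations τ x y z m) (k l : Fin n) :
    AlmostRightInvariant (2 * τ) (y (bit k + bit l)) := by
  have hy : y (bit k + bit l) = y (allBut k) * y (allBut l) := by
    rw [← h.y_add]; congr 1; funext i; simp only [Pi.add_apply]
    generalize (bit k) i = s; generalize (bit l) i = t; revert s t; decide
  rw [hy, two_mul]
  exact (h.y_allBut k).mul (h.y_allBut l)

theorem two_ari {x : (Fin n → Fin 2) → G} (hx : ∀ a b, x (a + b) = x a * x b)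
    (hb : ∀ i, AlmostRightInvariant τ (x (bit i))) (k l : Fin n) :
    AlmostRightInvariant (2 * τ) (x (bit k + bit l)) := by
  rw [hx, two_mul]
  exact (hb k).mul (hb l)

variable [IsIsometricSMul G G]

/-- A product of `X`s almost commutes with a `Z` on another index. Commuting `Z` past the last `X`
first keeps the cost linear in the number of factors. -/
theorem comm_sum_bit (h : CheckRelations τ x y z m) (j : Fin n) (S : Finset (Fin n))
    (hj : j ∉ S) : dist (x (∑ i ∈ S, bit i) * z (bit j)) (z (bit j) * x (∑ i ∈ S, bit i))
      ≤ 6 * S.card * τ := by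
  induction S using Finset.induction_on with
  | empty => simp [bits_map_zero h.x_add]
  | insert i S hi ih =>
    have hji : i ≠ j := fun e => hj (e ▸ Finset.mem_insert_self _ _)
    have ih := ih fun e => hj (Finset.mem_insert_of_mem e)
    have h1 := dist_mul_left_le (x (∑ i ∈ S, bit i)) (h.comm_local i j hji)
    have h2 := (h.x_bit i).dist_mul_right_le ih
    rw [Finset.sum_insert hi, add_comm, h.x_add, Finset.card_insert_of_notMem hi]
    simp only [← mul_assoc] at h1 h2 ⊢
    push_cast
    linarith [dist_triangle _ _ _ |>.trans (add_le_add h1 h2)]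

theorem comm_of_apply_eq_zero (h : CheckRelations τ x y z m) (j : Fin n) (a : Fin n → Fin 2)
    (ha : a j = 0) : dist (x a * z (bit j)) (z (bit j) * x a) ≤ 6 * n * τ := by
  have hτ := h.tau_nonneg (Fin.pos j)
  have := h.comm_sum_bit j (Finset.univ.filter (fun i => a i = 1)) (by simp [ha])
  rw [← bits_eq_sum] at this
  refine this.trans ?_
  have hc : ((Finset.univ.filter (fun i => a i = 1)).card : ℝ) ≤ n := by
    exact_mod_cast (Finset.card_le_univ _).trans (by simp)
  gcongr

/-- A product of `X`s almost commutes with `Z_k Z_l` if neither `k` nor `l` occurs in it. -/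
theorem comm_two (h : CheckRelations τ x y z m) (k l : Fin n) (a : Fin n → Fin 2)
    (hk : a k = 0) (hl : a l = 0) :
    dist (x a * z (bit k + bit l)) (z (bit k + bit l) * x a) ≤ (12 * n + 2) * τ := by
  have h1 := (h.z_bit l).dist_mul_right_le (h.comm_of_apply_eq_zero k a hk)
  have h2 := dist_mul_left_le (z (bit k)) (h.comm_of_apply_eq_zero l a hl)
  rw [h.z_add]
  simp only [← mul_assoc] at h1 h2 ⊢
  linarith [dist_triangle _ _ _ |>.trans (add_le_add h1 h2)]

/-- `Y_k Y_l ≈ X_l Z_k Z_l X_k`: the relation between two game rounds. -/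
theorem y_two (h : CheckRelations τ x y z m) (k l : Fin n) (hkl : k ≠ l) :
    dist (y (bit k + bit l)) (x (bit l) * z (bit k + bit l) * x (bit k)) ≤ (12 * n + 12) * τ := by
  -- the indices other than `k` and `l`, which both game rounds share
  set r : Fin n → Fin 2 := (fun _ => 1) + bit k + bit l with hr
  have hy : y (bit k + bit l) = y (allBut k) * y (allBut l) := by
    rw [← h.y_add]; congr 1; funext i; simp only [Pi.add_apply]
    generalize (bit k) i = s; generalize (bit l) i = t; revert s t; decide
  have hz : z (bit k + bit l) = z (allBut k) * z (allBut l) := by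
    rw [← h.z_add]; congr 1; funext i; simp only [Pi.add_apply]
    generalize (bit k) i = s; generalize (bit l) i = t; revert s t; decide
  have hx1 : x (allBut k) = x (bit l) * x r := by
    rw [← h.x_add]; congr 1; funext i; simp only [hr, Pi.add_apply]
    generalize (bit k) i = s; generalize (bit l) i = t; revert s t; decide
  have hx2 : x r * x (allBut l) = x (bit k) := by
    rw [← h.x_add]; congr 1; funext i; simp only [hr, Pi.add_apply]
    generalize (bit k) i = s; generalize (bit l) i = t; revert s t; decide
  have h1 := (h.y_allBut l).dist_mul_right_le (h.game_xz k)
  have h2 := dist_mul_left_le (m * x (allBut k) * z (allBut k)) (h.game_zx l)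
  have h3 : m * x (allBut k) * z (allBut k) * (m * z (allBut l) * x (allBut l))
      = x (bit l) * (x r * z (bit k + bit l)) * x (allBut l) := by
    calc _ = m * (x (allBut k) * z (allBut k) * m) * z (allBut l) * x (allBut l) := by
          simp only [mul_assoc]
      _ = (m * m) * x (allBut k) * (z (allBut k) * z (allBut l)) * x (allBut l) := by
          rw [← h.m_comm]; simp only [mul_assoc]
      _ = _ := by rw [h.m_sq, ← hz, hx1]; simp only [mul_assoc, one_mul]
  have h4 := (h.x_allBut l).dist_mul_right_le (dist_mul_left_le (x (bit l))
    (h.comm_two k l r (by simp [hr, hkl]) (by simp [hr, hkl.symm])))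
  have h5 : x (bit l) * (z (bit k + bit l) * x r) * x (allBut l)
      = x (bit l) * z (bit k + bit l) * x (bit k) := by
    rw [← hx2]; simp only [mul_assoc]
  rw [h5, ← h3] at h4
  rw [hy]
  linarith [dist_triangle _ _ _ |>.trans (add_le_add (dist_triangle _ _ _ |>.trans
    (add_le_add h1 h2)) h4)]

/-- `Y_i Y_j Y_k Y_l ≈ Z_i Z_j Z_k Z_l X_i X_j X_k X_l`. Two instances of `y_two` are rearranged until
the pair check for `i`, `k` exchanges `X_i X_k` with `Z_i Z_k`, so that no anticommutation is needed. -/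
theorem y_four (h : CheckRelations τ x y z m) (i j k l : Fin n) (hij : i ≠ j) (hik : i ≠ k)
    (hil : i ≠ l) (hjk : j ≠ k) (hjl : j ≠ l) (hkl : k ≠ l) :
    dist (y (bit i + bit j + (bit k + bit l)))
      (z (bit i + bit j + (bit k + bit l)) * x (bit i + bit j + (bit k + bit l)))
      ≤ (60 * n + 60) * τ := by
  have X := h.x_add
  have Z := h.z_add
  have h1 := (h.y_two_ari k l).dist_mul_right_le (h.y_two j i hij.symm)
  have h2 := dist_mul_left_le (x (bit i) * z (bit j + bit i) * x (bit j)) (h.y_two l k hkl.symm)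
  have h3 := dist_mul_left_le (x (bit i) * z (bit j + bit i) * x (bit k))
    ((h.x_bit l).dist_mul_right_le
      (h.comm_two k l (bit j) (by simp [hjk.symm]) (by simp [hjl.symm])))
  have h4 := dist_mul_left_le (x (bit i))
    (((two_ari Z h.z_bit k l).mul (two_ari X h.x_bit j l)).dist_mul_right_le
      (h.comm_two j i (bit k) (by simp [hjk]) (by simp [hik])))
  have h5 := ((two_ari Z h.z_bit j l).mul (two_ari X h.x_bit j l)).dist_mul_right_le
    (h.comm_pair i k hik)
  have h6 := dist_mul_left_le (z (bit i + bit k)) ((two_ari X h.x_bit j l).dist_mul_right_le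
    (h.comm_two j l (bit i + bit k) (by simp [hij.symm, hjk]) (by simp [hil.symm, hkl.symm])))
  have e0 : y (bit i + bit j + (bit k + bit l)) = y (bit j + bit i) * y (bit k + bit l) := by
    rw [h.y_add, add_comm (bit i)]
  have e2 : x (bit i) * z (bit j + bit i) * x (bit j) *
      (x (bit k) * z (bit l + bit k) * x (bit l)) = x (bit i) * z (bit j + bit i) * x (bit k) *
      (x (bit j) * z (bit k + bit l) * x (bit l)) := by
    rw [add_comm (bit l)]
    simp only [mul_assoc]
    rw [← mul_assoc (x (bit j)), bits_map_comm X (bit j), mul_assoc]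
  have e3 : x (bit i) * z (bit j + bit i) * x (bit k) * (z (bit k + bit l) * x (bit j) * x (bit l))
      = x (bit i) * (z (bit j + bit i) * x (bit k) *
        (z (bit k + bit l) * x (bit j + bit l))) := by
    rw [X (bit j)]; simp only [mul_assoc]
  have e4 : x (bit i) * (x (bit k) * z (bit j + bit i) * (z (bit k + bit l) * x (bit j + bit l)))
      = x (bit i + bit k) * z (bit i + bit k) * (z (bit j + bit l) * x (bit j + bit l)) := by
    have : z (bit j + bit i) * z (bit k + bit l) = z (bit i + bit k) * z (bit j + bit l) := by
      rw [← Z, ← Z]; congr 1; abel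
    rw [X (bit i)]; simp only [mul_assoc]
    rw [← mul_assoc (z _) (z _), this]; simp only [mul_assoc]
  have e5 : z (bit i + bit k) * x (bit i + bit k) * (z (bit j + bit l) * x (bit j + bit l))
      = z (bit i + bit k) * (x (bit i + bit k) * z (bit j + bit l) * x (bit j + bit l)) := by
    simp only [mul_assoc]
  have e6 : z (bit i + bit k) * (z (bit j + bit l) * x (bit i + bit k) * x (bit j + bit l))
      = z (bit i + bit j + (bit k + bit l)) * x (bit i + bit j + (bit k + bit l)) := by
    have ez : z (bit i + bit j + (bit k + bit l)) = z (bit i + bit k) * z (bit j + bit l) := by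
      rw [← Z]; congr 1; abel
    have ex : x (bit i + bit j + (bit k + bit l)) = x (bit i + bit k) * x (bit j + bit l) := by
      rw [← X]; congr 1; abel
    rw [ez, ex]; simp only [mul_assoc]
  rw [e2, add_comm (bit l)] at h2
  rw [dist_comm, ← e3, e4] at h4
  rw [e5] at h5
  rw [e6] at h6
  rw [e0]
  have t1 := dist_triangle _ _ _ |>.trans (add_le_add h1 h2)
  have t2 := dist_triangle _ _ _ |>.trans (add_le_add t1 h3)
  have t3 := dist_triangle _ _ _ |>.trans (add_le_add t2 h4)
  have t4 := dist_triangle _ _ _ |>.trans (add_le_add t3 h5)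
  have t5 := dist_triangle _ _ _ |>.trans (add_le_add t4 h6)
  linarith

/-- `y` agrees with `z x` on strings whose weight is divisible by four. Splitting off one quadruple
at a time keeps the cost of each step linear in `n`. -/
theorem y_sum (h : CheckRelations τ x y z m) (r : ℕ) :
    ∀ S : Finset (Fin n), S.card = 4 * r →
      dist (y (∑ i ∈ S, bit i)) (z (∑ i ∈ S, bit i) * x (∑ i ∈ S, bit i))
        ≤ r * (84 * n + 84) * τ := by
  induction r with
  | zero =>
    intro S hS
    obtain rfl : S = ∅ := Finset.card_eq_zero.mp (by simpa using hS)
    simp [bits_map_zero h.x_add, bits_map_zero h.y_add, bits_map_zero h.z_add]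
  | succ r ih =>
    intro S hS
    have X := h.x_add
    have Z := h.z_add
    obtain ⟨S₃, hS₃, hc₃⟩ := Finset.exists_subset_card_eq (s := S) (n := 4 * r) (by omega)
    have hd : (S \ S₃).card = 4 := by rw [Finset.card_sdiff_of_subset hS₃]; omega
    obtain ⟨i, A, hiA, hA, hAc⟩ := Finset.card_eq_succ.mp hd
    obtain ⟨j, k, l, hjk, hjl, hkl, rfl⟩ := Finset.card_eq_three.mp hAc
    simp only [Finset.mem_insert, Finset.mem_singleton, not_or] at hiA
    obtain ⟨hij, hik, hil⟩ := hiA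
    have hmem : ∀ t ∈ ({i, j, k, l} : Finset (Fin n)), t ∉ S₃ := by
      intro t ht; rw [hA] at ht; exact (Finset.mem_sdiff.mp ht).2
    have hsum : ∑ t ∈ S, bit t
        = ∑ t ∈ S₃, bit t + (bit i + bit j + (bit k + bit l)) := by
      rw [← Finset.sum_sdiff hS₃, ← hA, add_comm, Finset.sum_insert (by simp [hij, hik, hil]),
        Finset.sum_insert (by simp [hjk, hjl]), Finset.sum_pair hkl]
      abel
    have hz : ∀ t ∈ ({i, j, k, l} : Finset (Fin n)), (∑ t ∈ S₃, bit t : Fin n → Fin 2) t = 0 := by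
      intro t ht
      rw [Finset.sum_apply, Finset.sum_eq_zero]
      intro u hu
      have : t ≠ u := by rintro rfl; exact hmem _ ht hu
      simp [this]
    set s : Fin n → Fin 2 := ∑ t ∈ S₃, bit t with hs
    have hy4 : AlmostRightInvariant (2 * τ + 2 * τ) (y (bit i + bit j + (bit k + bit l))) := by
      rw [h.y_add]; exact (h.y_two_ari i j).mul (h.y_two_ari k l)
    have hx4 : AlmostRightInvariant (2 * τ + 2 * τ) (x (bit i + bit j + (bit k + bit l))) := by
      rw [h.x_add]; exact (two_ari X h.x_bit i j).mul (two_ari X h.x_bit k l)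
    have h1 := hy4.dist_mul_right_le (ih S₃ hc₃)
    have h2 := dist_mul_left_le (z s * x s) (h.y_four i j k l hij hik hil hjk hjl hkl)
    have h3 := (two_ari Z h.z_bit k l).dist_mul_right_le
      (h.comm_two i j s (hz i (by simp)) (hz j (by simp)))
    have h4 := dist_mul_left_le (z (bit i + bit j))
      (h.comm_two k l s (hz k (by simp)) (hz l (by simp)))
    simp only [← mul_assoc] at h3 h4
    have h5 := dist_mul_left_le (z s)
      (hx4.dist_mul_right_le (dist_triangle _ _ _ |>.trans (add_le_add h3 h4)))
    have e2 : z s * x s * (z (bit i + bit j + (bit k + bit l)) *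
        x (bit i + bit j + (bit k + bit l)))
        = z s * (x s * z (bit i + bit j) * z (bit k + bit l) *
          x (bit i + bit j + (bit k + bit l))) := by
      rw [Z (bit i + bit j)]; simp only [mul_assoc]
    have e3 : z s * (z (bit i + bit j) * z (bit k + bit l) * x s *
          x (bit i + bit j + (bit k + bit l)))
        = z (s + (bit i + bit j + (bit k + bit l))) *
          x (s + (bit i + bit j + (bit k + bit l))) := by
      rw [Z s, Z (bit i + bit j), X s]; simp only [mul_assoc]
    rw [e2] at h2
    rw [e3] at h5
    rw [hsum, h.y_add]
    have t1 := dist_triangle _ _ _ |>.trans (add_le_add h1 h2)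
    have t2 := dist_triangle _ _ _ |>.trans (add_le_add t1 h5)
    push_cast
    linarith

/-- The almost anticommutation of `X_k` and `Z_k`: the game round on which `t` is left out is
compared with the product of all the other `Y`s, arranged into quadruples (`y_four`, no sign) and
one pair (`y_two`, a sign). -/
theorem anticomm (h : CheckRelations τ x y z m) (hn : n % 4 = 3) (k : Fin n) :
    dist (x (bit k) * z (bit k)) (m * (z (bit k) * x (bit k))) ≤ 110 * (n : ℝ) ^ 2 * τ := by
  have X := h.x_add
  have Z := h.z_add
  have hτ := h.tau_nonneg (Fin.pos k)
  obtain ⟨r, hr⟩ : ∃ r, n = 4 * r + 3 := ⟨n / 4, by omega⟩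
  have hc : (Finset.univ.erase k : Finset (Fin n)).card = 4 * r + 2 := by
    rw [Finset.card_erase_of_mem (Finset.mem_univ _), Finset.card_univ, Fintype.card_fin]; omega
  obtain ⟨l, hl⟩ : (Finset.univ.erase k : Finset (Fin n)).Nonempty := by
    rw [← Finset.card_pos]; omega
  have hc2 : ((Finset.univ.erase k).erase l : Finset (Fin n)).card = 4 * r + 1 := by
    rw [Finset.card_erase_of_mem hl, hc]; rfl
  obtain ⟨t, ht⟩ : ((Finset.univ.erase k).erase l : Finset (Fin n)).Nonempty := by
    rw [← Finset.card_pos]; omega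
  set S := ((Finset.univ.erase k).erase l).erase t with hS
  have hSc : S.card = 4 * r := by rw [Finset.card_erase_of_mem ht, hc2]; rfl
  have hlk : l ≠ k := (Finset.mem_erase.mp hl).1
  have hsum : allBut t = ∑ i ∈ S, bit i + (bit k + bit l) := by
    rw [allBut, ← sum_univ_bit, ← Finset.add_sum_erase _ _ (Finset.mem_univ k),
      ← Finset.add_sum_erase _ _ hl, ← Finset.add_sum_erase _ _ ht]
    have := bits_add_self (bit t)
    calc _ = (bit t + bit t) + (∑ i ∈ S, bit i + (bit k + bit l)) := by abel
      _ = _ := by rw [this, zero_add]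
  have hz : ∀ u, u ∉ S → (∑ t ∈ S, bit t : Fin n → Fin 2) u = 0 := by
    intro u hu
    rw [Finset.sum_apply, Finset.sum_eq_zero]
    intro v hv
    have : u ≠ v := by rintro rfl; exact hu hv
    simp [this]
  have hYS := h.y_sum r S hSc
  set s : Fin n → Fin 2 := ∑ t ∈ S, bit t with hs
  have hsk : s k = 0 := hz k (by simp [hS])
  have hsl : s l = 0 := hz l (by simp [hS])
  have h1 := (h.y_two_ari k l).dist_mul_right_le hYS
  have h2 := dist_mul_left_le (z s * x s) (h.y_two l k hlk)
  have h3 := dist_mul_left_le (z s * x (bit k))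
    ((h.x_bit l).dist_mul_right_le (h.comm_two k l s hsk hsl))
  have h4 := h.game_zx t
  have e2 : z s * x s * (x (bit k) * z (bit l + bit k) * x (bit l))
      = z s * x (bit k) * (x s * z (bit k + bit l) * x (bit l)) := by
    rw [add_comm (bit l)]
    simp only [mul_assoc]
    rw [← mul_assoc (x s), bits_map_comm X s, mul_assoc]
  have e3 : z s * x (bit k) * (z (bit k + bit l) * x s * x (bit l))
      = z s * (x (bit k) * z (bit k + bit l) * x (s + bit l)) := by
    rw [X]; simp only [mul_assoc]
  have e4 : m * z (allBut t) * x (allBut t)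
      = z s * (m * z (bit k + bit l) * x (bit k) * x (s + bit l)) := by
    have : s + (bit k + bit l) = bit k + (s + bit l) := by abel
    rw [hsum, Z, this, X, ← mul_assoc, h.m_comm]
    simp only [mul_assoc]
    congr 1
    simp only [← mul_assoc]
    rw [h.m_comm]
  rw [hsum, h.y_add, ← hsum, e4, dist_comm] at h4
  rw [e2, add_comm (bit l)] at h2
  rw [e3] at h3
  have t1 := dist_triangle _ _ _ |>.trans (add_le_add h4 h1)
  have t2 := dist_triangle _ _ _ |>.trans (add_le_add t1 h2)
  have t3 := dist_triangle _ _ _ |>.trans (add_le_add t2 h3)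
  rw [dist_mul_left] at t3
  have hinv : AlmostRightInvariant (n * τ) (x (s + bit l))⁻¹ := by
    rw [bits_map_inv X]; exact map_ari X hτ h.x_bit _
  have t4 := hinv.dist_le_of_mul_right t3
  have h5 := dist_mul_left_le (m * z (bit k)) (h.comm_local k l hlk.symm)
  have e5 : m * z (bit k) * (x (bit k) * z (bit l)) = m * (z (bit k) * x (bit k)) * z (bit l) := by
    simp only [mul_assoc]
  have e6 : m * z (bit k) * (z (bit l) * x (bit k)) = m * z (bit k + bit l) * x (bit k) := by
    rw [Z]; simp only [mul_assoc]
  rw [e5, e6] at h5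
  have t5 := dist_triangle _ _ _ |>.trans (add_le_add h5 t4)
  rw [Z, ← mul_assoc (x (bit k))] at t5
  have hinv' : AlmostRightInvariant τ (z (bit l))⁻¹ := by
    rw [bits_map_inv Z]; exact h.z_bit l
  have t6 := hinv'.dist_le_of_mul_right t5
  rw [dist_comm]
  refine t6.trans ?_
  have hrn : (n : ℝ) = 4 * r + 3 := by exact_mod_cast hr
  have hr0 : (0 : ℝ) ≤ r := Nat.cast_nonneg r
  calc _ = (r * (84 * n + 84) + 26 * n + 29) * τ := by ring
    _ ≤ _ := by
      refine mul_le_mul_of_nonneg_right ?_ hτ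
      rw [hrn]; nlinarith

/-- Every `x a` commutes with `Z_j` up to the sign expected of Pauli operators. -/
theorem comm_signed (h : CheckRelations τ x y z m) (hn : n % 4 = 3) (j : Fin n)
    (a : Fin n → Fin 2) :
    dist (x a * z (bit j)) ((if a j = 1 then m else 1) * (z (bit j) * x a))
      ≤ 120 * (n : ℝ) ^ 2 * τ := by
  have X := h.x_add
  have hτ := h.tau_nonneg (Fin.pos j)
  have hn3 : (3 : ℝ) ≤ n := by exact_mod_cast (by omega : 3 ≤ n)
  by_cases ha : a j = 1
  · have ha' : (a + bit j) j = 0 := by simp [ha]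
    have h1 := dist_mul_left_le (x (a + bit j)) (h.anticomm hn j)
    have h2 := dist_mul_left_le m ((h.x_bit j).dist_mul_right_le (h.comm_of_apply_eq_zero j _ ha'))
    have e0 : x a = x (a + bit j) * x (bit j) := by
      rw [← X, add_assoc, bits_add_self, add_zero]
    have e1 : x (a + bit j) * (m * (z (bit j) * x (bit j)))
        = m * (x (a + bit j) * z (bit j) * x (bit j)) := by
      rw [← mul_assoc, ← h.m_comm]; simp only [mul_assoc]
    rw [e1] at h1
    have t1 := dist_triangle _ _ _ |>.trans (add_le_add h1 h2)
    rw [if_pos ha, e0]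
    rw [mul_assoc (x _) (x _), ← mul_assoc (z (bit j)) (x _)]
    refine t1.trans ?_
    calc _ = (110 * (n : ℝ) ^ 2 + 6 * n + 2) * τ := by ring
      _ ≤ _ := mul_le_mul_of_nonneg_right (by nlinarith) hτ
  · have ha' : a j = 0 := by revert ha; generalize a j = t; revert t; decide
    rw [if_neg ha, one_mul]
    refine (h.comm_of_apply_eq_zero j a ha').trans (mul_le_mul_of_nonneg_right (by nlinarith) hτ)

end CheckRelations

/-! ### Operators on the joint space -/

section Generic
variable {E : Type*} [NormedAddCommGroup E] [InnerProductSpace ℂ E]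

/-- The isometric embedding of an inner product space into its completion. -/
def toCompletion (E : Type*) [NormedAddCommGroup E] [InnerProductSpace ℂ E] :
    E →ₗᵢ[ℂ] UniformSpace.Completion E :=
  UniformSpace.Completion.toComplₗᵢ

theorem inner_toCompletion (x y : E) :
    inner ℂ (toCompletion E x) (toCompletion E y) = inner ℂ x y :=
  UniformSpace.Completion.inner_coe x y

theorem completion_toCompletion {F : Type*} [NormedAddCommGroup F] [InnerProductSpace ℂ F]
    (f : E →L[ℂ] F) (x : E) : f.completion (toCompletion E x) = toCompletion F (f x) :=
  f.completion_apply_coe x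

theorem clm_ext_toCompletion {F : Type*} [NormedAddCommGroup F] [NormedSpace ℂ F]
    {f g : UniformSpace.Completion E →L[ℂ] F}
    (h : ∀ x, f (toCompletion E x) = g (toCompletion E x)) : f = g := by
  ext x
  induction x using UniformSpace.Completion.induction_on with
  | hp => exact isClosed_eq f.continuous g.continuous
  | ih t => exact h t

/-- Two operators that scale the inner products of the vectors of a total family by `c` scale all
inner products by `c`. -/
theorem inner_map_of_total {F : Type*} [NormedAddCommGroup F] [InnerProductSpace ℂ F]
    {ι : Type*} (v : ι → E) (hv : ∀ f g : E →L[ℂ] ℂ, (∀ i, f (v i) = g (v i)) → f = g)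
    {T T' : E →L[ℂ] F} {c : ℂ}
    (h : ∀ i j, inner ℂ (T (v i)) (T' (v j)) = c * inner ℂ (v i) (v j)) (x y : E) :
    inner ℂ (T x) (T' y) = c * inner ℂ x y := by
  have h1 : ∀ i y, inner ℂ (T (v i)) (T' y) = c * inner ℂ (v i) y := by
    intro i y
    have : (innerSL ℂ (T (v i))).comp T' = c • innerSL ℂ (v i) := hv _ _ fun j => h i j
    exact DFunLike.congr_fun this y
  have h2 : (innerSL ℂ (T' y)).comp T = (starRingEnd ℂ c) • innerSL ℂ y := by
    refine hv _ _ fun i => ?_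
    change inner ℂ (T' y) (T (v i)) = starRingEnd ℂ c * inner ℂ y (v i)
    rw [← inner_conj_symm, h1, map_mul, inner_conj_symm]
  have h3 : inner ℂ (T' y) (T x) = starRingEnd ℂ c * inner ℂ y x := DFunLike.congr_fun h2 x
  rw [← inner_conj_symm, h3, map_mul, inner_conj_symm, Complex.conj_conj]

theorem norm_eq_of_inner {F : Type*} [NormedAddCommGroup F] [InnerProductSpace ℂ F] {x : E} {y : F}
    (h : inner ℂ x x = inner ℂ y y) : ‖x‖ = ‖y‖ := by
  rw [inner_self_eq_norm_sq_to_K (𝕜 := ℂ), inner_self_eq_norm_sq_to_K (𝕜 := ℂ)] at h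
  have h' : ‖x‖ ^ 2 = ‖y‖ ^ 2 := by exact_mod_cast h
  exact (sq_eq_sq₀ (norm_nonneg _) (norm_nonneg _)).mp h'

end Generic

section JointLemmas

variable {HA : Type u} {HB : Type v} {HP : Type w}
  [NormedAddCommGroup HA] [InnerProductSpace ℂ HA]
  [NormedAddCommGroup HB] [InnerProductSpace ℂ HB]
  [NormedAddCommGroup HP] [InnerProductSpace ℂ HP]

variable (HA HB HP) in
/-- The embedding of the algebraic tensor product into the joint Hilbert space. -/
def toJoint : (HA ⊗[ℂ] HB) ⊗[ℂ] HP →ₗᵢ[ℂ] Joint HA HB HP :=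
  toCompletion ((HA ⊗[ℂ] HB) ⊗[ℂ] HP)

theorem inner_toJoint (s t : (HA ⊗[ℂ] HB) ⊗[ℂ] HP) :
    inner ℂ (toJoint HA HB HP s) (toJoint HA HB HP t) = inner ℂ s t :=
  inner_toCompletion (E := (HA ⊗[ℂ] HB) ⊗[ℂ] HP) s t

theorem inner_toJoint_tmul (s t : HA ⊗[ℂ] HB) (p q : HP) :
    inner ℂ (toJoint HA HB HP (s ⊗ₜ[ℂ] p)) (toJoint HA HB HP (t ⊗ₜ[ℂ] q))
      = inner ℂ s t * inner ℂ p q :=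
  (inner_toJoint _ _).trans (inner_tmul ℂ s t p q)

/-- The product vector `a ⊗ b ⊗ p`. -/
def pure (a : HA) (b : HB) (p : HP) : Joint HA HB HP :=
  toJoint HA HB HP ((a ⊗ₜ[ℂ] b) ⊗ₜ[ℂ] p)

theorem clm_ext_pure {F : Type*} [NormedAddCommGroup F] [NormedSpace ℂ F]
    {f g : Joint HA HB HP →L[ℂ] F} (h : ∀ a b p, f (pure a b p) = g (pure a b p)) : f = g := by
  refine clm_ext_toCompletion fun x => ?_
  have : f.toLinearMap ∘ₗ (toJoint HA HB HP).toLinearMap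
    = g.toLinearMap ∘ₗ (toJoint HA HB HP).toLinearMap := TensorProduct.ext_threefold h
  exact LinearMap.congr_fun this x

theorem inner_pure (a a' : HA) (b b' : HB) (p p' : HP) :
    inner ℂ (pure a b p) (pure a' b' p') = inner ℂ a a' * inner ℂ b b' * inner ℂ p p' := by
  rw [pure, pure, inner_toJoint_tmul, inner_tmul]

theorem inner_map_of_pure {F : Type*} [NormedAddCommGroup F] [InnerProductSpace ℂ F]
    {T T' : Joint HA HB HP →L[ℂ] F} {c : ℂ}
    (h : ∀ a b p a' b' p', inner ℂ (T (pure a b p)) (T' (pure a' b' p'))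
      = c * inner ℂ (pure a b p) (pure a' b' p')) (x y : Joint HA HB HP) :
    inner ℂ (T x) (T' y) = c * inner ℂ x y :=
  inner_map_of_total (fun t : HA × HB × HP => pure t.1 t.2.1 t.2.2)
    (fun _ _ hfg => clm_ext_pure fun a b p => hfg (a, b, p))
    (fun s t => h s.1 s.2.1 s.2.2 t.1 t.2.1 t.2.2) x y

variable {KA LA : Type u} {KB LB : Type v}
  [NormedAddCommGroup KA] [InnerProductSpace ℂ KA] [NormedAddCommGroup KB] [InnerProductSpace ℂ KB]
  [NormedAddCommGroup LA] [InnerProductSpace ℂ LA] [NormedAddCommGroup LB] [InnerProductSpace ℂ LB]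

theorem localOp_pure (A : HA →L[ℂ] KA) (B : HB →L[ℂ] KB) (a : HA) (b : HB) (p : HP) :
    localOp HP A B (pure a b p) = pure (A a) (B b) p :=
  localOp_tmul HP A B a b p

theorem pure_add_left (a a' : HA) (b : HB) (p : HP) :
    pure (a + a') b p = pure a b p + pure a' b p := by
  rw [pure, add_tmul, add_tmul, map_add]; rfl

theorem pure_add_mid (a : HA) (b b' : HB) (p : HP) :
    pure a (b + b') p = pure a b p + pure a b' p := by
  rw [pure, tmul_add, add_tmul, map_add]; rfl

theorem pure_smul_left (c : ℂ) (a : HA) (b : HB) (p : HP) :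
    pure (c • a) b p = c • pure a b p := by
  rw [pure, ← smul_tmul', ← smul_tmul', map_smul]; rfl

theorem pure_smul_mid (c : ℂ) (a : HA) (b : HB) (p : HP) :
    pure a (c • b) p = c • pure a b p := by
  rw [pure, tmul_smul, ← smul_tmul', map_smul]; rfl

theorem localOp_comp (A : KA →L[ℂ] LA) (B : KB →L[ℂ] LB) (A' : HA →L[ℂ] KA) (B' : HB →L[ℂ] KB)
    (x : Joint HA HB HP) :
    localOp HP A B (localOp HP A' B' x) = localOp HP (A.comp A') (B.comp B') x := by
  have : (localOp HP A B).comp (localOp HP A' B') = localOp HP (A.comp A') (B.comp B') :=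
    clm_ext_pure fun a b p => by
      rw [ContinuousLinearMap.comp_apply, localOp_pure, localOp_pure, localOp_pure]; rfl
  exact DFunLike.congr_fun this x

theorem localOp_one (x : Joint HA HB HP) :
    localOp HP (1 : HA →L[ℂ] HA) (1 : HB →L[ℂ] HB) x = x := by
  have : localOp HP (1 : HA →L[ℂ] HA) (1 : HB →L[ℂ] HB) = ContinuousLinearMap.id ℂ _ :=
    clm_ext_pure fun a b p => localOp_pure _ _ _ _ _
  exact DFunLike.congr_fun this x

theorem localOp_add_left (A A' : HA →L[ℂ] KA) (B : HB →L[ℂ] KB) :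
    localOp HP (A + A') B = localOp HP A B + localOp HP A' B :=
  clm_ext_pure fun a b p => by
    rw [add_apply, localOp_pure, localOp_pure, localOp_pure, ← pure_add_left]; rfl

theorem localOp_add_right (A : HA →L[ℂ] KA) (B B' : HB →L[ℂ] KB) :
    localOp HP A (B + B') = localOp HP A B + localOp HP A B' :=
  clm_ext_pure fun a b p => by
    rw [add_apply, localOp_pure, localOp_pure, localOp_pure, ← pure_add_mid]; rfl

theorem localOp_smul_left (c : ℂ) (A : HA →L[ℂ] KA) (B : HB →L[ℂ] KB) :
    localOp HP (c • A) B = c • localOp HP A B :=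
  clm_ext_pure fun a b p => by
    rw [smul_apply, localOp_pure, localOp_pure, ← pure_smul_left]; rfl

theorem localOp_smul_right (c : ℂ) (A : HA →L[ℂ] KA) (B : HB →L[ℂ] KB) :
    localOp HP A (c • B) = c • localOp HP A B :=
  clm_ext_pure fun a b p => by
    rw [smul_apply, localOp_pure, localOp_pure, ← pure_smul_mid]; rfl

theorem inner_localOp {A A' : HA →L[ℂ] KA} {B B' : HB →L[ℂ] KB} {α β : ℂ}
    (hA : ∀ x y, inner ℂ (A x) (A' y) = α * inner ℂ x y)
    (hB : ∀ x y, inner ℂ (B x) (B' y) = β * inner ℂ x y) (x y : Joint HA HB HP) :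
    inner ℂ (localOp HP A B x) (localOp HP A' B' y) = α * β * inner ℂ x y := by
  refine inner_map_of_pure (F := Joint KA KB HP) (fun a b p a' b' p' => ?_) x y
  rw [localOp_pure, localOp_pure, inner_pure, inner_pure, hA, hB]; ring

theorem norm_localOp (A : HA →L[ℂ] KA) (B : HB →L[ℂ] KB) (hA : ∀ x, ‖A x‖ = ‖x‖)
    (hB : ∀ x, ‖B x‖ = ‖x‖) (x : Joint HA HB HP) : ‖localOp HP A B x‖ = ‖x‖ := by
  let iA : HA →ₗᵢ[ℂ] KA := ⟨A.toLinearMap, hA⟩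
  let iB : HB →ₗᵢ[ℂ] KB := ⟨B.toLinearMap, hB⟩
  have h := inner_localOp (HP := HP) (A := A) (A' := A) (B := B) (B' := B) (α := 1) (β := 1)
    (fun x y => (iA.inner_map_map x y).trans (one_mul _).symm)
    (fun x y => (iB.inner_map_map x y).trans (one_mul _).symm) x x
  rw [one_mul, one_mul] at h
  exact norm_eq_of_inner h

/-! ### States tensored with junk -/

variable {QA QB : Type} [NormedAddCommGroup QA] [InnerProductSpace ℂ QA]
  [NormedAddCommGroup QB] [InnerProductSpace ℂ QB]

theorem withJunkL_tmul_pure (q : QA) (r : QB) (a : KA) (b : KB) (p : HP) :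
    withJunkL KA KB HP (q ⊗ₜ[ℂ] r) (pure a b p) = pure (q ⊗ₜ[ℂ] a) (r ⊗ₜ[ℂ] b) p :=
  withJunk_tmul q r a b p

theorem withJunkL_pure (φ : QA ⊗[ℂ] QB) (a : KA) (b : KB) (p : HP) :
    withJunkL KA KB HP φ (pure a b p)
      = toJoint (QA ⊗[ℂ] KA) (QB ⊗[ℂ] KB) HP
        ((interleave QA QB KA KB (φ ⊗ₜ[ℂ] (a ⊗ₜ[ℂ] b))) ⊗ₜ[ℂ] p) :=
  completion_toCompletion _ _

theorem inner_withJunkL (φ φ' : QA ⊗[ℂ] QB) (x y : Joint KA KB HP) :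
    inner ℂ (withJunkL KA KB HP φ x) (withJunkL KA KB HP φ' y) = inner ℂ φ φ' * inner ℂ x y := by
  refine inner_map_of_pure (F := Joint (QA ⊗[ℂ] KA) (QB ⊗[ℂ] KB) HP)
    (fun a b p a' b' p' => ?_) x y
  have h := LinearIsometryEquiv.inner_map_map (𝕜 := ℂ) (E := (QA ⊗[ℂ] QB) ⊗[ℂ] (KA ⊗[ℂ] KB))
    (E' := (QA ⊗[ℂ] KA) ⊗[ℂ] (QB ⊗[ℂ] KB)) (interleave QA QB KA KB)
    (φ ⊗ₜ[ℂ] (a ⊗ₜ[ℂ] b)) (φ' ⊗ₜ[ℂ] (a' ⊗ₜ[ℂ] b'))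
  rw [inner_tmul, inner_tmul] at h
  rw [withJunkL_pure, withJunkL_pure, inner_pure, inner_toJoint_tmul, h]
  ring

theorem withJunkL_add (φ φ' : QA ⊗[ℂ] QB) :
    withJunkL KA KB HP (φ + φ') = withJunkL KA KB HP φ + withJunkL KA KB HP φ' :=
  clm_ext_pure fun a b p => by
    rw [add_apply, withJunkL_pure, withJunkL_pure, withJunkL_pure, add_tmul, map_add, add_tmul,
      map_add]

theorem withJunkL_smul (c : ℂ) (φ : QA ⊗[ℂ] QB) :
    withJunkL KA KB HP (c • φ) = c • withJunkL KA KB HP φ :=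
  clm_ext_pure fun a b p => by
    rw [smul_apply, withJunkL_pure, withJunkL_pure, ← smul_tmul', map_smul, ← smul_tmul', map_smul]

theorem mapL_interleave (σ : QA →L[ℂ] QA) (ρ : QB →L[ℂ] QB) (φ : QA ⊗[ℂ] QB) (a : KA) (b : KB) :
    mapL (mapL σ (.id ℂ KA)) (mapL ρ (.id ℂ KB)) (interleave QA QB KA KB (φ ⊗ₜ[ℂ] (a ⊗ₜ[ℂ] b)))
      = interleave QA QB KA KB (mapL σ ρ φ ⊗ₜ[ℂ] (a ⊗ₜ[ℂ] b)) := by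
  induction φ using TensorProduct.induction_on with
  | zero =>
    rw [zero_tmul, LinearIsometryEquiv.map_zero, ContinuousLinearMap.map_zero,
      ContinuousLinearMap.map_zero, zero_tmul, LinearIsometryEquiv.map_zero]
  | add φ φ' h h' =>
    rw [add_tmul, LinearIsometryEquiv.map_add, ContinuousLinearMap.map_add,
      ContinuousLinearMap.map_add, add_tmul, LinearIsometryEquiv.map_add, h, h']
  | tmul q r =>
    rw [interleave_tmul, mapL_tmul, mapL_tmul, mapL_tmul, mapL_tmul, interleave_tmul]
    rfl

theorem localOp_toJoint (A : HA →L[ℂ] KA) (B : HB →L[ℂ] KB) (t : HA ⊗[ℂ] HB) (p : HP) :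
    localOp HP A B (toJoint HA HB HP (t ⊗ₜ[ℂ] p)) = toJoint KA KB HP (mapL A B t ⊗ₜ[ℂ] p) :=
  completion_toCompletion _ _

theorem localOp_withJunkL (σ : QA →L[ℂ] QA) (ρ : QB →L[ℂ] QB) (φ : QA ⊗[ℂ] QB)
    (x : Joint KA KB HP) :
    localOp HP (mapL σ (.id ℂ KA)) (mapL ρ (.id ℂ KB)) (withJunkL KA KB HP φ x)
      = withJunkL KA KB HP (mapL σ ρ φ) x := by
  have : (localOp HP (mapL σ (.id ℂ KA)) (mapL ρ (.id ℂ KB))).comp (withJunkL KA KB HP φ)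
      = withJunkL KA KB HP (mapL σ ρ φ) := clm_ext_pure fun a b p => by
    rw [ContinuousLinearMap.comp_apply, withJunkL_pure, withJunkL_pure, localOp_toJoint,
      mapL_interleave]
  exact DFunLike.congr_fun this x

end JointLemmas

/-! ### Families of isometries with orthogonal ranges -/

section Orthogonal

variable {ι E F : Type*} [Fintype ι] [DecidableEq ι] [NormedAddCommGroup E] [InnerProductSpace ℂ E]
  [NormedAddCommGroup F] [InnerProductSpace ℂ F]

/-- The operators `L p` are isometries with pairwise orthogonal ranges. -/
def OrthogonalIsometries (L : ι → E →L[ℂ] F) : Prop :=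
  ∀ p q x y, inner ℂ (L p x) (L q y) = (if p = q then 1 else 0) * inner ℂ x y

theorem OrthogonalIsometries.norm_sq_sum {L : ι → E →L[ℂ] F} (hL : OrthogonalIsometries L)
    (x : ι → E) : ‖∑ p, L p (x p)‖ ^ 2 = ∑ p, ‖x p‖ ^ 2 := by
  have : (inner ℂ (∑ p, L p (x p)) (∑ p, L p (x p)) : ℂ) = ∑ p, inner ℂ (x p) (x p) := by
    rw [sum_inner]
    refine Finset.sum_congr rfl fun p _ => ?_
    rw [inner_sum, Finset.sum_eq_single p]
    · rw [hL, if_pos rfl, one_mul]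
    · intro q _ hq
      rw [hL, if_neg hq.symm, zero_mul]
    · simp
  simp only [inner_self_eq_norm_sq_to_K] at this
  exact_mod_cast this

/-- The normalized sum of vectors from orthogonal ranges: its norm is a root mean square. -/
theorem OrthogonalIsometries.norm_avg_le {L : ι → E →L[ℂ] F} (hL : OrthogonalIsometries L)
    {c : ℝ} (hc : c ^ 2 * Fintype.card ι = 1) {δ : ℝ} (hδ : 0 ≤ δ) (x : ι → E)
    (hx : ∀ p, ‖x p‖ ≤ δ) : ‖(c : ℂ) • ∑ p, L p (x p)‖ ≤ δ := by
  refine (sq_le_sq₀ (norm_nonneg _) hδ).mp ?_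
  rw [norm_smul, mul_pow, hL.norm_sq_sum, Complex.norm_real, Real.norm_eq_abs, sq_abs]
  calc c ^ 2 * ∑ p, ‖x p‖ ^ 2 ≤ c ^ 2 * ∑ _p : ι, δ ^ 2 := by
        gcongr with p
        exact hx p
    _ = δ ^ 2 := by
        rw [Finset.sum_const, Finset.card_univ, nsmul_eq_mul, ← mul_assoc, hc, one_mul]

theorem OrthogonalIsometries.norm_avg_eq {L : ι → E →L[ℂ] F} (hL : OrthogonalIsometries L)
    {c : ℝ} (hc : c ^ 2 * Fintype.card ι = 1) {δ : ℝ} (hδ : 0 ≤ δ) (x : ι → E)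
    (hx : ∀ p, ‖x p‖ = δ) : ‖(c : ℂ) • ∑ p, L p (x p)‖ = δ := by
  refine (sq_eq_sq₀ (norm_nonneg _) hδ).mp ?_
  rw [norm_smul, mul_pow, hL.norm_sq_sum, Complex.norm_real, Real.norm_eq_abs, sq_abs]
  simp only [hx]
  rw [Finset.sum_const, Finset.card_univ, nsmul_eq_mul, ← mul_assoc, hc, one_mul]

/-- If `S` permutes the ranges of the `L p` up to scalars, then the distance between the
superposition of the `y p` and the image under `S` of that of the `w p` is at most the largest of
the distances between corresponding terms. -/
theorem OrthogonalIsometries.norm_avg_sub_map_le {L : ι → E →L[ℂ] F}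
    (hL : OrthogonalIsometries L) {c : ℝ} (hc : c ^ 2 * Fintype.card ι = 1) {δ : ℝ} (hδ : 0 ≤ δ)
    (S : F →L[ℂ] F) (π : Equiv.Perm ι) (s : ι → ℂ) (hS : ∀ p x, S (L (π p) x) = s p • L p x)
    (y w : ι → E) (h : ∀ p, ‖y p - s p • w (π p)‖ ≤ δ) :
    ‖(c : ℂ) • ∑ p, L p (y p) - S ((c : ℂ) • ∑ p, L p (w p))‖ ≤ δ := by
  have : (c : ℂ) • ∑ p, L p (y p) - S ((c : ℂ) • ∑ p, L p (w p))
      = (c : ℂ) • ∑ p, L p (y p - s p • w (π p)) := by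
    rw [map_smul, ← smul_sub, map_sum, ← Equiv.sum_comp π (fun p => S (L p (w p))),
      ← Finset.sum_sub_distrib]
    simp [hS]
  rw [this]
  exact hL.norm_avg_le hc hδ _ h

end Orthogonal

/-! ### The Bell basis -/

theorem inner_smul_sum_smul {E ι : Type*} [NormedAddCommGroup E] [InnerProductSpace ℂ E] [Fintype ι]
    (c d : ℂ) (f g : ι → ℂ) (v w : ι → E) :
    inner ℂ (c • ∑ i, f i • v i) (d • ∑ i, g i • w i)
      = starRingEnd ℂ c * d * ∑ i, ∑ j, starRingEnd ℂ (f i) * g j * inner ℂ (v i) (w j) := by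
  rw [inner_smul_left, inner_smul_right, sum_inner, mul_assoc]
  simp only [inner_sum, inner_smul_left, inner_smul_right, mul_assoc, mul_left_comm]

section Qubit

variable {n : ℕ}

/-- The computational basis vector `|s⟩`. -/
def ket (s : Fin n → Fin 2) : Qubits n := EuclideanSpace.single s 1

theorem inner_ket (s t : Fin n → Fin 2) :
    inner ℂ (ket s) (ket t) = if s = t then (1 : ℂ) else 0 := by
  simp [ket, EuclideanSpace.inner_single_left]

/-- The character `(-1) ^ (b · s)`. -/
def character (b s : Fin n → Fin 2) : ℂ := ∏ j, if b j = 1 ∧ s j = 1 then -1 else 1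

theorem character_add_left (b b' s : Fin n → Fin 2) :
    character (b + b') s = character b s * character b' s := by
  rw [character, character, character, ← Finset.prod_mul_distrib]
  refine Finset.prod_congr rfl fun j _ => ?_
  rw [Pi.add_apply]
  generalize b j = x; generalize b' j = y; generalize s j = z
  fin_cases x <;> fin_cases y <;> fin_cases z <;> norm_num [Fin.ext_iff]

theorem character_comm (b s : Fin n → Fin 2) : character b s = character s b := by
  simp only [character, and_comm]

theorem character_bit (i : Fin n) (s : Fin n → Fin 2) :
    character (bit i) s = if s i = 1 then -1 else 1 := by
  rw [character, Finset.prod_eq_single i]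
  · simp
  · intro j _ hj; simp [hj]
  · simp

theorem conj_character (b s : Fin n → Fin 2) : starRingEnd ℂ (character b s) = character b s := by
  rw [character, map_prod]
  refine Finset.prod_congr rfl fun j _ => ?_
  split_ifs <;> simp

theorem sum_character (b : Fin n → Fin 2) :
    ∑ s, character b s = if b = 0 then (2 : ℂ) ^ n else 0 := by
  have h : ∑ s : Fin n → Fin 2, character b s
      = ∏ j, ∑ t : Fin 2, if b j = 1 ∧ t = 1 then (-1 : ℂ) else 1 := by
    rw [Finset.prod_univ_sum, Fintype.piFinset_univ]; rfl
  rw [h]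
  split_ifs with hb
  · subst hb; simp
  · obtain ⟨j, hj⟩ := Function.ne_iff.mp hb
    refine Finset.prod_eq_zero (Finset.mem_univ j) ?_
    have : b j = 1 := by revert hj; simp only [Pi.zero_apply]; generalize b j = t; revert t; decide
    simp [this]

/-- The pairs `(a, b)` of exponents of the Pauli operators `X^a Z^b` on `n` qubits. -/
abbrev PauliIndex (n : ℕ) : Type := (Fin n → Fin 2) × (Fin n → Fin 2)

/-- The normalization `2 ^ (-n/2)` of a maximally entangled state. -/
def bellNorm (n : ℕ) : ℝ := (1 / Real.sqrt 2) ^ n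

theorem bellNorm_sq (n : ℕ) : bellNorm n ^ 2 * 2 ^ n = 1 := by
  rw [bellNorm, ← pow_mul, mul_comm n 2, pow_mul, ← mul_pow, div_pow, Real.sq_sqrt (by norm_num)]
  norm_num

/-- The Bell basis: `(X^a Z^b ⊗ 1) |Φ⁺⟩^{⊗ n}`. -/
def bellBasis (p : PauliIndex n) : Qubits n ⊗[ℂ] Qubits n :=
  (bellNorm n : ℂ) • ∑ s, character p.2 s • (ket (s + p.1) ⊗ₜ[ℂ] ket s)

theorem inner_bellBasis (p q : PauliIndex n) :
    inner ℂ (bellBasis p) (bellBasis q) = if p = q then (1 : ℂ) else 0 := by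
  obtain ⟨a, b⟩ := p
  obtain ⟨a', b'⟩ := q
  refine (inner_smul_sum_smul (E := Qubits n ⊗[ℂ] Qubits n) _ _ _ _ _ _).trans ?_
  have h : ∀ s t : Fin n → Fin 2, starRingEnd ℂ (character b s) * character b' t
      * inner ℂ (ket (s + a) ⊗ₜ[ℂ] ket s) (ket (t + a') ⊗ₜ[ℂ] ket t)
      = if s = t then (if a = a' then character (b + b') s else 0) else (0 : ℂ) := by
    intro s t
    rw [inner_tmul, inner_ket, inner_ket, conj_character, character_add_left]
    by_cases hst : s = t
    · subst hst; simp
    · simp [hst]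
  simp only [h, Finset.sum_ite_eq, Finset.mem_univ, if_true, Prod.mk.injEq]
  by_cases ha : a = a'
  · simp only [ha, if_true, sum_character, true_and, Complex.conj_ofReal]
    have hb : b + b' = 0 ↔ b = b' :=
      ⟨bits_eq_of_add_eq_zero, fun h => h ▸ bits_add_self _⟩
    simp only [hb]
    split_ifs
    · have := bellNorm_sq n
      rw [← sq]
      exact_mod_cast this
    · simp
  · simp [ha]

theorem span_bellBasis : Submodule.span ℂ (Set.range (bellBasis (n := n))) = ⊤ := by
  have ho : Orthonormal ℂ (bellBasis (n := n)) := orthonormal_iff_ite.mpr inner_bellBasis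
  refine ho.linearIndependent.span_eq_top_of_card_eq_finrank' ?_
  rw [Module.finrank_tensorProduct]
  simp

theorem onQubit_ket (σ : Matrix (Fin 2) (Fin 2) ℂ) (i : Fin n) (s : Fin n → Fin 2) :
    onQubit σ i (ket s) = ∑ t, (∏ j, (if j = i then σ else 1) (t j) (s j)) • ket t := by
  ext u
  rw [onQubit, Matrix.ofLp_toEuclideanCLM]
  simp [ket, Pi.single_apply]

theorem onQubit_pauliX_ket (i : Fin n) (s : Fin n → Fin 2) :
    onQubit pauliX i (ket s) = ket (s + bit i) := by
  rw [onQubit_ket, Finset.sum_eq_single (s + bit i)]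
  · rw [Finset.prod_eq_one, one_smul]
    intro j _
    by_cases hj : j = i
    · subst hj
      simp only [if_true, Pi.add_apply, Pi.single_eq_same]
      generalize s j = t; revert t; simp [pauliX]
    · have : (s + bit i) j = s j := by simp [hj]
      rw [if_neg hj, this, Matrix.one_apply_eq]
  · intro t _ ht
    obtain ⟨j, hj⟩ := Function.ne_iff.mp ht
    rw [Finset.prod_eq_zero (Finset.mem_univ j), zero_smul]
    by_cases hji : j = i
    · subst hji
      simp only [if_true, Pi.add_apply, Pi.single_eq_same] at hj ⊢
      revert hj; generalize s j = x; generalize t j = y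
      fin_cases x <;> fin_cases y <;> simp [pauliX]
    · simp only [Pi.add_apply, Pi.single_apply, hji, if_false, add_zero] at hj
      simp [hji, hj]
  · simp

theorem onQubit_pauliZ_ket (i : Fin n) (s : Fin n → Fin 2) :
    onQubit pauliZ i (ket s) = character (bit i) s • ket s := by
  rw [onQubit_ket, Finset.sum_eq_single s, character_bit]
  · congr 1
    rw [Finset.prod_eq_single i]
    · rw [if_pos rfl]; generalize s i = x; fin_cases x <;> simp [pauliZ]
    · intro j _ hj; simp [hj]
    · simp
  · intro t _ ht
    obtain ⟨j, hj⟩ := Function.ne_iff.mp ht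
    rw [Finset.prod_eq_zero (Finset.mem_univ j), zero_smul]
    by_cases hji : j = i
    · subst hji
      rw [if_pos rfl]
      revert hj; generalize s j = x; generalize t j = y
      fin_cases x <;> fin_cases y <;> simp [pauliZ]
    · simp [hji, hj]
  · simp

theorem pauliX_left_bellBasis (i : Fin n) (p : PauliIndex n) :
    mapL (onQubit pauliX i) (.id ℂ (Qubits n)) (bellBasis p) = bellBasis (p.1 + bit i, p.2) := by
  simp only [bellBasis, map_smul, map_sum, mapL_tmul, onQubit_pauliX_ket, add_assoc]
  rfl

theorem pauliZ_left_bellBasis (i : Fin n) (p : PauliIndex n) :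
    mapL (onQubit pauliZ i) (.id ℂ (Qubits n)) (bellBasis p)
      = character (bit i) p.1 • bellBasis (p.1, p.2 + bit i) := by
  simp only [bellBasis, map_smul, map_sum, mapL_tmul, onQubit_pauliZ_ket]
  rw [smul_comm (character (bit i) p.1), Finset.smul_sum (r := character (bit i) p.1)]
  refine congrArg ((bellNorm n : ℂ) • ·) (Finset.sum_congr rfl fun s _ => ?_)
  rw [character_add_left, character_comm (bit i) (s + p.1), character_add_left, smul_tmul',
    smul_smul, smul_smul, ← smul_tmul', character_comm s, character_comm p.1]
  simp only [ContinuousLinearMap.id_apply]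
  congr 1
  ring

theorem pauliX_right_bellBasis (i : Fin n) (p : PauliIndex n) :
    mapL (.id ℂ (Qubits n)) (onQubit pauliX i) (bellBasis p)
      = character (bit i) p.2 • bellBasis (p.1 + bit i, p.2) := by
  simp only [bellBasis, map_smul, map_sum, mapL_tmul, onQubit_pauliX_ket]
  rw [smul_comm (character (bit i) p.2), Finset.smul_sum (r := character (bit i) p.2),
    ← Equiv.sum_comp (Equiv.addRight (bit i))]
  refine congrArg ((bellNorm n : ℂ) • ·) (Finset.sum_congr rfl fun s _ => ?_)
  simp only [Equiv.coe_addRight, ContinuousLinearMap.id_apply]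
  rw [character_comm, character_add_left, smul_smul, character_comm s, mul_comm, add_assoc s,
    add_assoc s, add_comm (bit i), bits_add_self, add_zero]

theorem pauliZ_right_bellBasis (i : Fin n) (p : PauliIndex n) :
    mapL (.id ℂ (Qubits n)) (onQubit pauliZ i) (bellBasis p) = bellBasis (p.1, p.2 + bit i) := by
  simp only [bellBasis, map_smul, map_sum, mapL_tmul, onQubit_pauliZ_ket]
  refine congrArg ((bellNorm n : ℂ) • ·) (Finset.sum_congr rfl fun s _ => ?_)
  rw [character_add_left, tmul_smul, smul_smul]
  rfl

theorem bellStates_eq : bellStates n = bellBasis (0, 0) := by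
  rw [bellStates, bellBasis, Finset.smul_sum]
  refine Finset.sum_congr rfl fun s _ => ?_
  rw [Finset.sum_eq_single s]
  · have : character (0 : Fin n → Fin 2) s = 1 := by simp [character]
    rw [this, one_smul, add_zero]
    congr 1
    simp [bellAmplitude, bellNorm]
  · intro t _ ht
    obtain ⟨j, hj⟩ := Function.ne_iff.mp ht
    rw [Finset.prod_eq_zero (Finset.mem_univ j) (if_neg hj.symm), zero_smul]
  · simp

end Qubit

/-! ### The joint space without its construction -/

section JointSpace

/-- The joint Hilbert space `Joint HA HB HP`. As a definition of its own it hides the construction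
from instance search. -/
def JointSpace (HA : Type u) (HB : Type v) (HP : Type w)
    [NormedAddCommGroup HA] [InnerProductSpace ℂ HA]
    [NormedAddCommGroup HB] [InnerProductSpace ℂ HB]
    [NormedAddCommGroup HP] [InnerProductSpace ℂ HP] : Type (max u v w) :=
  Joint HA HB HP

variable {HA KA LA : Type u} {HB KB LB : Type v} {HP : Type w}
  [NormedAddCommGroup HA] [InnerProductSpace ℂ HA]
  [NormedAddCommGroup HB] [InnerProductSpace ℂ HB]
  [NormedAddCommGroup HP] [InnerProductSpace ℂ HP]
  [NormedAddCommGroup KA] [InnerProductSpace ℂ KA] [NormedAddCommGroup KB] [InnerProductSpace ℂ KB]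
  [NormedAddCommGroup LA] [InnerProductSpace ℂ LA] [NormedAddCommGroup LB] [InnerProductSpace ℂ LB]

instance : NormedAddCommGroup (JointSpace HA HB HP) :=
  inferInstanceAs (NormedAddCommGroup (UniformSpace.Completion ((HA ⊗[ℂ] HB) ⊗[ℂ] HP)))

instance : InnerProductSpace ℂ (JointSpace HA HB HP) :=
  inferInstanceAs (InnerProductSpace ℂ (UniformSpace.Completion ((HA ⊗[ℂ] HB) ⊗[ℂ] HP)))

instance : CompleteSpace (JointSpace HA HB HP) :=
  inferInstanceAs (CompleteSpace (UniformSpace.Completion ((HA ⊗[ℂ] HB) ⊗[ℂ] HP)))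

variable (HP) in
/-- The operator `A ⊗ B ⊗ I`. -/
def jointOp (A : HA →L[ℂ] KA) (B : HB →L[ℂ] KB) : JointSpace HA HB HP →L[ℂ] JointSpace KA KB HP :=
  localOp HP A B

theorem jointOp_comp_apply (A : KA →L[ℂ] LA) (B : KB →L[ℂ] LB) (A' : HA →L[ℂ] KA)
    (B' : HB →L[ℂ] KB) (x : JointSpace HA HB HP) :
    jointOp HP A B (jointOp HP A' B' x) = jointOp HP (A.comp A') (B.comp B') x :=
  localOp_comp A B A' B' x

theorem jointOp_one (x : JointSpace HA HB HP) :
    jointOp HP (1 : HA →L[ℂ] HA) (1 : HB →L[ℂ] HB) x = x :=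
  localOp_one x

theorem jointOp_add_left (A A' : HA →L[ℂ] KA) (B : HB →L[ℂ] KB) :
    jointOp HP (A + A') B = jointOp HP A B + jointOp HP A' B :=
  localOp_add_left A A' B

theorem jointOp_add_right (A : HA →L[ℂ] KA) (B B' : HB →L[ℂ] KB) :
    jointOp HP A (B + B') = jointOp HP A B + jointOp HP A B' :=
  localOp_add_right A B B'

theorem jointOp_smul_left (c : ℂ) (A : HA →L[ℂ] KA) (B : HB →L[ℂ] KB) :
    jointOp HP (c • A) B = c • jointOp HP A B :=
  localOp_smul_left c A B

theorem jointOp_smul_right (c : ℂ) (A : HA →L[ℂ] KA) (B : HB →L[ℂ] KB) :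
    jointOp HP A (c • B) = c • jointOp HP A B :=
  localOp_smul_right c A B

theorem inner_jointOp {A A' : HA →L[ℂ] KA} {B B' : HB →L[ℂ] KB} {α β : ℂ}
    (hA : ∀ x y, inner ℂ (A x) (A' y) = α * inner ℂ x y)
    (hB : ∀ x y, inner ℂ (B x) (B' y) = β * inner ℂ x y) (x y : JointSpace HA HB HP) :
    inner ℂ (jointOp HP A B x) (jointOp HP A' B' y) = α * β * inner ℂ x y :=
  inner_localOp hA hB x y

theorem norm_jointOp (A : HA →L[ℂ] KA) (B : HB →L[ℂ] KB) (hA : ∀ x, ‖A x‖ = ‖x‖)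
    (hB : ∀ x, ‖B x‖ = ‖x‖) (x : JointSpace HA HB HP) : ‖jointOp HP A B x‖ = ‖x‖ :=
  norm_localOp A B hA hB x

/-- The product vector `a ⊗ b ⊗ p`. -/
def product (a : HA) (b : HB) (p : HP) : JointSpace HA HB HP := pure a b p

theorem clm_ext_product {F : Type*} [NormedAddCommGroup F] [NormedSpace ℂ F]
    {f g : JointSpace HA HB HP →L[ℂ] F} (h : ∀ a b p, f (product a b p) = g (product a b p)) :
    f = g :=
  clm_ext_pure (HA := HA) (HB := HB) (HP := HP) (F := F) (f := f) (g := g) h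

variable {QA QB : Type} [NormedAddCommGroup QA] [InnerProductSpace ℂ QA]
  [NormedAddCommGroup QB] [InnerProductSpace ℂ QB]

variable (KA KB HP) in
/-- The operator `ξ ↦ φ ⊗ ξ` for a reference state `φ`. -/
def jointJunk (φ : QA ⊗[ℂ] QB) :
    JointSpace KA KB HP →L[ℂ] JointSpace (QA ⊗[ℂ] KA) (QB ⊗[ℂ] KB) HP :=
  withJunkL KA KB HP φ

theorem jointJunk_tmul_product (q : QA) (r : QB) (a : KA) (b : KB) (p : HP) :
    jointJunk KA KB HP (q ⊗ₜ[ℂ] r) (product a b p) = product (q ⊗ₜ[ℂ] a) (r ⊗ₜ[ℂ] b) p :=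
  withJunkL_tmul_pure q r a b p

theorem inner_jointJunk (φ φ' : QA ⊗[ℂ] QB) (x y : JointSpace KA KB HP) :
    inner ℂ (jointJunk KA KB HP φ x) (jointJunk KA KB HP φ' y) = inner ℂ φ φ' * inner ℂ x y :=
  inner_withJunkL φ φ' x y

theorem jointJunk_add (φ φ' : QA ⊗[ℂ] QB) :
    jointJunk KA KB HP (φ + φ') = jointJunk KA KB HP φ + jointJunk KA KB HP φ' :=
  withJunkL_add φ φ'

theorem jointJunk_smul (c : ℂ) (φ : QA ⊗[ℂ] QB) :
    jointJunk KA KB HP (c • φ) = c • jointJunk KA KB HP φ :=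
  withJunkL_smul c φ

theorem jointOp_jointJunk (σ : QA →L[ℂ] QA) (ρ : QB →L[ℂ] QB) (φ : QA ⊗[ℂ] QB)
    (x : JointSpace KA KB HP) :
    jointOp HP (mapL σ (.id ℂ KA)) (mapL ρ (.id ℂ KB)) (jointJunk KA KB HP φ x)
      = jointJunk KA KB HP (mapL σ ρ φ) x :=
  localOp_withJunkL σ ρ φ x

end JointSpace

/-! ### Isometries into a space with additional qubits -/

section Attach

variable {Q R : Type} {H K : Type*} [NormedAddCommGroup Q] [InnerProductSpace ℂ Q]
  [NormedAddCommGroup R] [InnerProductSpace ℂ R] [NormedAddCommGroup H] [InnerProductSpace ℂ H]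
  [NormedAddCommGroup K] [InnerProductSpace ℂ K]

theorem inner_isometry {E F : Type*} [NormedAddCommGroup E] [InnerProductSpace ℂ E]
    [NormedAddCommGroup F] [InnerProductSpace ℂ F] (f : E →ₗᵢ[ℂ] F) (x y : E) :
    inner ℂ (f x) (f y) = inner ℂ x y := f.inner_map_map x y

theorem inner_isometry_tmul {E E' F : Type*} [NormedAddCommGroup E] [InnerProductSpace ℂ E]
    [NormedAddCommGroup E'] [InnerProductSpace ℂ E'] [NormedAddCommGroup F]
    [InnerProductSpace ℂ F] (f : E ⊗[ℂ] E' →ₗᵢ[ℂ] F) (x x' : E) (y y' : E') :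
    inner ℂ (f (x ⊗ₜ[ℂ] y)) (f (x' ⊗ₜ[ℂ] y')) = inner ℂ x x' * inner ℂ y y' := by
  rw [inner_isometry, inner_tmul]

/-- The isometry `(q ⊗ r) ⊗ x ↦ q ⊗ j (r ⊗ x)`. -/
def reassociate (j : R ⊗[ℂ] H →ₗᵢ[ℂ] K) : (Q ⊗[ℂ] R) ⊗[ℂ] H →ₗᵢ[ℂ] Q ⊗[ℂ] K :=
  (j.lTensor Q).comp (assocIsometry ℂ Q R H).toLinearIsometry

/-- The operator `x ↦ φ ⊗ x`, where the second half of `φ` is put next to `x` into the space `K`. -/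
def attach (j : R ⊗[ℂ] H →ₗᵢ[ℂ] K) (φ : Q ⊗[ℂ] R) : H →L[ℂ] Q ⊗[ℂ] K :=
  (reassociate j).toContinuousLinearMap.comp (mkL ℂ (Q ⊗[ℂ] R) H φ)

variable (j : R ⊗[ℂ] H →ₗᵢ[ℂ] K)

theorem attach_apply (φ : Q ⊗[ℂ] R) (x : H) : attach j φ x = reassociate j (φ ⊗ₜ[ℂ] x) := rfl

theorem inner_attach (φ φ' : Q ⊗[ℂ] R) (x y : H) :
    inner ℂ (attach j φ x) (attach j φ' y) = inner ℂ φ φ' * inner ℂ x y := by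
  exact inner_isometry_tmul (E := Q ⊗[ℂ] R) (E' := H) (F := Q ⊗[ℂ] K) (reassociate j) φ φ' x y

theorem attach_tmul (q : Q) (r : R) (x : H) : attach j (q ⊗ₜ[ℂ] r) x = q ⊗ₜ[ℂ] j (r ⊗ₜ[ℂ] x) := rfl

theorem attach_add (φ φ' : Q ⊗[ℂ] R) : attach j (φ + φ') = attach j φ + attach j φ' := by
  refine ContinuousLinearMap.ext fun x => ?_
  rw [add_apply, attach_apply, attach_apply, attach_apply, add_tmul]
  exact (reassociate j).map_add _ _

theorem attach_smul (c : ℂ) (φ : Q ⊗[ℂ] R) : attach j (c • φ) = c • attach j φ := by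
  refine ContinuousLinearMap.ext fun x => ?_
  rw [smul_apply, attach_apply, attach_apply, ← smul_tmul']
  exact (reassociate j).map_smul _ _

theorem mapL_attach (σ : Q →L[ℂ] Q) (φ : Q ⊗[ℂ] R) (x : H) :
    mapL σ (.id ℂ K) (attach j φ x) = attach j (mapL σ (.id ℂ R) φ) x := by
  induction φ using TensorProduct.induction_on with
  | zero =>
    have h : attach j (0 : Q ⊗[ℂ] R) = 0 := by
      have := attach_add j (0 : Q ⊗[ℂ] R) 0
      rwa [add_zero, left_eq_add] at this
    rw [ContinuousLinearMap.map_zero, h, zero_apply, ContinuousLinearMap.map_zero]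
  | add φ φ' h h' =>
    rw [ContinuousLinearMap.map_add, attach_add, attach_add, add_apply, add_apply,
      ContinuousLinearMap.map_add, h, h']
  | tmul q r =>
    rw [attach_tmul, mapL_tmul, mapL_tmul, attach_tmul]
    rfl

/-- The operators that attach the vectors of the Bell basis. -/
theorem orthogonalIsometries_attach_bellBasis {n : ℕ} (j : Qubits n ⊗[ℂ] H →ₗᵢ[ℂ] K) :
    OrthogonalIsometries (fun p : PauliIndex n => attach j (bellBasis p)) := fun p q x y => by
  refine (inner_attach j (bellBasis p) (bellBasis q) x y).trans ?_
  rw [inner_bellBasis]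

end Attach

section JointOpSum

variable {HA FA : Type u} {HB FB : Type v} {HP : Type w}
  [NormedAddCommGroup HA] [InnerProductSpace ℂ HA]
  [NormedAddCommGroup HB] [InnerProductSpace ℂ HB]
  [NormedAddCommGroup HP] [InnerProductSpace ℂ HP]
  [NormedAddCommGroup FA] [InnerProductSpace ℂ FA]
  [NormedAddCommGroup FB] [InnerProductSpace ℂ FB]

theorem jointOp_left_comp_apply {KA : Type u} [NormedAddCommGroup KA] [InnerProductSpace ℂ KA]
    (A : KA →L[ℂ] FA) (A' : HA →L[ℂ] KA) (x : JointSpace HA HB HP) :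
    jointOp HP A (1 : HB →L[ℂ] HB) (jointOp HP A' (1 : HB →L[ℂ] HB) x)
      = jointOp HP (A.comp A') (1 : HB →L[ℂ] HB) x :=
  jointOp_comp_apply A 1 A' 1 x

theorem jointOp_right_comp_apply {KB : Type v} [NormedAddCommGroup KB] [InnerProductSpace ℂ KB]
    (B : KB →L[ℂ] FB) (B' : HB →L[ℂ] KB) (x : JointSpace HA HB HP) :
    jointOp HP (1 : HA →L[ℂ] HA) B (jointOp HP (1 : HA →L[ℂ] HA) B' x)
      = jointOp HP (1 : HA →L[ℂ] HA) (B.comp B') x :=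
  jointOp_comp_apply 1 B 1 B' x

theorem jointOp_zero_left (B : HB →L[ℂ] FB) :
    jointOp HP (0 : HA →L[ℂ] FA) B = 0 := by
  have := jointOp_smul_left (HP := HP) 0 (0 : HA →L[ℂ] FA) B
  rwa [zero_smul, zero_smul] at this

theorem jointOp_zero_right (A : HA →L[ℂ] FA) :
    jointOp HP A (0 : HB →L[ℂ] FB) = 0 := by
  have := jointOp_smul_right (HP := HP) 0 A (0 : HB →L[ℂ] FB)
  rwa [zero_smul, zero_smul] at this

theorem jointOp_sum_left {κ : Type*} [DecidableEq κ] (f : κ → HA →L[ℂ] FA)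
    (B : HB →L[ℂ] FB) (t : Finset κ) (x : JointSpace HA HB HP) :
    jointOp HP (∑ p ∈ t, f p) B x = ∑ p ∈ t, jointOp HP (f p) B x := by
  induction t using Finset.induction_on with
  | empty => rw [Finset.sum_empty, Finset.sum_empty, jointOp_zero_left]; rfl
  | insert p t hp ih =>
    rw [Finset.sum_insert hp, Finset.sum_insert hp, jointOp_add_left, add_apply, ih]

theorem jointOp_sum_right {κ : Type*} [DecidableEq κ] (A : HA →L[ℂ] FA)
    (f : κ → HB →L[ℂ] FB) (t : Finset κ) (x : JointSpace HA HB HP) :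
    jointOp HP A (∑ p ∈ t, f p) x = ∑ p ∈ t, jointOp HP A (f p) x := by
  induction t using Finset.induction_on with
  | empty => rw [Finset.sum_empty, Finset.sum_empty, jointOp_zero_right]; rfl
  | insert p t hp ih =>
    rw [Finset.sum_insert hp, Finset.sum_insert hp, jointOp_add_right, add_apply, ih]

end JointOpSum

section Twirl

variable {ι : Type*} [Fintype ι] [DecidableEq ι]

/-- The operator `x ↦ c ∑ₚ Lₚ (Uₚ x)`. If the `Lₚ` are isometries with orthogonal ranges and `c` is
the inverse square root of their number, then it is an isometry whichever isometries `Uₚ` are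
used. -/
def twirl {H F : Type*} [NormedAddCommGroup H] [InnerProductSpace ℂ H]
    [NormedAddCommGroup F] [InnerProductSpace ℂ F] (c : ℝ) (L : ι → H →L[ℂ] F) (U : ι → H →L[ℂ] H) :
    H →L[ℂ] F :=
  (c : ℂ) • ∑ p, (L p).comp (U p)

theorem norm_twirl {H F : Type*} [NormedAddCommGroup H] [InnerProductSpace ℂ H]
    [NormedAddCommGroup F] [InnerProductSpace ℂ F] {c : ℝ} {L : ι → H →L[ℂ] F}
    (hL : OrthogonalIsometries L) (hc : c ^ 2 * Fintype.card ι = 1) (U : ι → H →L[ℂ] H)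
    (hU : ∀ p x, ‖U p x‖ = ‖x‖) (x : H) : ‖twirl c L U x‖ = ‖x‖ := by
  rw [twirl, smul_apply, sum_apply]
  exact hL.norm_avg_eq hc (norm_nonneg x) (fun p => U p x) (fun p => hU p x)

variable {HA FA : Type u} {HB FB : Type v} {HP : Type w}
  [NormedAddCommGroup HA] [InnerProductSpace ℂ HA]
  [NormedAddCommGroup HB] [InnerProductSpace ℂ HB]
  [NormedAddCommGroup HP] [InnerProductSpace ℂ HP]
  [NormedAddCommGroup FA] [InnerProductSpace ℂ FA]
  [NormedAddCommGroup FB] [InnerProductSpace ℂ FB] {c : ℝ}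

theorem jointOp_twirl_left (L : ι → HA →L[ℂ] FA) (U : ι → HA →L[ℂ] HA) (x : JointSpace HA HB HP) :
    jointOp HP (twirl c L U) (1 : HB →L[ℂ] HB) x
      = (c : ℂ) • ∑ p, jointOp HP (L p) (1 : HB →L[ℂ] HB) (jointOp HP (U p) 1 x) := by
  rw [twirl, jointOp_smul_left, smul_apply, jointOp_sum_left]
  refine congrArg _ (Finset.sum_congr rfl fun p _ => ?_)
  rw [jointOp_left_comp_apply]

/-- If `S` permutes the ranges of the `L p` in the way in which the `U p` are almost permuted, then
the isometry `twirl c L U` almost turns the passage from `x` to `y` into the action of `S`. -/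
theorem twirl_left_intertwines {L : ι → HA →L[ℂ] FA} (hL : OrthogonalIsometries L)
    (hc : c ^ 2 * Fintype.card ι = 1) (U : ι → HA →L[ℂ] HA) (S : FA →L[ℂ] FA)
    (π : Equiv.Perm ι) (s : ι → ℂ) (hS : ∀ p x, S (L (π p) x) = s p • L p x) {δ : ℝ} (hδ : 0 ≤ δ)
    (x y : JointSpace HA HB HP)
    (h : ∀ p, ‖jointOp HP (U p) (1 : HB →L[ℂ] HB) y
      - s p • jointOp HP (U (π p)) (1 : HB →L[ℂ] HB) x‖ ≤ δ) :
    ‖jointOp HP (twirl c L U) (1 : HB →L[ℂ] HB) y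
      - jointOp HP S (1 : HB →L[ℂ] HB) (jointOp HP (twirl c L U) (1 : HB →L[ℂ] HB) x)‖ ≤ δ := by
  have hL' : OrthogonalIsometries (E := JointSpace HA HB HP) (F := JointSpace FA HB HP)
      (fun p => jointOp HP (L p) (1 : HB →L[ℂ] HB)) := fun p q x y =>
    (inner_jointOp (β := 1) (hL p q) (fun x y => (one_mul _).symm) x y).trans (by rw [mul_one])
  rw [jointOp_twirl_left, jointOp_twirl_left]
  refine hL'.norm_avg_sub_map_le hc hδ (jointOp HP S (1 : HB →L[ℂ] HB)) π s (fun p x => ?_)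
    (fun p => jointOp HP (U p) 1 y) (fun p => jointOp HP (U p) 1 x) h
  have e : S.comp (L (π p)) = s p • L p := ContinuousLinearMap.ext fun x => hS p x
  rw [jointOp_left_comp_apply, e, jointOp_smul_left]
  rfl

theorem jointOp_twirl_right (L : ι → HB →L[ℂ] FB) (U : ι → HB →L[ℂ] HB)
    (x : JointSpace HA HB HP) :
    jointOp HP (1 : HA →L[ℂ] HA) (twirl c L U) x
      = (c : ℂ) • ∑ p, jointOp HP (1 : HA →L[ℂ] HA) (L p) (jointOp HP 1 (U p) x) := by
  rw [twirl, jointOp_smul_right, smul_apply, jointOp_sum_right]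
  refine congrArg _ (Finset.sum_congr rfl fun p _ => ?_)
  rw [jointOp_right_comp_apply]

theorem twirl_right_intertwines {L : ι → HB →L[ℂ] FB} (hL : OrthogonalIsometries L)
    (hc : c ^ 2 * Fintype.card ι = 1) (U : ι → HB →L[ℂ] HB) (S : FB →L[ℂ] FB)
    (π : Equiv.Perm ι) (s : ι → ℂ) (hS : ∀ p x, S (L (π p) x) = s p • L p x) {δ : ℝ} (hδ : 0 ≤ δ)
    (x y : JointSpace HA HB HP)
    (h : ∀ p, ‖jointOp HP (1 : HA →L[ℂ] HA) (U p) y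
      - s p • jointOp HP (1 : HA →L[ℂ] HA) (U (π p)) x‖ ≤ δ) :
    ‖jointOp HP (1 : HA →L[ℂ] HA) (twirl c L U) y
      - jointOp HP (1 : HA →L[ℂ] HA) S (jointOp HP (1 : HA →L[ℂ] HA) (twirl c L U) x)‖ ≤ δ := by
  have hL' : OrthogonalIsometries (E := JointSpace HA HB HP) (F := JointSpace HA FB HP)
      (fun p => jointOp HP (1 : HA →L[ℂ] HA) (L p)) := fun p q x y =>
    (inner_jointOp (α := 1) (fun x y => (one_mul _).symm) (hL p q) x y).trans (by rw [one_mul])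
  rw [jointOp_twirl_right, jointOp_twirl_right]
  refine hL'.norm_avg_sub_map_le hc hδ (jointOp HP (1 : HA →L[ℂ] HA) S) π s (fun p x => ?_)
    (fun p => jointOp HP 1 (U p) y) (fun p => jointOp HP 1 (U p) x) h
  have e : S.comp (L (π p)) = s p • L p := ContinuousLinearMap.ext fun x => hS p x
  rw [jointOp_right_comp_apply, e, jointOp_smul_right]
  rfl

/-- The normalization of the `4 ^ n` terms of `bellTwirl`. -/
theorem card_pauliIndex (n : ℕ) :
    (bellNorm n ^ 2) ^ 2 * (Fintype.card (PauliIndex n) : ℝ) = 1 := by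
  have : (Fintype.card (PauliIndex n) : ℝ) = 2 ^ n * 2 ^ n := by simp
  rw [this]
  linear_combination (bellNorm n ^ 2 * 2 ^ n + 1) * bellNorm_sq n

end Twirl

/-! ### Decomposition of a state along the Bell basis -/

/-- A unit vector close to the range of an isometry is close to the image of a unit vector. -/
theorem exists_unit_norm_sub_le {E F : Type*} [NormedAddCommGroup E] [InnerProductSpace ℂ E]
    [NormedAddCommGroup F] [InnerProductSpace ℂ F] {χ : F} {L : E →L[ℂ] F} (hL : ∀ x, ‖L x‖ = ‖x‖)
    (hχ : ‖χ‖ = 1) (hE : ∃ x : E, x ≠ 0) {x : E} {δ : ℝ} (hx : ‖χ - L x‖ ≤ δ) :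
    ∃ ξ : E, ‖ξ‖ = 1 ∧ ‖χ - L ξ‖ ≤ 2 * δ := by
  by_cases h0 : x = 0
  · obtain ⟨y, hy⟩ := hE
    refine ⟨((‖y‖⁻¹ : ℝ) : ℂ) • y, ?_, ?_⟩
    · rw [norm_smul, Complex.norm_real, norm_inv, norm_norm,
        inv_mul_cancel₀ (norm_ne_zero_iff.mpr hy)]
    · refine (norm_sub_le _ _).trans ?_
      rw [h0, map_zero, sub_zero, hχ] at hx
      rw [hL, norm_smul, Complex.norm_real, norm_inv, norm_norm,
        inv_mul_cancel₀ (norm_ne_zero_iff.mpr hy), hχ]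
      linarith
  · have hx0 : ‖x‖ ≠ 0 := norm_ne_zero_iff.mpr h0
    refine ⟨((‖x‖⁻¹ : ℝ) : ℂ) • x, ?_, ?_⟩
    · rw [norm_smul, Complex.norm_real, norm_inv, norm_norm, inv_mul_cancel₀ hx0]
    · -- normalizing moves `x` by `|‖x‖ - 1|`, which is at most the distance of `L x` from `χ`
      have h1 : ‖L x - L (((‖x‖⁻¹ : ℝ) : ℂ) • x)‖ ≤ δ := by
        have e : x - ((‖x‖⁻¹ : ℝ) : ℂ) • x = ((1 - ‖x‖⁻¹ : ℝ) : ℂ) • x := by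
          push_cast; rw [sub_smul, one_smul]
        rw [← map_sub, hL, e, norm_smul, Complex.norm_real, Real.norm_eq_abs]
        have e2 : |1 - ‖x‖⁻¹| * ‖x‖ = |‖x‖ - 1| := by
          conv_lhs => rw [← abs_of_nonneg (norm_nonneg x), ← abs_mul, abs_norm]
          congr 1
          field_simp
        rw [e2, ← hχ, ← hL x, ← norm_sub_rev] at *
        exact (abs_norm_sub_norm_le _ _).trans hx
      calc ‖χ - L (((‖x‖⁻¹ : ℝ) : ℂ) • x)‖
          ≤ ‖χ - L x‖ + ‖L x - L (((‖x‖⁻¹ : ℝ) : ℂ) • x)‖ := norm_sub_le_norm_sub_add_norm_sub _ _ _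
        _ ≤ 2 * δ := by linarith

theorem OrthogonalIsometries.adjoint_apply {ι E F : Type*} [DecidableEq ι]
    [NormedAddCommGroup E] [InnerProductSpace ℂ E] [CompleteSpace E] [NormedAddCommGroup F]
    [InnerProductSpace ℂ F] [CompleteSpace F] {T : ι → E →L[ℂ] F} (hT : OrthogonalIsometries T)
    (p q : ι) (x : E) :
    ContinuousLinearMap.adjoint (T p) (T q x) = if p = q then x else 0 := by
  refine ext_inner_left ℂ fun y => ?_
  rw [ContinuousLinearMap.adjoint_inner_right, hT]
  split_ifs <;> simp

section Decomposition

variable {ι E F : Type*} [Fintype ι] [DecidableEq ι] [NormedAddCommGroup E] [InnerProductSpace ℂ E]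
  [CompleteSpace E] [NormedAddCommGroup F] [InnerProductSpace ℂ F] [CompleteSpace F]
  {T : ι → E →L[ℂ] F}

open ContinuousLinearMap (adjoint)

/-- The ranges of the operators `T p` span a dense subspace, in the form in which this is used: a
bounded operator is determined by its values on them. -/
def IsTotal (T : ι → E →L[ℂ] F) : Prop :=
  ∀ f g : F →L[ℂ] F, (∀ p x, f (T p x) = g (T p x)) → f = g

/-- The decomposition of a vector along the ranges of the `T p`. -/
theorem OrthogonalIsometries.sum_adjoint (hT : OrthogonalIsometries T) (ht : IsTotal T) (χ : F) :
    ∑ p, T p (adjoint (T p) χ) = χ := by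
  have : ∑ p, (T p).comp (adjoint (T p)) = ContinuousLinearMap.id ℂ F := ht _ _ fun q x => by
    rw [sum_apply, Finset.sum_eq_single q]
    · rw [ContinuousLinearMap.comp_apply, hT.adjoint_apply, if_pos rfl]; rfl
    · intro p _ hp
      rw [ContinuousLinearMap.comp_apply, hT.adjoint_apply, if_neg hp, map_zero]
    · simp
  have h := DFunLike.congr_fun this χ
  rwa [sum_apply] at h

/-- Two operators that permute the ranges of the `T p` in the same way, up to phases, differ on `χ`
by the mass of `χ` on the ranges for which the phases differ. -/
theorem OrthogonalIsometries.norm_sq_map_sub_map (hT : OrthogonalIsometries T) (ht : IsTotal T)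
    {S S' : F →L[ℂ] F} (π : Equiv.Perm ι) {s s' : ι → ℂ} (hS : ∀ p x, S (T p x) = s p • T (π p) x)
    (hS' : ∀ p x, S' (T p x) = s' p • T (π p) x) (χ : F) :
    ‖S χ - S' χ‖ ^ 2 = ∑ p, ‖s p - s' p‖ ^ 2 * ‖adjoint (T p) χ‖ ^ 2 := by
  have hχ := hT.sum_adjoint ht χ
  have h : S χ - S' χ
      = ∑ q, T q ((s (π.symm q) - s' (π.symm q)) • adjoint (T (π.symm q)) χ) := by
    conv_lhs => rw [← hχ]
    rw [map_sum, map_sum, ← Finset.sum_sub_distrib]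
    conv_rhs => rw [← Equiv.sum_comp π]
    refine Finset.sum_congr rfl fun p _ => ?_
    rw [hS, hS', Equiv.symm_apply_apply, map_smul, sub_smul]
  rw [h, hT.norm_sq_sum, ← Equiv.sum_comp π]
  simp only [Equiv.symm_apply_apply, norm_smul, mul_pow]

/-- A unit vector on which the Pauli operators of Alice almost agree with those of Bob is close to
one whose only component in the Bell basis is the one along the Bell state itself: every other Bell
vector is an eigenvector with eigenvalue `-1` of some `X_A X_B` or some `Z_A Z_B`. -/
theorem exists_junk {n : ℕ} {T : PauliIndex n → E →L[ℂ] F} (hT : OrthogonalIsometries T)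
    (ht : IsTotal T) {XA XB ZA ZB : Fin n → F →L[ℂ] F}
    (hXA : ∀ i p x, XA i (T p x) = T (p.1 + bit i, p.2) x)
    (hXB : ∀ i p x, XB i (T p x) = character (bit i) p.2 • T (p.1 + bit i, p.2) x)
    (hZA : ∀ i p x, ZA i (T p x) = character (bit i) p.1 • T (p.1, p.2 + bit i) x)
    (hZB : ∀ i p x, ZB i (T p x) = T (p.1, p.2 + bit i) x)
    {χ : F} (hχ : ‖χ‖ = 1) {δ : ℝ} (hδ : 0 ≤ δ) (hX : ∀ i, ‖XA i χ - XB i χ‖ ≤ δ)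
    (hZ : ∀ i, ‖ZA i χ - ZB i χ‖ ≤ δ) :
    ∃ ξ : E, ‖ξ‖ = 1 ∧ ‖χ - T (0, 0) ξ‖ ≤ 2 * (√n * δ) := by
  have hX2 : ∀ i, ∑ p : PauliIndex n, ‖1 - character (bit i) p.2‖ ^ 2 * ‖adjoint (T p) χ‖ ^ 2
      ≤ δ ^ 2 := fun i => by
    rw [← hT.norm_sq_map_sub_map ht (S := XA i) (S' := XB i)
      ((Equiv.addRight (bit i)).prodCongr (Equiv.refl _)) (s := fun _ => 1)
      (fun p x => (hXA i p x).trans (one_smul ℂ _).symm) (hXB i)]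
    exact pow_le_pow_left₀ (norm_nonneg _) (hX i) 2
  have hZ2 : ∀ i, ∑ p : PauliIndex n, ‖character (bit i) p.1 - 1‖ ^ 2 * ‖adjoint (T p) χ‖ ^ 2
      ≤ δ ^ 2 := fun i => by
    rw [← hT.norm_sq_map_sub_map ht (S := ZA i) (S' := ZB i)
      ((Equiv.refl _).prodCongr (Equiv.addRight (bit i))) (s' := fun _ => 1)
      (hZA i) (fun p x => (hZB i p x).trans (one_smul ℂ _).symm)]
    exact pow_le_pow_left₀ (norm_nonneg _) (hZ i) 2
  have hsum := hT.sum_adjoint ht χ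
  have key : ∀ p : PauliIndex n, p ≠ (0, 0) → 4 ≤ ∑ i, (‖1 - character (bit i) p.2‖ ^ 2
      + ‖character (bit i) p.1 - 1‖ ^ 2) := by
    rintro ⟨a, b⟩ hp
    have hne : ∃ i, a i = 1 ∨ b i = 1 := by
      by_contra hcon
      push Not at hcon
      refine hp (Prod.ext (funext fun i => ?_) (funext fun i => ?_))
      · have := (hcon i).1; change a i = 0; revert this; generalize a i = t; revert t; decide
      · have := (hcon i).2; change b i = 0; revert this; generalize b i = t; revert t; decide
    obtain ⟨i, hi⟩ := hne
    refine le_trans ?_ (Finset.single_le_sum (fun j _ => by positivity) (Finset.mem_univ i))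
    rw [character_bit, character_bit]
    rcases hi with hi | hi
    · simp only [hi, if_true]
      have : ‖(-1 : ℂ) - 1‖ ^ 2 = 4 := by norm_num
      rw [this]; exact le_add_of_nonneg_left (by positivity)
    · simp only [hi, if_true]
      have : ‖(1 : ℂ) - -1‖ ^ 2 = 4 := by norm_num
      rw [this]; exact le_add_of_nonneg_right (by positivity)
  have hd : χ - T (0, 0) (adjoint (T (0, 0)) χ)
      = ∑ p, T p (if p = (0, 0) then 0 else adjoint (T p) χ) := by
    rw [← Finset.add_sum_erase _ _ (Finset.mem_univ ((0, 0) : PauliIndex n)), if_pos rfl, map_zero,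
      zero_add, sub_eq_iff_eq_add']
    refine (hsum.symm.trans (Finset.add_sum_erase _ _
      (Finset.mem_univ ((0, 0) : PauliIndex n))).symm).trans ?_
    refine congrArg _ (Finset.sum_congr rfl fun p hp => ?_)
    rw [if_neg (Finset.ne_of_mem_erase hp)]
  have hbound : ‖χ - T (0, 0) (adjoint (T (0, 0)) χ)‖ ≤ √n * δ := by
    refine (sq_le_sq₀ (norm_nonneg _) (by positivity)).mp ?_
    rw [hd, hT.norm_sq_sum, mul_pow, Real.sq_sqrt (Nat.cast_nonneg n)]
    have h4 : 4 * ∑ p : PauliIndex n, ‖if p = (0, 0) then 0 else adjoint (T p) χ‖ ^ 2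
        ≤ 2 * (n * δ ^ 2) := by
      rw [Finset.mul_sum]
      calc ∑ p : PauliIndex n, 4 * ‖if p = (0, 0) then 0 else adjoint (T p) χ‖ ^ 2
          ≤ ∑ p : PauliIndex n, (∑ i, (‖1 - character (bit i) p.2‖ ^ 2
              + ‖character (bit i) p.1 - 1‖ ^ 2)) * ‖adjoint (T p) χ‖ ^ 2 := by
            refine Finset.sum_le_sum fun p _ => ?_
            split_ifs with hp
            · rw [norm_zero, zero_pow two_ne_zero, mul_zero]; positivity
            · exact mul_le_mul_of_nonneg_right (key p hp) (by positivity)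
        _ = ∑ i, (∑ p : PauliIndex n, ‖1 - character (bit i) p.2‖ ^ 2 * ‖adjoint (T p) χ‖ ^ 2
              + ∑ p : PauliIndex n, ‖character (bit i) p.1 - 1‖ ^ 2 * ‖adjoint (T p) χ‖ ^ 2) := by
            simp only [Finset.sum_mul, ← Finset.sum_add_distrib, ← add_mul]
            exact Finset.sum_comm
        _ ≤ ∑ _i : Fin n, (δ ^ 2 + δ ^ 2) := Finset.sum_le_sum fun i _ => add_le_add (hX2 i) (hZ2 i)
        _ = 2 * (n * δ ^ 2) := by
            rw [Finset.sum_const, Finset.card_univ, Fintype.card_fin, nsmul_eq_mul]; ring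
    nlinarith [mul_nonneg (Nat.cast_nonneg (α := ℝ) n) (sq_nonneg δ)]
  have hE : ∃ x : E, x ≠ 0 := by
    by_contra hcon
    push Not at hcon
    rw [← hsum, Finset.sum_eq_zero fun p _ => by rw [hcon (adjoint (T p) χ), map_zero],
      norm_zero] at hχ
    exact zero_ne_one hχ
  refine exists_unit_norm_sub_le (fun x => norm_eq_of_inner ?_) hχ hE hbound
  rw [hT, if_pos rfl, one_mul]

end Decomposition

section Total

variable {KA : Type u} {KB : Type v} {HP : Type w} {n : ℕ}
  [NormedAddCommGroup KA] [InnerProductSpace ℂ KA] [NormedAddCommGroup KB] [InnerProductSpace ℂ KB]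
  [NormedAddCommGroup HP] [InnerProductSpace ℂ HP]

theorem product_add_left (a a' : KA) (b : KB) (p : HP) :
    product (a + a') b p = product a b p + product a' b p := pure_add_left a a' b p

theorem product_add_mid (a : KA) (b b' : KB) (p : HP) :
    product a (b + b') p = product a b p + product a b' p := pure_add_mid a b b' p

theorem orthogonalIsometries_jointJunk_bellBasis :
    OrthogonalIsometries (fun p : PauliIndex n => jointJunk KA KB HP (bellBasis p)) :=
  fun p q x y => by
    refine (inner_jointJunk (bellBasis p) (bellBasis q) x y).trans ?_
    rw [inner_bellBasis]

/-- Product vectors of a composite of qubits and junk are sums of vectors `φ ⊗ ξ`. -/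
theorem eq_of_forall_jointJunk_tmul {QA QB : Type} [NormedAddCommGroup QA] [InnerProductSpace ℂ QA]
    [NormedAddCommGroup QB] [InnerProductSpace ℂ QB] {F : Type*} [NormedAddCommGroup F]
    [NormedSpace ℂ F] {f g : JointSpace (QA ⊗[ℂ] KA) (QB ⊗[ℂ] KB) HP →L[ℂ] F}
    (h : ∀ q r x, f (jointJunk KA KB HP (q ⊗ₜ[ℂ] r) x) = g (jointJunk KA KB HP (q ⊗ₜ[ℂ] r) x)) :
    f = g := by
  refine clm_ext_product fun a b p => ?_
  induction a using TensorProduct.induction_on with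
  | zero =>
    have := product_add_left (0 : QA ⊗[ℂ] KA) 0 b p
    rw [add_zero, left_eq_add] at this
    rw [this, map_zero, map_zero]
  | add a a' h h' => rw [product_add_left, map_add, map_add, h, h']
  | tmul q a =>
    induction b using TensorProduct.induction_on with
    | zero =>
      have := product_add_mid (q ⊗ₜ[ℂ] a) (0 : QB ⊗[ℂ] KB) 0 p
      rw [add_zero, left_eq_add] at this
      rw [this, map_zero, map_zero]
    | add b b' h h' => rw [product_add_mid, map_add, map_add, h, h']
    | tmul r b => rw [← jointJunk_tmul_product, h]

theorem isTotal_jointJunk_bellBasis :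
    IsTotal (fun p : PauliIndex n => jointJunk KA KB HP (bellBasis p)) := fun f g h => by
  refine eq_of_forall_jointJunk_tmul fun q r x => ?_
  have hmem : q ⊗ₜ[ℂ] r ∈ Submodule.span ℂ (Set.range (bellBasis (n := n))) := by
    rw [span_bellBasis]; trivial
  generalize q ⊗ₜ[ℂ] r = φ at hmem
  induction hmem using Submodule.span_induction with
  | mem φ hφ => obtain ⟨p, rfl⟩ := hφ; exact h p x
  | zero =>
    have := jointJunk_add (KA := KA) (KB := KB) (HP := HP) (0 : Qubits n ⊗[ℂ] Qubits n) 0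
    rw [add_zero, left_eq_add] at this
    rw [this, zero_apply, map_zero, map_zero]
  | add φ φ' _ _ h h' => rw [jointJunk_add, add_apply, map_add, map_add, h, h']
  | smul c φ _ h => rw [jointJunk_smul, smul_apply, map_smul, map_smul, h]

end Total

/-! ### Products of commuting observables -/

section BitsProd

variable {n : ℕ} {R : Type*} [Monoid R]

/-- The product of the `M j` over all `j` with `a j = 1`, in ascending order of the indices. -/
def bitsProd (M : Fin n → R) (a : Fin n → Fin 2) : R :=
  (((List.finRange n).filter (fun j => a j = 1)).map M).prod

theorem prodExcept_eq_bitsProd (M : Fin n → R) (k : Fin n) :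
    prodExcept M k = bitsProd M (allBut k) := by
  unfold prodExcept bitsProd
  congr 2
  refine List.filter_congr fun j _ => ?_
  by_cases h : j = k <;> simp [h]

theorem bitsProd_bit (M : Fin n → R) (i : Fin n) : bitsProd M (bit i) = M i := by
  have h : (List.finRange n).filter (fun j => bit i j = 1) = [i] := by
    have : (List.finRange n).filter (fun j => bit i j = 1)
        = (List.finRange n).filter (fun j => j = i) :=
      List.filter_congr fun j _ => by by_cases h : j = i <;> simp [h]
    rw [this, List.filter_eq, List.count_eq_one_of_mem (List.nodup_finRange n)
      (List.mem_finRange i)]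
    rfl
  rw [bitsProd, h, List.map_singleton, List.prod_singleton]

theorem list_prod_map_mul_of_commute {ι : Type*} (l : List ι) (f g : ι → R)
    (h : ∀ i j, Commute (f i) (g j)) :
    (l.map fun i => f i * g i).prod = (l.map f).prod * (l.map g).prod := by
  induction l with
  | nil => simp
  | cons i l ih =>
    have : Commute (l.map f).prod (g i) := Commute.list_prod_left _ _ fun y hy => by
      obtain ⟨j, _, rfl⟩ := List.mem_map.mp hy
      exact h j i
    simp only [List.map_cons, List.prod_cons, ih]
    rw [mul_assoc, mul_assoc, ← mul_assoc (g i), ← this.eq, mul_assoc]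

theorem bitsProd_eq_ite (M : Fin n → R) (a : Fin n → Fin 2) :
    bitsProd M a = ((List.finRange n).map fun j => if a j = 1 then M j else 1).prod := by
  unfold bitsProd
  induction List.finRange n with
  | nil => rfl
  | cons j l ih =>
    by_cases h : a j = 1
    · rw [List.filter_cons_of_pos (by simp [h]), List.map_cons, List.prod_cons, ih, List.map_cons,
        List.prod_cons, if_pos h]
    · rw [List.filter_cons_of_neg (by simp [h]), ih, List.map_cons, List.prod_cons, if_neg h,
        one_mul]

theorem bitsProd_add {M : Fin n → R} (hM : ∀ i, M i * M i = 1) (hc : ∀ i j, Commute (M i) (M j))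
    (a b : Fin n → Fin 2) : bitsProd M (a + b) = bitsProd M a * bitsProd M b := by
  rw [bitsProd_eq_ite, bitsProd_eq_ite, bitsProd_eq_ite, ← list_prod_map_mul_of_commute]
  · refine congrArg _ (List.map_congr_left fun j _ => ?_)
    rw [Pi.add_apply]
    generalize a j = s; generalize b j = t
    fin_cases s <;> fin_cases t <;> simp [hM]
  · intro i j
    split_ifs
    · exact hc i j
    · exact Commute.one_right _
    · exact Commute.one_left _
    · exact Commute.one_left _

theorem map_bitsProd {S : Type*} [Monoid S] (f : R →* S) (M : Fin n → R) (a : Fin n → Fin 2) :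
    f (bitsProd M a) = bitsProd (fun i => f (M i)) a := by
  rw [bitsProd, map_list_prod, List.map_map]; rfl

end BitsProd

/-- For odd `n`, every pair of qubits is checked upon some input. -/
theorem exists_mem_checkedPairs {n : ℕ} (hn : n % 2 = 1) {i j : Fin n} (hij : i ≠ j) :
    ∃ y, s(i, j) ∈ checkedPairs y := by
  wlog h : i < j generalizing i j
  · obtain ⟨y, hy⟩ := this hij.symm (lt_of_le_of_ne (not_lt.mp h) hij.symm)
    exact ⟨y, Sym2.eq_swap ▸ hy⟩
  have hlt : (i : ℕ) < j := h
  have hj := j.isLt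
  rcases Nat.even_or_odd' ((j : ℕ) - i) with ⟨s, hs | hs⟩
  · refine ⟨⟨i + s, by omega⟩, i, j, s, by omega, by omega, ?_, ?_, rfl⟩
    · simp
    · have : (j : ℕ) = i + s + s := by omega
      rw [this]; push_cast; ring
  · -- for an odd distance the midpoint lies on the other arc of the cycle
    obtain ⟨t, ht⟩ : ∃ t, n - ((j : ℕ) - i) = 2 * t := ⟨(n - ((j : ℕ) - i)) / 2, by omega⟩
    have hy : ((((j : ℕ) + t) % n : ℕ) : ZMod n) = (j : ℕ) + t := by
      rw [ZMod.natCast_mod]; push_cast; ring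
    refine ⟨⟨((j : ℕ) + t) % n, Nat.mod_lt _ (by omega)⟩, j, i, t, by omega, by omega, ?_, ?_,
      Sym2.eq_swap⟩
    · simp only [hy]; ring
    · simp only [hy]
      have : (j : ℕ) + t + t = i + n := by omega
      have h2 := congrArg (Nat.cast (R := ZMod n)) this
      push_cast at h2
      rw [h2, ZMod.natCast_self, add_zero]

/-! ### The unitaries of one party, compared by their action on the state -/

section Mirror

variable {HA : Type u} {HB : Type v} {HP : Type w}
  [NormedAddCommGroup HA] [InnerProductSpace ℂ HA] [NormedAddCommGroup HB] [InnerProductSpace ℂ HB]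
  [NormedAddCommGroup HP] [InnerProductSpace ℂ HP]

variable (HA HP) in
/-- The operator `B` of Bob, on the joint space. -/
def actB (B : HB →L[ℂ] HB) : JointSpace HA HB HP →L[ℂ] JointSpace HA HB HP :=
  jointOp HP (1 : HA →L[ℂ] HA) B

variable (HB HP) in
/-- The operator `A` of Alice, on the joint space. -/
def actA (A : HA →L[ℂ] HA) : JointSpace HA HB HP →L[ℂ] JointSpace HA HB HP :=
  jointOp HP A (1 : HB →L[ℂ] HB)

theorem actA_mul (A A' : HA →L[ℂ] HA) (x : JointSpace HA HB HP) :
    actA HB HP (A * A') x = actA HB HP A (actA HB HP A' x) :=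
  (jointOp_left_comp_apply A A' x).symm

theorem actB_mul (B B' : HB →L[ℂ] HB) (x : JointSpace HA HB HP) :
    actB HA HP (B * B') x = actB HA HP B (actB HA HP B' x) :=
  (jointOp_right_comp_apply B B' x).symm

theorem actA_one (x : JointSpace HA HB HP) : actA HB HP 1 x = x := jointOp_one x

theorem actB_one (x : JointSpace HA HB HP) : actB HA HP 1 x = x := jointOp_one x

theorem actA_neg (A : HA →L[ℂ] HA) (x : JointSpace HA HB HP) :
    actA HB HP (-A) x = -actA HB HP A x := by
  have := DFunLike.congr_fun (jointOp_smul_left (HP := HP) (-1) A (1 : HB →L[ℂ] HB)) x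
  rwa [neg_one_smul, neg_one_smul] at this

theorem actB_neg (B : HB →L[ℂ] HB) (x : JointSpace HA HB HP) :
    actB HA HP (-B) x = -actB HA HP B x := by
  have := DFunLike.congr_fun (jointOp_smul_right (HP := HP) (-1) (1 : HA →L[ℂ] HA) B) x
  rwa [neg_one_smul, neg_one_smul] at this

theorem actA_actB (A : HA →L[ℂ] HA) (B : HB →L[ℂ] HB) (x : JointSpace HA HB HP) :
    actA HB HP A (actB HA HP B x) = jointOp HP A B x := by
  refine (jointOp_comp_apply A 1 1 B x).trans ?_
  rfl

theorem actB_actA (A : HA →L[ℂ] HA) (B : HB →L[ℂ] HB) (x : JointSpace HA HB HP) :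
    actB HA HP B (actA HB HP A x) = actA HB HP A (actB HA HP B x) := by
  rw [actA_actB]
  refine (jointOp_comp_apply 1 B A 1 x).trans ?_
  rfl

theorem norm_actA {A : HA →L[ℂ] HA} (hA : ∀ x, ‖A x‖ = ‖x‖) (x : JointSpace HA HB HP) :
    ‖actA HB HP A x‖ = ‖x‖ :=
  norm_jointOp A 1 hA (fun _ => rfl) x

theorem norm_actB {B : HB →L[ℂ] HB} (hB : ∀ x, ‖B x‖ = ‖x‖) (x : JointSpace HA HB HP) :
    ‖actB HA HP B x‖ = ‖x‖ :=
  norm_jointOp 1 B (fun _ => rfl) hB x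

variable {Ψ : JointSpace HA HB HP}

/-- `A Ψ` and `B Ψ` are `c`-close, for an isometry `B` of Bob. -/
structure Mirrors (Ψ : JointSpace HA HB HP) (c : ℝ) (A : HA →L[ℂ] HA) (B : HB →L[ℂ] HB) :
    Prop where
  norm_map : ∀ x, ‖B x‖ = ‖x‖
  norm_sub_le : ‖actA HB HP A Ψ - actB HA HP B Ψ‖ ≤ c

theorem Mirrors.one : Mirrors Ψ 0 1 1 :=
  ⟨fun _ => rfl, by rw [actA_one, actB_one, sub_self, norm_zero]⟩

theorem Mirrors.mono {c d : ℝ} {A : HA →L[ℂ] HA} {B : HB →L[ℂ] HB} (h : Mirrors Ψ c A B)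
    (hcd : c ≤ d) : Mirrors Ψ d A B := ⟨h.1, h.2.trans hcd⟩

/-- The mirror image of a product is the product of the mirror images in the reverse order. -/
theorem Mirrors.mul {c d : ℝ} {A A' : HA →L[ℂ] HA} {B B' : HB →L[ℂ] HB} (h : Mirrors Ψ c A B)
    (h' : Mirrors Ψ d A' B') (hA : ∀ x, ‖A x‖ = ‖x‖) : Mirrors Ψ (c + d) (A * A') (B' * B) := by
  refine ⟨fun x => (h'.norm_map (B x)).trans (h.norm_map x), ?_⟩
  have h1 : ‖actA HB HP A (actA HB HP A' Ψ) - actA HB HP A (actB HA HP B' Ψ)‖ ≤ d := by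
    rw [← map_sub, norm_actA hA]; exact h'.norm_sub_le
  have h2 : ‖actB HA HP B' (actA HB HP A Ψ) - actB HA HP B' (actB HA HP B Ψ)‖ ≤ c := by
    rw [← map_sub, norm_actB h'.norm_map]; exact h.norm_sub_le
  rw [actA_mul, actB_mul]
  rw [actB_actA] at h2
  refine (norm_sub_le_norm_sub_add_norm_sub _ (actA HB HP A (actB HA HP B' Ψ)) _).trans ?_
  rw [add_comm c]
  exact add_le_add h1 h2

/-- Two operators of Alice with the same mirror image are close. -/
theorem Mirrors.norm_sub_le_add {c d : ℝ} {A A' : HA →L[ℂ] HA} {B : HB →L[ℂ] HB}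
    (h : Mirrors Ψ c A B) (h' : Mirrors Ψ d A' B) :
    ‖actA HB HP A Ψ - actA HB HP A' Ψ‖ ≤ c + d := by
  refine (norm_sub_le_norm_sub_add_norm_sub _ (actB HA HP B Ψ) _).trans ?_
  rw [norm_sub_rev (actB HA HP B Ψ)]
  exact add_le_add h.norm_sub_le h'.norm_sub_le

/-- A correlation between two `±1`-valued observables says how close their actions are. -/
theorem norm_sq_actA_sub_actB (hΨ : ‖Ψ‖ = 1) {A : HA →L[ℂ] HA} {B : HB →L[ℂ] HB}
    (hA : ∀ x, ‖A x‖ = ‖x‖) (hA2 : A * A = 1) (hB : ∀ x, ‖B x‖ = ‖x‖) :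
    ‖actA HB HP A Ψ - actB HA HP B Ψ‖ ^ 2 = 2 - 2 * (inner ℂ Ψ (jointOp HP A B Ψ)).re := by
  let f : JointSpace HA HB HP →ₗᵢ[ℂ] JointSpace HA HB HP :=
    ⟨(actA HB HP A).toLinearMap, norm_actA hA⟩
  have h : inner ℂ (actA HB HP A Ψ) (actB HA HP B Ψ) = inner ℂ Ψ (jointOp HP A B Ψ) := by
    rw [← actA_actB]
    refine (f.inner_map_map _ _).symm.trans ?_
    change inner ℂ (actA HB HP A (actA HB HP A Ψ)) _ = _
    rw [← actA_mul, hA2, actA_one]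
    rfl
  rw [norm_sub_sq (𝕜 := ℂ), norm_actA hA, norm_actB hB, hΨ, h]
  change 1 ^ 2 - 2 * (inner ℂ Ψ (jointOp HP A B Ψ)).re + 1 ^ 2 = _
  ring

theorem mirrors_of_le_inner (hΨ : ‖Ψ‖ = 1) {A : HA →L[ℂ] HA} {B : HB →L[ℂ] HB}
    (hA : ∀ x, ‖A x‖ = ‖x‖) (hA2 : A * A = 1) (hB : ∀ x, ‖B x‖ = ‖x‖) {ε : ℝ}
    (h : 1 - ε ≤ (inner ℂ Ψ (jointOp HP A B Ψ)).re) : Mirrors Ψ (√(2 * ε)) A B := by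
  refine ⟨hB, Real.le_sqrt_of_sq_le ?_⟩
  rw [norm_sq_actA_sub_actB hΨ hA hA2 hB]
  linarith

variable [CompleteSpace HA]

/-- The unitaries of Alice, as a pseudometric group for the distance `‖u Ψ - v Ψ‖`. The state is an
argument, so that the distance can depend on it and does not clash with the operator norm. -/
def AliceUnitary (_Ψ : JointSpace HA HB HP) : Type u := unitary (HA →L[ℂ] HA)

instance : Group (AliceUnitary Ψ) := inferInstanceAs (Group (unitary (HA →L[ℂ] HA)))

/-- The operator underlying a unitary of Alice. -/
def AliceUnitary.op : AliceUnitary Ψ →* (HA →L[ℂ] HA) := (unitary (HA →L[ℂ] HA)).subtype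

theorem AliceUnitary.norm_op (u : AliceUnitary Ψ) (x : HA) : ‖AliceUnitary.op u x‖ = ‖x‖ :=
  ContinuousLinearMap.norm_map_of_mem_unitary u.2 x

instance : PseudoMetricSpace (AliceUnitary Ψ) :=
  PseudoMetricSpace.induced (fun u : AliceUnitary Ψ => actA HB HP (AliceUnitary.op u) Ψ)
    inferInstance

theorem AliceUnitary.dist_eq (u v : AliceUnitary Ψ) :
    dist u v = ‖actA HB HP (AliceUnitary.op u) Ψ - actA HB HP (AliceUnitary.op v) Ψ‖ :=
  dist_eq_norm (actA HB HP (AliceUnitary.op u) Ψ) (actA HB HP (AliceUnitary.op v) Ψ)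

instance : IsIsometricSMul (AliceUnitary Ψ) (AliceUnitary Ψ) where
  isometry_smul w := Isometry.of_dist_eq fun u v => by
    rw [smul_eq_mul, smul_eq_mul, AliceUnitary.dist_eq, AliceUnitary.dist_eq, map_mul, map_mul,
      actA_mul, actA_mul, ← map_sub, norm_actA (AliceUnitary.norm_op w)]

theorem Mirrors.almostRightInvariant {c : ℝ} {w : AliceUnitary Ψ} {B : HB →L[ℂ] HB}
    (h : Mirrors Ψ c (AliceUnitary.op w) B) : AlmostRightInvariant c w := by
  have key : ∀ u : AliceUnitary Ψ, ‖actA HB HP (AliceUnitary.op (u * w)) Ψ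
      - actB HA HP B (actA HB HP (AliceUnitary.op u) Ψ)‖ ≤ c := fun u => by
    rw [map_mul, actA_mul, actB_actA, ← map_sub, norm_actA (AliceUnitary.norm_op u)]
    exact h.norm_sub_le
  intro u v
  have h3 : ‖actB HA HP B (actA HB HP (AliceUnitary.op u) Ψ)
      - actB HA HP B (actA HB HP (AliceUnitary.op v) Ψ)‖ = dist u v := by
    rw [← map_sub, norm_actB h.norm_map, AliceUnitary.dist_eq]
  have h1 := key u
  have h2 := key v
  rw [norm_sub_rev] at h2
  rw [AliceUnitary.dist_eq]
  refine (norm_sub_le_norm_sub_add_norm_sub _ (actB HA HP B (actA HB HP (AliceUnitary.op u) Ψ))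
    _).trans ?_
  refine (add_le_add_right (norm_sub_le_norm_sub_add_norm_sub _
    (actB HA HP B (actA HB HP (AliceUnitary.op v) Ψ)) _) _).trans ?_
  linarith

theorem mirrors_list_prod {τ : ℝ} (l : List (AliceUnitary Ψ))
    (h : ∀ w ∈ l, ∃ B, Mirrors Ψ τ (AliceUnitary.op w) B) :
    ∃ B, Mirrors Ψ (l.length * τ) (AliceUnitary.op l.prod) B := by
  induction l with
  | nil =>
    refine ⟨1, ?_⟩
    rw [List.length_nil, Nat.cast_zero, zero_mul, List.prod_nil, map_one]
    exact Mirrors.one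
  | cons w l ih =>
    obtain ⟨B, hB⟩ := ih fun w' hw' => h w' (List.mem_cons_of_mem _ hw')
    obtain ⟨B', hB'⟩ := h w List.mem_cons_self
    refine ⟨B * B', ?_⟩
    rw [List.length_cons, List.prod_cons, map_mul, Nat.cast_add, Nat.cast_one, add_mul, one_mul,
      add_comm]
    exact hB'.mul hB (AliceUnitary.norm_op w)

/-- A product of observables has a mirror image if each of the observables does. -/
theorem mirrors_bitsProd {n : ℕ} {τ : ℝ} (hτ : 0 ≤ τ) (M : Fin n → AliceUnitary Ψ)
    (h : ∀ i, ∃ B, Mirrors Ψ τ (AliceUnitary.op (M i)) B) (a : Fin n → Fin 2) :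
    ∃ B, Mirrors Ψ (n * τ) (AliceUnitary.op (bitsProd M a)) B := by
  obtain ⟨B, hB⟩ := mirrors_list_prod (((List.finRange n).filter (fun j => a j = 1)).map M)
    (τ := τ) fun w hw => by
      obtain ⟨j, _, rfl⟩ := List.mem_map.mp hw
      exact h j
  refine ⟨B, hB.norm_map, hB.norm_sub_le.trans (mul_le_mul_of_nonneg_right ?_ hτ)⟩
  rw [List.length_map]
  refine Nat.cast_le.mpr ((List.length_filter_le _ _).trans ?_)
  rw [List.length_finRange]

end Mirror

/-! ### The relations that follow from the correlations -/

section Observables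

variable {H : Type*} [NormedAddCommGroup H] [InnerProductSpace ℂ H] [CompleteSpace H]

/-- A single `±1`-valued observable. -/
def IsObservable (M : H →L[ℂ] H) : Prop := IsSelfAdjoint M ∧ M * M = 1

theorem IsObservable.mem_unitary {M : H →L[ℂ] H} (h : IsObservable M) :
    M ∈ unitary (H →L[ℂ] H) := by
  rw [Unitary.mem_iff, h.1.star_eq]
  exact ⟨h.2, h.2⟩

theorem IsObservable.norm_map {M : H →L[ℂ] H} (h : IsObservable M) (x : H) : ‖M x‖ = ‖x‖ :=
  ContinuousLinearMap.norm_map_of_mem_unitary h.mem_unitary x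

theorem IsObservable.mul {M N : H →L[ℂ] H} (hM : IsObservable M) (hN : IsObservable N)
    (h : M * N = N * M) : IsObservable (M * N) := by
  refine ⟨(hM.1.commute_iff hN.1).mp h, ?_⟩
  rw [mul_assoc, ← mul_assoc N, ← h, mul_assoc, hN.2, mul_one, hM.2]

theorem IsObservable.neg {M : H →L[ℂ] H} (hM : IsObservable M) : IsObservable (-M) :=
  ⟨hM.1.neg, by rw [neg_mul_neg, hM.2]⟩

end Observables

section Relations

variable {HA : Type u} {HB : Type v} {HP : Type w}
  [NormedAddCommGroup HA] [InnerProductSpace ℂ HA] [CompleteSpace HA]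
  [NormedAddCommGroup HB] [InnerProductSpace ℂ HB] [NormedAddCommGroup HP] [InnerProductSpace ℂ HP]
  {n : ℕ}

/-- An observable of Alice as an element of her group of unitaries. -/
def IsObservable.toUnitary (Ψ : JointSpace HA HB HP) {M : HA →L[ℂ] HA} (h : IsObservable M) :
    AliceUnitary Ψ :=
  ⟨M, h.mem_unitary⟩

/-- The sign `-1` as a unitary of Alice. -/
def AliceUnitary.sign (Ψ : JointSpace HA HB HP) : AliceUnitary Ψ :=
  ⟨-1, by rw [Unitary.mem_iff]; simp⟩

variable {Ψ : JointSpace HA HB HP}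

theorem AliceUnitary.op_injective :
    Function.Injective (AliceUnitary.op : AliceUnitary Ψ →* (HA →L[ℂ] HA)) :=
  Subtype.val_injective

theorem AliceUnitary.op_sign : AliceUnitary.op (AliceUnitary.sign Ψ) = -1 := rfl

/-- The products of the observables of a joint measurement of Alice. -/
def measurementProd (Ψ : JointSpace HA HB HP) {M : Fin n → HA →L[ℂ] HA}
    (h : IsJointMeasurement (Set.range M)) : (Fin n → Fin 2) → AliceUnitary Ψ :=
  bitsProd fun i => IsObservable.toUnitary Ψ (h.1 (M i) ⟨i, rfl⟩)

variable {M : Fin n → HA →L[ℂ] HA} (h : IsJointMeasurement (Set.range M))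

theorem measurementProd_add (a b : Fin n → Fin 2) :
    measurementProd Ψ h (a + b) = measurementProd Ψ h a * measurementProd Ψ h b :=
  bitsProd_add (fun i => AliceUnitary.op_injective (h.1 (M i) ⟨i, rfl⟩).2)
    (fun i j => AliceUnitary.op_injective (h.2 (M i) ⟨i, rfl⟩ (M j) ⟨j, rfl⟩)) a b

theorem op_measurementProd (a : Fin n → Fin 2) :
    AliceUnitary.op (measurementProd Ψ h a) = bitsProd M a :=
  map_bitsProd _ _ _

theorem op_measurementProd_bit (i : Fin n) :
    AliceUnitary.op (measurementProd Ψ h (bit i)) = M i := by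
  rw [op_measurementProd, bitsProd_bit]

theorem op_measurementProd_allBut (k : Fin n) :
    AliceUnitary.op (measurementProd Ψ h (allBut k)) = prodExcept M k := by
  rw [op_measurementProd, prodExcept_eq_bitsProd]

theorem isObservable_bitsProd {M : Fin n → HA →L[ℂ] HA}
    (h : IsJointMeasurement (Set.range M)) (a : Fin n → Fin 2) (Ψ : JointSpace HA HB HP) :
    (∀ x, ‖bitsProd M a x‖ = ‖x‖) ∧ bitsProd M a * bitsProd M a = 1 := by
  rw [← op_measurementProd (Ψ := Ψ) h]
  refine ⟨AliceUnitary.norm_op _, ?_⟩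
  rw [← map_mul, bits_map_mul_self (measurementProd_add h), map_one]

/-- Operators of Alice whose mirror images commute almost commute on the state. -/
theorem dist_mul_le_of_mirrors {u v : AliceUnitary Ψ} {B C : HB →L[ℂ] HB} {c d : ℝ}
    (hu : Mirrors Ψ c (AliceUnitary.op u) B) (hv : Mirrors Ψ d (AliceUnitary.op v) C)
    (hBC : B * C = C * B) : dist (u * v) (v * u) ≤ 2 * (c + d) := by
  have h1 := hu.mul hv (AliceUnitary.norm_op u)
  have h2 := hv.mul hu (AliceUnitary.norm_op v)
  rw [← map_mul] at h1 h2
  rw [hBC] at h2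
  rw [AliceUnitary.dist_eq]
  refine (h1.norm_sub_le_add h2).trans (le_of_eq ?_)
  ring

variable [CompleteSpace HB]

/-- Mirror images of the observables of Alice that the correlations provide. -/
structure HasMirrors (Ψ : JointSpace HA HB HP) (a : AliceObservables n HA)
    (b : BobObservables n HB) (τ : ℝ) : Prop where
  gameX : ∀ k, Mirrors Ψ τ (prodExcept a.X k) (b.gameX k)
  gameY : ∀ k, Mirrors Ψ τ (prodExcept a.Y k) (-(b.gameX k * b.gameZ k))
  gameZ : ∀ k, Mirrors Ψ τ (prodExcept a.Z k) (b.gameZ k)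
  localX : ∀ i, Mirrors Ψ τ (a.X i) (b.localX i)
  localZ : ∀ i j, i ≠ j → Mirrors Ψ τ (a.Z i) (b.localZ j i)
  pairX : ∀ i j, i ≠ j → Mirrors Ψ τ (a.X i * a.X j) (b.pairX s(i, j))
  pairZ : ∀ i j, i ≠ j → Mirrors Ψ τ (a.Z i * a.Z j) (b.pairZ s(i, j))

theorem hasMirrors (hΨ : ‖Ψ‖ = 1) (hn : n % 2 = 1) (h1n : 1 < n) (a : AliceObservables n HA)
    (b : BobObservables n HB) {ε₀ ε₁ ε₂ ε : ℝ} (h0 : GameCorrelations Ψ a b ε₀)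
    (h1 : LocalCheckCorrelations Ψ a b ε₁) (h2 : PairCheckCorrelations Ψ a b ε₂)
    (hε₀ : ε₀ ≤ ε) (hε₁ : ε₁ ≤ ε) (hε₂ : ε₂ ≤ ε) : HasMirrors Ψ a b (√(2 * ε)) := by
  have mono : ∀ {δ}, δ ≤ ε → √(2 * δ) ≤ √(2 * ε) := fun h => Real.sqrt_le_sqrt (by linarith)
  have oX : ∀ i, IsObservable (a.X i) := fun i => a.input_one.1 _ ⟨i, rfl⟩
  have oZ : ∀ i, IsObservable (a.Z i) := fun i => a.input_three.1 _ ⟨i, rfl⟩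
  have ogX : ∀ k, IsObservable (b.gameX k) := fun k => (b.game_input k).1 _ (by simp)
  have ogZ : ∀ k, IsObservable (b.gameZ k) := fun k => (b.game_input k).1 _ (by simp)
  have : Nontrivial (Fin n) := Fin.nontrivial_iff_two_le.mpr h1n
  have cX : ∀ i j, a.X i * a.X j = a.X j * a.X i := fun i j =>
    a.input_one.2 _ ⟨i, rfl⟩ _ ⟨j, rfl⟩
  have cZ : ∀ i j, a.Z i * a.Z j = a.Z j * a.Z i := fun i j =>
    a.input_three.2 _ ⟨i, rfl⟩ _ ⟨j, rfl⟩
  have opair : ∀ i j, i ≠ j → IsObservable (b.pairX s(i, j)) ∧ IsObservable (b.pairZ s(i, j)) :=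
    fun i j hij => by
      obtain ⟨y, hy⟩ := exists_mem_checkedPairs hn hij
      exact ⟨(b.pair_input y).1 _ (Or.inl ⟨_, hy, rfl⟩), (b.pair_input y).1 _ (Or.inr ⟨_, hy, rfl⟩)⟩
  refine ⟨fun k => ?_, fun k => ?_, fun k => ?_, fun i => ?_, fun i j hij => ?_,
    fun i j hij => ?_, fun i j hij => ?_⟩
  · have hX := isObservable_bitsProd a.input_one (allBut k) Ψ
    rw [← prodExcept_eq_bitsProd] at hX
    exact (mirrors_of_le_inner hΨ hX.1 hX.2 (ogX k).norm_map (h0 k).1).mono (mono hε₀)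
  · have hY := isObservable_bitsProd a.input_two (allBut k) Ψ
    rw [← prodExcept_eq_bitsProd] at hY
    have ho := (((ogX k).mul (ogZ k) ((b.game_input k).2 _ (by simp) _ (by simp))).neg).norm_map
    refine (mirrors_of_le_inner hΨ hY.1 hY.2 ho ?_).mono (mono hε₀)
    have e : jointOp HP (prodExcept a.Y k) (-(b.gameX k * b.gameZ k)) Ψ
        = -jointOp HP (prodExcept a.Y k) (b.gameX k * b.gameZ k) Ψ := by
      rw [← actA_actB, ← actA_actB, actB_neg, map_neg]
    rw [e, inner_neg_right, Complex.neg_re]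
    exact (h0 k).2.1
  · have hZ := isObservable_bitsProd a.input_three (allBut k) Ψ
    rw [← prodExcept_eq_bitsProd] at hZ
    exact (mirrors_of_le_inner hΨ hZ.1 hZ.2 (ogZ k).norm_map (h0 k).2.2).mono (mono hε₀)
  · obtain ⟨j, hj⟩ := exists_ne i
    have ho : IsObservable (b.localX i) := (b.local_input i).1 _ (Or.inl rfl)
    exact (mirrors_of_le_inner hΨ (oX i).norm_map (oX i).2 ho.norm_map (h1 i j hj.symm).1).mono
      (mono hε₁)
  · have ho : IsObservable (b.localZ j i) := (b.local_input j).1 _ (Or.inr ⟨i, hij, rfl⟩)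
    exact (mirrors_of_le_inner hΨ (oZ i).norm_map (oZ i).2 ho.norm_map (h1 i j hij).2).mono
      (mono hε₁)
  · have ho := (oX i).mul (oX j) (cX i j)
    exact (mirrors_of_le_inner hΨ ho.norm_map ho.2 (opair i j hij).1.norm_map
      (h2 i j hij).1).mono (mono hε₂)
  · have ho := (oZ i).mul (oZ j) (cZ i j)
    exact (mirrors_of_le_inner hΨ ho.norm_map ho.2 (opair i j hij).2.norm_map
      (h2 i j hij).2).mono (mono hε₂)

theorem HasMirrors.checkRelations {a : AliceObservables n HA} {b : BobObservables n HB} {τ : ℝ}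
    (h : HasMirrors Ψ a b τ) (hn : n % 2 = 1) (h1n : 1 < n) :
    CheckRelations τ (measurementProd Ψ a.input_one) (measurementProd Ψ a.input_two)
      (measurementProd Ψ a.input_three) (AliceUnitary.sign Ψ) := by
  have : Nontrivial (Fin n) := Fin.nontrivial_iff_two_le.mpr h1n
  set x := measurementProd Ψ a.input_one with hx
  set y := measurementProd Ψ a.input_two with hy
  set z := measurementProd Ψ a.input_three with hz
  have mX : ∀ i, Mirrors Ψ τ (AliceUnitary.op (x (bit i))) (b.localX i) := fun i => by
    rw [hx, op_measurementProd_bit]; exact h.localX i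
  have mZ : ∀ i j, i ≠ j → Mirrors Ψ τ (AliceUnitary.op (z (bit i))) (b.localZ j i) :=
    fun i j hij => by rw [hz, op_measurementProd_bit]; exact h.localZ i j hij
  have mgX : ∀ k, Mirrors Ψ τ (AliceUnitary.op (x (allBut k))) (b.gameX k) := fun k => by
    rw [hx, op_measurementProd_allBut]; exact h.gameX k
  have mgY : ∀ k, Mirrors Ψ τ (AliceUnitary.op (y (allBut k))) (-(b.gameX k * b.gameZ k)) :=
    fun k => by rw [hy, op_measurementProd_allBut]; exact h.gameY k
  have mgZ : ∀ k, Mirrors Ψ τ (AliceUnitary.op (z (allBut k))) (b.gameZ k) := fun k => by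
    rw [hz, op_measurementProd_allBut]; exact h.gameZ k
  have mpX : ∀ i j, i ≠ j → Mirrors Ψ τ (AliceUnitary.op (x (bit i + bit j))) (b.pairX s(i, j)) :=
    fun i j hij => by
      rw [hx, measurementProd_add, map_mul, op_measurementProd_bit, op_measurementProd_bit]
      exact h.pairX i j hij
  have mpZ : ∀ i j, i ≠ j → Mirrors Ψ τ (AliceUnitary.op (z (bit i + bit j))) (b.pairZ s(i, j)) :=
    fun i j hij => by
      rw [hz, measurementProd_add, map_mul, op_measurementProd_bit, op_measurementProd_bit]
      exact h.pairZ i j hij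
  have gcomm : ∀ k, b.gameX k * b.gameZ k = b.gameZ k * b.gameX k := fun k =>
    (b.game_input k).2 _ (by simp) _ (by simp)
  -- a mirror image of `g` gives one of `-g`
  have neg : ∀ {c : ℝ} {g : AliceUnitary Ψ} {B : HB →L[ℂ] HB}, Mirrors Ψ c (AliceUnitary.op g) B →
      Mirrors Ψ c (AliceUnitary.op (AliceUnitary.sign Ψ * g)) (-B) := fun {c g B} hg => by
    refine ⟨fun t => ?_, ?_⟩
    · rw [neg_apply, norm_neg, hg.norm_map]
    · rw [map_mul, AliceUnitary.op_sign, neg_one_mul, actA_neg, actB_neg, neg_sub_neg, norm_sub_rev]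
      exact hg.norm_sub_le
  refine ⟨measurementProd_add _, measurementProd_add _, measurementProd_add _, fun g => ?_, ?_,
    fun i => (mX i).almostRightInvariant, fun i => ?_, fun i => (mgX i).almostRightInvariant,
    fun i => (mgY i).almostRightInvariant, fun i j hij => ?_, fun i j hij => ?_, fun k => ?_,
    fun k => ?_⟩
  · refine AliceUnitary.op_injective ?_
    rw [map_mul, map_mul, AliceUnitary.op_sign, neg_one_mul, mul_neg_one]
  · refine AliceUnitary.op_injective ?_
    rw [map_mul, AliceUnitary.op_sign, map_one]; simp
  · obtain ⟨j, hj⟩ := exists_ne i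
    exact (mZ i j hj.symm).almostRightInvariant
  · have hc : b.localX i * b.localZ i j = b.localZ i j * b.localX i :=
      (b.local_input i).2 _ (Or.inl rfl) _ (Or.inr ⟨j, hij.symm, rfl⟩)
    exact (dist_mul_le_of_mirrors (mX i) (mZ j i hij.symm) hc).trans (by linarith)
  · obtain ⟨t, ht⟩ := exists_mem_checkedPairs hn hij
    have hc : b.pairX s(i, j) * b.pairZ s(i, j) = b.pairZ s(i, j) * b.pairX s(i, j) :=
      (b.pair_input t).2 _ (Or.inl ⟨_, ht, rfl⟩) _ (Or.inr ⟨_, ht, rfl⟩)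
    exact (dist_mul_le_of_mirrors (mpX i j hij) (mpZ i j hij) hc).trans (by linarith)
  · have h2 := (mgZ k).mul (mgX k) (AliceUnitary.norm_op _)
    rw [← map_mul] at h2
    have h2 := neg h2
    rw [mul_assoc, AliceUnitary.dist_eq]
    exact ((mgY k).norm_sub_le_add h2).trans (by linarith)
  · have h2 := (mgX k).mul (mgZ k) (AliceUnitary.norm_op _)
    rw [← gcomm, ← map_mul] at h2
    have h2 := neg h2
    rw [mul_assoc, AliceUnitary.dist_eq]
    exact ((mgY k).norm_sub_le_add h2).trans (by linarith)

end Relations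

/-! ### The approximate intertwining relations -/

namespace CheckRelations

variable {n : ℕ} {G : Type*} [Group G] [PseudoMetricSpace G] [IsIsometricSMul G G] {τ : ℝ}
  {x y z : (Fin n → Fin 2) → G} {m : G}

theorem alice_intertwines (h : CheckRelations τ x y z m) (hn : n % 4 = 3) (j : Fin n)
    (a b : Fin n → Fin 2) :
    dist (z b * x a * z (bit j)) ((if a j = 1 then m else 1) * (z (b + bit j) * x a))
      ≤ 120 * n ^ 2 * τ := by
  have h1 := dist_mul_left_le (z b) (h.comm_signed hn j a)
  have e : z b * ((if a j = 1 then m else 1) * (z (bit j) * x a))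
      = (if a j = 1 then m else 1) * (z (b + bit j) * x a) := by
    split_ifs
    · rw [h.z_add, ← mul_assoc, ← h.m_comm]; simp only [mul_assoc]
    · rw [h.z_add, one_mul, one_mul, mul_assoc]
  rwa [e, ← mul_assoc] at h1

theorem bob_intertwines (h : CheckRelations τ x y z m) (hn : n % 4 = 3) (j : Fin n)
    (a b : Fin n → Fin 2) :
    dist (z (bit j) * (x a * z b)) ((if a j = 1 then m else 1) * (x a * z (b + bit j)))
      ≤ 120 * n ^ 2 * τ + 2 * (n * τ) := by
  have h1 := dist_mul_left_le (if a j = 1 then m else 1) (h.comm_signed hn j a)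
  have hs : (if a j = 1 then m else 1) * (if a j = 1 then m else 1) = 1 := by
    split_ifs
    · exact h.m_sq
    · exact one_mul 1
  rw [← mul_assoc (if a j = 1 then m else 1) (if a j = 1 then m else 1), hs, one_mul, dist_comm]
    at h1
  have h2 := (map_ari h.z_add (h.tau_nonneg (by omega)) h.z_bit b).dist_mul_right_le h1
  rw [add_comm b, h.z_add]
  simpa only [mul_assoc] using h2

end CheckRelations

section Attach

variable {n : ℕ} {H K : Type*} [NormedAddCommGroup H] [InnerProductSpace ℂ H]
  [NormedAddCommGroup K] [InnerProductSpace ℂ K] (j : Qubits n ⊗[ℂ] H →ₗᵢ[ℂ] K)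

theorem pauliX_attach (i : Fin n) (p : PauliIndex n) (v : H) :
    mapL (onQubit pauliX i) (.id ℂ K) (attach j (bellBasis p) v)
      = attach j (bellBasis (p.1 + bit i, p.2)) v := by
  rw [mapL_attach, pauliX_left_bellBasis]

theorem pauliZ_attach (i : Fin n) (p : PauliIndex n) (v : H) :
    mapL (onQubit pauliZ i) (.id ℂ K) (attach j (bellBasis p) v)
      = character (bit i) p.1 • attach j (bellBasis (p.1, p.2 + bit i)) v := by
  rw [mapL_attach, pauliZ_left_bellBasis, attach_smul]
  rfl

variable (n) in
/-- The permutation of the Bell basis by the Pauli operator `X` on qubit `i`. -/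
def shiftX (i : Fin n) : Equiv.Perm (PauliIndex n) :=
  (Equiv.addRight (bit i)).prodCongr (Equiv.refl _)

variable (n) in
/-- The permutation of the Bell basis by the Pauli operator `Z` on qubit `i`. -/
def shiftZ (i : Fin n) : Equiv.Perm (PauliIndex n) :=
  (Equiv.refl _).prodCongr (Equiv.addRight (bit i))

theorem pauliX_attach_shiftX (i : Fin n) (p : PauliIndex n) (v : H) :
    mapL (onQubit pauliX i) (.id ℂ K) (attach j (bellBasis (shiftX n i p)) v)
      = (1 : ℂ) • attach j (bellBasis p) v := by
  have e : (p.1 + bit i + bit i, p.2) = p := by rw [add_assoc, bits_add_self, add_zero]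
  rw [pauliX_attach, one_smul]
  exact congrArg (fun q => attach j (bellBasis q) v) e

theorem pauliZ_attach_shiftZ (i : Fin n) (p : PauliIndex n) (v : H) :
    mapL (onQubit pauliZ i) (.id ℂ K) (attach j (bellBasis (shiftZ n i p)) v)
      = character (bit i) p.1 • attach j (bellBasis p) v := by
  have e : (p.1, p.2 + bit i + bit i) = p := by rw [add_assoc, bits_add_self, add_zero]
  rw [pauliZ_attach]
  exact congrArg (fun q => character (bit i) p.1 • attach j (bellBasis q) v) e

/-- The isometry `2^{-n} ∑_p |φ_p⟩ ⊗ U_p`, where `φ_p` runs through the Bell basis. -/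
def bellTwirl (U : PauliIndex n → H →L[ℂ] H) : H →L[ℂ] Qubits n ⊗[ℂ] K :=
  twirl (F := Qubits n ⊗[ℂ] K) (bellNorm n ^ 2) (fun p : PauliIndex n => attach j (bellBasis p)) U

theorem norm_bellTwirl (U : PauliIndex n → H →L[ℂ] H) (hU : ∀ p x, ‖U p x‖ = ‖x‖) (x : H) :
    ‖bellTwirl j U x‖ = ‖x‖ :=
  norm_twirl (F := Qubits n ⊗[ℂ] K) (orthogonalIsometries_attach_bellBasis j) (card_pauliIndex n)
    U hU x

end Attach

section Intertwine

variable {HA KA : Type u} {HB KB : Type v} {HP : Type w} {n : ℕ}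
  [NormedAddCommGroup HA] [InnerProductSpace ℂ HA] [NormedAddCommGroup HB] [InnerProductSpace ℂ HB]
  [NormedAddCommGroup KA] [InnerProductSpace ℂ KA] [NormedAddCommGroup KB] [InnerProductSpace ℂ KB]
  [NormedAddCommGroup HP] [InnerProductSpace ℂ HP]

theorem bellTwirl_left_intertwines (j : Qubits n ⊗[ℂ] HA →ₗᵢ[ℂ] KA)
    (U : PauliIndex n → HA →L[ℂ] HA) (S : Qubits n ⊗[ℂ] KA →L[ℂ] Qubits n ⊗[ℂ] KA)
    (π : Equiv.Perm (PauliIndex n)) (s : PauliIndex n → ℂ)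
    (hS : ∀ p x, S (attach j (bellBasis (π p)) x) = s p • attach j (bellBasis p) x)
    {δ : ℝ} (hδ : 0 ≤ δ) (x y : JointSpace HA HB HP)
    (h : ∀ p, ‖actA HB HP (U p) y - s p • actA HB HP (U (π p)) x‖ ≤ δ) :
    ‖jointOp HP (bellTwirl j U) (1 : HB →L[ℂ] HB) y
      - jointOp HP S (1 : HB →L[ℂ] HB) (jointOp HP (bellTwirl j U) (1 : HB →L[ℂ] HB) x)‖ ≤ δ :=
  twirl_left_intertwines (FA := Qubits n ⊗[ℂ] KA) (orthogonalIsometries_attach_bellBasis j)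
    (card_pauliIndex n) U S π s hS hδ x y h

theorem bellTwirl_right_intertwines (j : Qubits n ⊗[ℂ] HB →ₗᵢ[ℂ] KB)
    (U : PauliIndex n → HB →L[ℂ] HB) (S : Qubits n ⊗[ℂ] KB →L[ℂ] Qubits n ⊗[ℂ] KB)
    (π : Equiv.Perm (PauliIndex n)) (s : PauliIndex n → ℂ)
    (hS : ∀ p x, S (attach j (bellBasis (π p)) x) = s p • attach j (bellBasis p) x)
    {δ : ℝ} (hδ : 0 ≤ δ) (x y : JointSpace HA HB HP)
    (h : ∀ p, ‖actB HA HP (U p) y - s p • actB HA HP (U (π p)) x‖ ≤ δ) :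
    ‖jointOp HP (1 : HA →L[ℂ] HA) (bellTwirl j U) y
      - jointOp HP (1 : HA →L[ℂ] HA) S (jointOp HP (1 : HA →L[ℂ] HA) (bellTwirl j U) x)‖ ≤ δ :=
  twirl_right_intertwines (FB := Qubits n ⊗[ℂ] KB) (orthogonalIsometries_attach_bellBasis j)
    (card_pauliIndex n) U S π s hS hδ x y h

variable {FA : Type u} {FB : Type v} [NormedAddCommGroup FA] [InnerProductSpace ℂ FA]
  [NormedAddCommGroup FB] [InnerProductSpace ℂ FB]

/-- An intertwining relation for the isometry of Alice survives the action of that of Bob. -/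
theorem intertwines_of_left {A : HA →L[ℂ] FA} {B : HB →L[ℂ] FB} (hB : ∀ x, ‖B x‖ = ‖x‖)
    (S : FA →L[ℂ] FA) {x y : JointSpace HA HB HP} {δ : ℝ}
    (h : ‖jointOp HP A (1 : HB →L[ℂ] HB) y
      - jointOp HP S (1 : HB →L[ℂ] HB) (jointOp HP A (1 : HB →L[ℂ] HB) x)‖ ≤ δ) :
    ‖jointOp HP A B y - jointOp HP S (1 : FB →L[ℂ] FB) (jointOp HP A B x)‖ ≤ δ := by
  have e1 : jointOp HP (1 : FA →L[ℂ] FA) B (jointOp HP A (1 : HB →L[ℂ] HB) y) = jointOp HP A B y :=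
    jointOp_comp_apply 1 B A 1 y
  have e2 : jointOp HP (1 : FA →L[ℂ] FA) B
        (jointOp HP S (1 : HB →L[ℂ] HB) (jointOp HP A (1 : HB →L[ℂ] HB) x))
      = jointOp HP S (1 : FB →L[ℂ] FB) (jointOp HP A B x) := by
    rw [jointOp_left_comp_apply]
    exact (jointOp_comp_apply 1 B (S.comp A) 1 x).trans (jointOp_comp_apply S 1 A B x).symm
  rw [← e1, ← e2, ← map_sub, norm_jointOp 1 B (fun _ => rfl) hB]
  exact h

theorem intertwines_of_right {A : HA →L[ℂ] FA} {B : HB →L[ℂ] FB} (hA : ∀ x, ‖A x‖ = ‖x‖)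
    (S : FB →L[ℂ] FB) {x y : JointSpace HA HB HP} {δ : ℝ}
    (h : ‖jointOp HP (1 : HA →L[ℂ] HA) B y
      - jointOp HP (1 : HA →L[ℂ] HA) S (jointOp HP (1 : HA →L[ℂ] HA) B x)‖ ≤ δ) :
    ‖jointOp HP A B y - jointOp HP (1 : FA →L[ℂ] FA) S (jointOp HP A B x)‖ ≤ δ := by
  have e1 : jointOp HP A (1 : FB →L[ℂ] FB) (jointOp HP (1 : HA →L[ℂ] HA) B y) = jointOp HP A B y :=
    jointOp_comp_apply A 1 1 B y
  have e2 : jointOp HP A (1 : FB →L[ℂ] FB)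
        (jointOp HP (1 : HA →L[ℂ] HA) S (jointOp HP (1 : HA →L[ℂ] HA) B x))
      = jointOp HP (1 : FA →L[ℂ] FA) S (jointOp HP A B x) := by
    rw [jointOp_right_comp_apply]
    exact (jointOp_comp_apply A 1 1 (S.comp B) x).trans (jointOp_comp_apply 1 S A B x).symm
  rw [← e1, ← e2, ← map_sub, norm_jointOp A 1 hA (fun _ => rfl)]
  exact h

end Intertwine

section Estimates

variable {HA : Type u} {HB : Type v} {HP : Type w}
  [NormedAddCommGroup HA] [InnerProductSpace ℂ HA] [CompleteSpace HA]
  [NormedAddCommGroup HB] [InnerProductSpace ℂ HB] [NormedAddCommGroup HP] [InnerProductSpace ℂ HP]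
  {n : ℕ} {Ψ : JointSpace HA HB HP}

theorem character_smul_actA (i : Fin n) (a : Fin n → Fin 2) (g : AliceUnitary Ψ) :
    character (bit i) a • actA HB HP (AliceUnitary.op g) Ψ = actA HB HP
      (AliceUnitary.op ((if a i = 1 then AliceUnitary.sign Ψ else 1) * g)) Ψ := by
  rw [character_bit]
  split_ifs
  · rw [map_mul, AliceUnitary.op_sign, neg_one_mul, actA_neg, neg_one_smul]
  · rw [one_mul, one_smul]

theorem norm_character_bit (i : Fin n) (a : Fin n → Fin 2) : ‖character (bit i) a‖ = 1 := by
  rw [character_bit]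
  split_ifs <;> simp

/-- A relation among unitaries of Alice carries over to their mirror images. -/
theorem Mirrors.norm_sub_smul_le {c d e : ℝ} {g w w' : AliceUnitary Ψ} {B V V' : HB →L[ℂ] HB}
    (hB : Mirrors Ψ c (AliceUnitary.op g) B) (hV : Mirrors Ψ d (AliceUnitary.op w) V)
    (hV' : Mirrors Ψ d (AliceUnitary.op w') V') {s : ℂ} (hs : ‖s‖ = 1)
    (h : ‖actA HB HP (AliceUnitary.op (g * w)) Ψ - s • actA HB HP (AliceUnitary.op w') Ψ‖ ≤ e) :
    ‖actB HA HP V (actB HA HP B Ψ) - s • actB HA HP V' Ψ‖ ≤ c + 2 * d + e := by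
  have h1 : ‖actB HA HP V (actB HA HP B Ψ) - actB HA HP V (actA HB HP (AliceUnitary.op g) Ψ)‖
      ≤ c := by
    rw [← map_sub, norm_actB hV.norm_map, norm_sub_rev]
    exact hB.norm_sub_le
  have h2 : ‖actB HA HP V (actA HB HP (AliceUnitary.op g) Ψ)
      - actA HB HP (AliceUnitary.op (g * w)) Ψ‖ ≤ d := by
    rw [actB_actA, map_mul, actA_mul, ← map_sub, norm_actA (AliceUnitary.norm_op g), norm_sub_rev]
    exact hV.norm_sub_le
  have h3 : ‖s • actA HB HP (AliceUnitary.op w') Ψ - s • actB HA HP V' Ψ‖ ≤ d := by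
    rw [← smul_sub, norm_smul, hs, one_mul]
    exact hV'.norm_sub_le
  have t1 := norm_sub_le_norm_sub_add_norm_sub (actB HA HP V (actB HA HP B Ψ))
    (actB HA HP V (actA HB HP (AliceUnitary.op g) Ψ)) (s • actB HA HP V' Ψ)
  have t2 := norm_sub_le_norm_sub_add_norm_sub (actB HA HP V (actA HB HP (AliceUnitary.op g) Ψ))
    (actA HB HP (AliceUnitary.op (g * w)) Ψ) (s • actB HA HP V' Ψ)
  have t3 := norm_sub_le_norm_sub_add_norm_sub (actA HB HP (AliceUnitary.op (g * w)) Ψ)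
    (s • actA HB HP (AliceUnitary.op w') Ψ) (s • actB HA HP V' Ψ)
  linarith

end Estimates

/-! ### The common junk state -/

section Junk

variable {ι E F : Type*} [Fintype ι] [DecidableEq ι] [NormedAddCommGroup E] [InnerProductSpace ℂ E]
  [CompleteSpace E] [NormedAddCommGroup F] [InnerProductSpace ℂ F] [CompleteSpace F]

/-- An operator that permutes the ranges of the `T p` up to phases is an isometry. -/
theorem OrthogonalIsometries.norm_map_eq {T : ι → E →L[ℂ] F} (hT : OrthogonalIsometries T)
    (ht : IsTotal T) {S : F →L[ℂ] F} (π : Equiv.Perm ι) {s : ι → ℂ}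
    (hS : ∀ p x, S (T p x) = s p • T (π p) x) (hs : ∀ p, ‖s p‖ = 1) (χ : F) : ‖S χ‖ = ‖χ‖ := by
  have h := hT.norm_sq_map_sub_map ht (S' := 0) π (s' := fun _ => 0) hS
    (fun p x => by rw [zero_apply, zero_smul]) χ
  have h2 := hT.norm_sq_sum fun p => ContinuousLinearMap.adjoint (T p) χ
  rw [hT.sum_adjoint ht] at h2
  simp only [zero_apply, sub_zero, hs, one_pow, one_mul] at h
  rw [← h2] at h
  exact (sq_eq_sq₀ (norm_nonneg _) (norm_nonneg _)).mp h

/-- If vectors `xA i`, `xB i`, `zA i`, `zB i` are close to the images of `χ` under the Pauli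
operators of the two parties and if `xA i` is close to `xB i` and `zA i` to `zB i`, then they all
are close to the images of the Bell state tensored with a common junk state. -/
theorem exists_junk_of_intertwines {n : ℕ} {T : PauliIndex n → E →L[ℂ] F}
    (hT : OrthogonalIsometries T) (ht : IsTotal T) {XA XB ZA ZB : Fin n → F →L[ℂ] F}
    (hXA : ∀ i p x, XA i (T p x) = T (p.1 + bit i, p.2) x)
    (hXB : ∀ i p x, XB i (T p x) = character (bit i) p.2 • T (p.1 + bit i, p.2) x)
    (hZA : ∀ i p x, ZA i (T p x) = character (bit i) p.1 • T (p.1, p.2 + bit i) x)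
    (hZB : ∀ i p x, ZB i (T p x) = T (p.1, p.2 + bit i) x)
    {χ : F} (hχ : ‖χ‖ = 1) {xA xB zA zB : Fin n → F} {η τ : ℝ} (hη : 0 ≤ η) (hτ : 0 ≤ τ)
    (hxA : ∀ i, ‖xA i - XA i χ‖ ≤ η) (hxB : ∀ i, ‖xB i - XB i χ‖ ≤ η)
    (hzA : ∀ i, ‖zA i - ZA i χ‖ ≤ η) (hzB : ∀ i, ‖zB i - ZB i χ‖ ≤ η)
    (hx : ∀ i, ‖xA i - xB i‖ ≤ τ) (hz : ∀ i, ‖zA i - zB i‖ ≤ τ) :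
    ∃ ξ : E, ‖ξ‖ = 1 ∧ ‖χ - T (0, 0) ξ‖ ≤ 2 * (√n * (2 * η + τ)) ∧ ∀ i,
      ‖xA i - XA i (T (0, 0) ξ)‖ ≤ η + 2 * (√n * (2 * η + τ)) ∧
      ‖zA i - ZA i (T (0, 0) ξ)‖ ≤ η + 2 * (√n * (2 * η + τ)) ∧
      ‖xB i - XB i (T (0, 0) ξ)‖ ≤ η + 2 * (√n * (2 * η + τ)) ∧
      ‖zB i - ZB i (T (0, 0) ξ)‖ ≤ η + 2 * (√n * (2 * η + τ)) := by
  have tri : ∀ a b c d : F, ‖a - c‖ ≤ η → ‖b - d‖ ≤ η → ‖a - b‖ ≤ τ → ‖c - d‖ ≤ 2 * η + τ := by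
    intro a b c d h1 h2 h3
    have t1 := norm_sub_le_norm_sub_add_norm_sub c a d
    have t2 := norm_sub_le_norm_sub_add_norm_sub a b d
    rw [norm_sub_rev c a] at t1
    linarith
  obtain ⟨ξ, hξ, hξχ⟩ := exists_junk hT ht hXA hXB hZA hZB hχ (δ := 2 * η + τ) (by linarith)
    (fun i => tri _ _ _ _ (hxA i) (hxB i) (hx i)) (fun i => tri _ _ _ _ (hzA i) (hzB i) (hz i))
  have step : ∀ {S : F →L[ℂ] F} {v : F}, (∀ t, ‖S t‖ = ‖t‖) → ‖v - S χ‖ ≤ η →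
      ‖v - S (T (0, 0) ξ)‖ ≤ η + 2 * (√n * (2 * η + τ)) := fun {S v} hS hv => by
    refine (norm_sub_le_norm_sub_add_norm_sub v (S χ) _).trans (add_le_add hv ?_)
    rw [← map_sub, hS]
    exact hξχ
  refine ⟨ξ, hξ, hξχ, fun i => ⟨step ?_ (hxA i), step ?_ (hzA i), step ?_ (hxB i), step ?_ (hzB i)⟩⟩
  · exact hT.norm_map_eq ht (shiftX n i) (s := fun _ => 1)
      (fun p x => (hXA i p x).trans (one_smul ℂ _).symm) fun _ => norm_one
  · exact hT.norm_map_eq ht (shiftZ n i) (hZA i) fun p => norm_character_bit i p.1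
  · exact hT.norm_map_eq ht (shiftX n i) (hXB i) fun p => norm_character_bit i p.2
  · exact hT.norm_map_eq ht (shiftZ n i) (s := fun _ => 1)
      (fun p x => (hZB i p x).trans (one_smul ℂ _).symm) fun _ => norm_one

end Junk

/-! ### The self-test -/

section PauliJunk

variable {KA : Type u} {KB : Type v} {HP : Type w}
  [NormedAddCommGroup KA] [InnerProductSpace ℂ KA] [NormedAddCommGroup KB] [InnerProductSpace ℂ KB]
  [NormedAddCommGroup HP] [InnerProductSpace ℂ HP]
  {QA QB : Type} [NormedAddCommGroup QA] [InnerProductSpace ℂ QA]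
  [NormedAddCommGroup QB] [InnerProductSpace ℂ QB]

theorem jointOp_left_jointJunk (σ : QA →L[ℂ] QA) (φ : QA ⊗[ℂ] QB) (x : JointSpace KA KB HP) :
    jointOp HP (mapL σ (.id ℂ KA)) (1 : QB ⊗[ℂ] KB →L[ℂ] QB ⊗[ℂ] KB) (jointJunk KA KB HP φ x)
      = jointJunk KA KB HP (mapL σ (.id ℂ QB) φ) x := by
  have h := jointOp_jointJunk σ (.id ℂ QB) φ x
  rwa [mapL_id_id] at h

theorem jointOp_right_jointJunk (ρ : QB →L[ℂ] QB) (φ : QA ⊗[ℂ] QB) (x : JointSpace KA KB HP) :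
    jointOp HP (1 : QA ⊗[ℂ] KA →L[ℂ] QA ⊗[ℂ] KA) (mapL ρ (.id ℂ KB)) (jointJunk KA KB HP φ x)
      = jointJunk KA KB HP (mapL (.id ℂ QA) ρ φ) x := by
  have h := jointOp_jointJunk (.id ℂ QA) ρ φ x
  rwa [mapL_id_id] at h

end PauliJunk

section Main

variable {HA KA : Type u} {HB KB : Type v} {HP : Type w} {n : ℕ}
  [NormedAddCommGroup HA] [InnerProductSpace ℂ HA] [CompleteSpace HA]
  [NormedAddCommGroup HB] [InnerProductSpace ℂ HB] [CompleteSpace HB]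
  [NormedAddCommGroup HP] [InnerProductSpace ℂ HP]
  [NormedAddCommGroup KA] [InnerProductSpace ℂ KA]
  [NormedAddCommGroup KB] [InnerProductSpace ℂ KB]
  {Ψ : JointSpace HA HB HP}

variable (KA KB HP n) in
/-- The reference operator `σ` on the `i`th qubit of Alice, on the joint space. -/
def refA (σ : Matrix (Fin 2) (Fin 2) ℂ) (i : Fin n) :
    JointSpace (Qubits n ⊗[ℂ] KA) (Qubits n ⊗[ℂ] KB) HP →L[ℂ]
      JointSpace (Qubits n ⊗[ℂ] KA) (Qubits n ⊗[ℂ] KB) HP :=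
  jointOp HP (mapL (onQubit σ i) (.id ℂ KA)) (1 : Qubits n ⊗[ℂ] KB →L[ℂ] Qubits n ⊗[ℂ] KB)

variable (KA KB HP n) in
/-- The reference operator `σ` on the `i`th qubit of Bob, on the joint space. -/
def refB (σ : Matrix (Fin 2) (Fin 2) ℂ) (i : Fin n) :
    JointSpace (Qubits n ⊗[ℂ] KA) (Qubits n ⊗[ℂ] KB) HP →L[ℂ]
      JointSpace (Qubits n ⊗[ℂ] KA) (Qubits n ⊗[ℂ] KB) HP :=
  jointOp HP (1 : Qubits n ⊗[ℂ] KA →L[ℂ] Qubits n ⊗[ℂ] KA) (mapL (onQubit σ i) (.id ℂ KB))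

theorem refA_jointJunk (σ : Matrix (Fin 2) (Fin 2) ℂ) (i : Fin n) (φ : Qubits n ⊗[ℂ] Qubits n)
    (x : JointSpace KA KB HP) : refA KA KB HP n σ i (jointJunk KA KB HP φ x)
      = jointJunk KA KB HP (mapL (onQubit σ i) (.id ℂ (Qubits n)) φ) x :=
  jointOp_left_jointJunk _ _ _

theorem refB_jointJunk (σ : Matrix (Fin 2) (Fin 2) ℂ) (i : Fin n) (φ : Qubits n ⊗[ℂ] Qubits n)
    (x : JointSpace KA KB HP) : refB KA KB HP n σ i (jointJunk KA KB HP φ x)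
      = jointJunk KA KB HP (mapL (.id ℂ (Qubits n)) (onQubit σ i) φ) x :=
  jointOp_right_jointJunk _ _ _

/-- The isometry of Alice intertwines her observables with the Pauli operators. -/
theorem exists_isometry_left {a : AliceObservables n HA} {b : BobObservables n HB} {τ : ℝ}
    (h : HasMirrors Ψ a b τ) (hn : n % 4 = 3) (j : Qubits n ⊗[ℂ] HA →ₗᵢ[ℂ] KA) :
    ∃ A : HA →L[ℂ] Qubits n ⊗[ℂ] KA, (∀ x, ‖A x‖ = ‖x‖) ∧ ∀ i,
      ‖jointOp HP A (1 : HB →L[ℂ] HB) (actA HB HP (a.X i) Ψ)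
        - jointOp HP (mapL (onQubit pauliX i) (.id ℂ KA)) (1 : HB →L[ℂ] HB)
          (jointOp HP A (1 : HB →L[ℂ] HB) Ψ)‖ ≤ 120 * n ^ 2 * τ ∧
      ‖jointOp HP A (1 : HB →L[ℂ] HB) (actA HB HP (a.Z i) Ψ)
        - jointOp HP (mapL (onQubit pauliZ i) (.id ℂ KA)) (1 : HB →L[ℂ] HB)
          (jointOp HP A (1 : HB →L[ℂ] HB) Ψ)‖ ≤ 120 * n ^ 2 * τ := by
  have hc := h.checkRelations (by omega) (by omega)
  have hτ := hc.tau_nonneg (by omega)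
  set x := measurementProd Ψ a.input_one with hx
  set z := measurementProd Ψ a.input_three with hz
  have hxi : ∀ i, a.X i = AliceUnitary.op (x (bit i)) := fun i =>
    (op_measurementProd_bit _ _).symm
  have hzi : ∀ i, a.Z i = AliceUnitary.op (z (bit i)) := fun i =>
    (op_measurementProd_bit _ _).symm
  let U : PauliIndex n → HA →L[ℂ] HA := fun p => AliceUnitary.op (z p.2 * x p.1)
  refine ⟨bellTwirl j U, norm_bellTwirl j U fun p => AliceUnitary.norm_op _, fun i => ⟨?_, ?_⟩⟩
  · refine bellTwirl_left_intertwines j U _ (shiftX n i) (fun _ => 1)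
      (pauliX_attach_shiftX j i) (by positivity) Ψ _ fun p => ?_
    have e : actA HB HP (U p) (actA HB HP (a.X i) Ψ) = actA HB HP (U (shiftX n i p)) Ψ := by
      rw [hxi, ← actA_mul, ← map_mul, mul_assoc, ← hc.x_add]
      rfl
    rw [e, one_smul, sub_self, norm_zero]
    positivity
  · refine bellTwirl_left_intertwines j U _ (shiftZ n i) (fun p => character (bit i) p.1)
      (pauliZ_attach_shiftZ j i) (by positivity) Ψ _ fun p => ?_
    have e := hc.alice_intertwines hn i p.1 p.2
    rw [AliceUnitary.dist_eq] at e
    rw [hzi, ← actA_mul, ← map_mul, character_smul_actA]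
    exact e

/-- The isometry of Bob intertwines his observables with the Pauli operators. It is built from
mirror images of the unitaries of Alice. -/
theorem exists_isometry_right {a : AliceObservables n HA} {b : BobObservables n HB} {τ : ℝ}
    (h : HasMirrors Ψ a b τ) (hn : n % 4 = 3) (h3 : 3 < n) {k : Fin n → Fin n} (hk : ∀ i, k i ≠ i)
    (j : Qubits n ⊗[ℂ] HB →ₗᵢ[ℂ] KB) :
    ∃ B : HB →L[ℂ] Qubits n ⊗[ℂ] KB, (∀ x, ‖B x‖ = ‖x‖) ∧ ∀ i,
      ‖jointOp HP (1 : HA →L[ℂ] HA) B (actB HA HP (b.localX i) Ψ)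
        - jointOp HP (1 : HA →L[ℂ] HA) (mapL (onQubit pauliX i) (.id ℂ KB))
          (jointOp HP (1 : HA →L[ℂ] HA) B Ψ)‖ ≤ 121 * n ^ 2 * τ ∧
      ‖jointOp HP (1 : HA →L[ℂ] HA) B (actB HA HP (b.localZ (k i) i) Ψ)
        - jointOp HP (1 : HA →L[ℂ] HA) (mapL (onQubit pauliZ i) (.id ℂ KB))
          (jointOp HP (1 : HA →L[ℂ] HA) B Ψ)‖ ≤ 121 * n ^ 2 * τ := by
  have hc := h.checkRelations (by omega) (by omega)
  have hτ := hc.tau_nonneg (by omega)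
  have mX : ∀ i, Mirrors Ψ τ (AliceUnitary.op (measurementProd Ψ a.input_one (bit i)))
      (b.localX i) := fun i => by
    rw [op_measurementProd_bit]; exact h.localX i
  have mZ : ∀ i, Mirrors Ψ τ (AliceUnitary.op (measurementProd Ψ a.input_three (bit i)))
      (b.localZ (k i) i) := fun i => by
    rw [op_measurementProd_bit]; exact h.localZ i (k i) (hk i).symm
  have hV : ∀ p : PauliIndex n, ∃ V : HB →L[ℂ] HB, Mirrors Ψ (n * τ + n * τ)
      (AliceUnitary.op (measurementProd Ψ a.input_one p.1 * measurementProd Ψ a.input_three p.2))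
      V := fun p => by
    obtain ⟨V, hV⟩ := mirrors_bitsProd hτ (fun i => IsObservable.toUnitary Ψ
      (a.input_one.1 (a.X i) ⟨i, rfl⟩)) (fun i => ⟨_, h.localX i⟩) p.1
    obtain ⟨V', hV'⟩ := mirrors_bitsProd hτ (fun i => IsObservable.toUnitary Ψ
      (a.input_three.1 (a.Z i) ⟨i, rfl⟩)) (fun i => ⟨_, h.localZ i (k i) (hk i).symm⟩) p.2
    refine ⟨V' * V, ?_⟩
    rw [map_mul]
    exact hV.mul hV' (AliceUnitary.norm_op _)
  choose V hV using hV
  set x := measurementProd Ψ a.input_one with hx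
  set z := measurementProd Ψ a.input_three with hz
  have hn7 : (7 : ℝ) ≤ n := by
    have : 7 ≤ n := by omega
    exact_mod_cast this
  have hbound : τ + 2 * (n * τ + n * τ) + (120 * n ^ 2 * τ + 2 * (n * τ)) ≤ 121 * n ^ 2 * τ := by
    nlinarith [mul_nonneg hτ (mul_nonneg (sub_nonneg.mpr hn7) (by linarith : (0 : ℝ) ≤ n)),
      mul_nonneg hτ (sub_nonneg.mpr hn7)]
  have hbound' : τ + 2 * (n * τ + n * τ) + 0 ≤ 121 * n ^ 2 * τ :=
    le_trans (add_le_add_right (by positivity) _) hbound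
  refine ⟨bellTwirl j V, norm_bellTwirl j V fun p => (hV p).norm_map, fun i => ⟨?_, ?_⟩⟩
  · refine bellTwirl_right_intertwines j V _ (shiftX n i) (fun _ => 1)
      (pauliX_attach_shiftX j i) (by positivity) Ψ _ fun p => ?_
    refine ((mX i).norm_sub_smul_le (hV p) (hV (shiftX n i p)) norm_one (e := 0) ?_).trans hbound'
    have e : x (bit i) * (x p.1 * z p.2) = x (shiftX n i p).1 * z (shiftX n i p).2 := by
      rw [← mul_assoc, ← hc.x_add, add_comm]
      rfl
    rw [e, one_smul, sub_self, norm_zero]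
  · refine bellTwirl_right_intertwines j V _ (shiftZ n i) (fun p => character (bit i) p.1)
      (pauliZ_attach_shiftZ j i) (by positivity) Ψ _ fun p => ?_
    refine ((mZ i).norm_sub_smul_le (hV p) (hV (shiftZ n i p)) (norm_character_bit i p.1)
      ?_).trans hbound
    have e := hc.bob_intertwines hn i p.1 p.2
    rw [AliceUnitary.dist_eq] at e
    rw [character_smul_actA]
    exact e

/-- The self-test for fixed spaces `KA` and `KB` of the junk state, into which the qubits of each
party, next to the space of that party, embed. -/
theorem exists_isometries_junk {a : AliceObservables n HA} {b : BobObservables n HB} {τ : ℝ}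
    (hΨ : ‖Ψ‖ = 1) (h : HasMirrors Ψ a b τ) (hn : n % 4 = 3) (h3 : 3 < n) {k : Fin n → Fin n}
    (hk : ∀ i, k i ≠ i) (jA : Qubits n ⊗[ℂ] HA →ₗᵢ[ℂ] KA) (jB : Qubits n ⊗[ℂ] HB →ₗᵢ[ℂ] KB) :
    ∃ (A : HA →L[ℂ] Qubits n ⊗[ℂ] KA) (B : HB →L[ℂ] Qubits n ⊗[ℂ] KB)
      (ξ : JointSpace KA KB HP), (∀ x, ‖A x‖ = ‖x‖) ∧ (∀ x, ‖B x‖ = ‖x‖) ∧ ‖ξ‖ = 1 ∧ ∀ i,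
      ‖jointOp HP A B Ψ - jointJunk KA KB HP (bellStates n) ξ‖ ≤ 607 * (n ^ 2 * √n) * τ ∧
      ‖jointOp HP A B (actA HB HP (a.X i) Ψ) - jointJunk KA KB HP (bellStatesActA pauliX i) ξ‖
        ≤ 607 * (n ^ 2 * √n) * τ ∧
      ‖jointOp HP A B (actA HB HP (a.Z i) Ψ) - jointJunk KA KB HP (bellStatesActA pauliZ i) ξ‖
        ≤ 607 * (n ^ 2 * √n) * τ ∧
      ‖jointOp HP A B (actB HA HP (b.localX i) Ψ)
        - jointJunk KA KB HP (bellStatesActB pauliX i) ξ‖ ≤ 607 * (n ^ 2 * √n) * τ ∧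
      ‖jointOp HP A B (actB HA HP (b.localZ (k i) i) Ψ)
        - jointJunk KA KB HP (bellStatesActB pauliZ i) ξ‖ ≤ 607 * (n ^ 2 * √n) * τ := by
  have hτ := (h.checkRelations (by omega) (by omega)).tau_nonneg (by omega)
  obtain ⟨A, hA, hA'⟩ := exists_isometry_left h hn jA
  obtain ⟨B, hB, hB'⟩ := exists_isometry_right h hn h3 hk jB
  have hle : 120 * (n : ℝ) ^ 2 * τ ≤ 121 * n ^ 2 * τ := by
    have : 0 ≤ (n : ℝ) ^ 2 * τ := by positivity
    linarith
  obtain ⟨ξ, hξ, h0, hi⟩ := exists_junk_of_intertwines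
    (E := JointSpace KA KB HP) (F := JointSpace (Qubits n ⊗[ℂ] KA) (Qubits n ⊗[ℂ] KB) HP)
    (T := fun p : PauliIndex n => jointJunk KA KB HP (bellBasis p))
    orthogonalIsometries_jointJunk_bellBasis isTotal_jointJunk_bellBasis
    (XA := refA KA KB HP n pauliX) (XB := refB KA KB HP n pauliX)
    (ZA := refA KA KB HP n pauliZ) (ZB := refB KA KB HP n pauliZ)
    (fun i p x => by rw [refA_jointJunk, pauliX_left_bellBasis])
    (fun i p x => by rw [refB_jointJunk, pauliX_right_bellBasis, jointJunk_smul, smul_apply])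
    (fun i p x => by rw [refA_jointJunk, pauliZ_left_bellBasis, jointJunk_smul, smul_apply])
    (fun i p x => by rw [refB_jointJunk, pauliZ_right_bellBasis])
    (χ := jointOp HP A B Ψ) ((norm_jointOp A B hA hB Ψ).trans hΨ)
    (xA := fun i => jointOp HP A B (actA HB HP (a.X i) Ψ))
    (xB := fun i => jointOp HP A B (actB HA HP (b.localX i) Ψ))
    (zA := fun i => jointOp HP A B (actA HB HP (a.Z i) Ψ))
    (zB := fun i => jointOp HP A B (actB HA HP (b.localZ (k i) i) Ψ))
    (η := 121 * n ^ 2 * τ) (τ := τ) (by positivity) hτ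
    (fun i => intertwines_of_left hB _ ((hA' i).1.trans hle))
    (fun i => intertwines_of_right hA _ (hB' i).1)
    (fun i => intertwines_of_left hB _ ((hA' i).2.trans hle))
    (fun i => intertwines_of_right hA _ (hB' i).2)
    (fun i => by rw [← map_sub, norm_jointOp A B hA hB]; exact (h.localX i).norm_sub_le)
    (fun i => by
      rw [← map_sub, norm_jointOp A B hA hB]; exact (h.localZ i (k i) (hk i).symm).norm_sub_le)
  have hn1 : (1 : ℝ) ≤ n := by
    have : 1 ≤ n := by omega
    exact_mod_cast this
  have hs : 1 ≤ √(n : ℝ) := Real.one_le_sqrt.mpr hn1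
  have hnn : (1 : ℝ) ≤ (n : ℝ) ^ 2 := one_le_pow₀ hn1
  have hmono : τ ≤ (n : ℝ) ^ 2 * τ := le_mul_of_one_le_left hτ hnn
  have hmono' : (n : ℝ) ^ 2 * τ ≤ √n * (n ^ 2 * τ) := le_mul_of_one_le_left (by positivity) hs
  have hbig : 121 * (n : ℝ) ^ 2 * τ + 2 * (√n * (2 * (121 * n ^ 2 * τ) + τ))
      ≤ 607 * (n ^ 2 * √n) * τ := by
    have : √(n : ℝ) * τ ≤ √n * (n ^ 2 * τ) := mul_le_mul_of_nonneg_left hmono (Real.sqrt_nonneg _)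
    nlinarith
  have hbig0 : 2 * (√n * (2 * (121 * (n : ℝ) ^ 2 * τ) + τ)) ≤ 607 * (n ^ 2 * √n) * τ :=
    le_trans (le_add_of_nonneg_left (by positivity)) hbig
  have eA : ∀ σ i, jointJunk KA KB HP (bellStatesActA σ i) ξ
      = refA KA KB HP n σ i (jointJunk KA KB HP (bellBasis (0, 0)) ξ) := fun σ i => by
    rw [refA_jointJunk, bellStatesActA, bellStates_eq]
  have eB : ∀ σ i, jointJunk KA KB HP (bellStatesActB σ i) ξ
      = refB KA KB HP n σ i (jointJunk KA KB HP (bellBasis (0, 0)) ξ) := fun σ i => by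
    rw [refB_jointJunk, bellStatesActB, bellStates_eq]
  refine ⟨A, B, ξ, hA, hB, hξ, fun i => ?_⟩
  rw [eA, eA, eB, eB, bellStates_eq]
  exact ⟨h0.trans hbig0, (hi i).1.trans hbig, (hi i).2.1.trans hbig, (hi i).2.2.1.trans hbig,
    (hi i).2.2.2.trans hbig⟩

/-- `exists_isometries_junk` in terms of `localOp` and `withJunk`. -/
theorem exists_localOp_withJunk {a : AliceObservables n HA} {b : BobObservables n HB} {ε : ℝ}
    (Ψ : Joint HA HB HP) (hΨ : ‖Ψ‖ = 1) (h : HasMirrors (HP := HP) Ψ a b (√(2 * ε)))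
    (hn : n % 4 = 3) (h3 : 3 < n) {k : Fin n → Fin n}
    (hk : ∀ i, k i ≠ i) (jA : Qubits n ⊗[ℂ] HA →ₗᵢ[ℂ] KA) (jB : Qubits n ⊗[ℂ] HB →ₗᵢ[ℂ] KB) :
    ∃ (ξ : Joint KA KB HP)
      (ΦA : HA →ₗᵢ[ℂ] Qubits n ⊗[ℂ] KA) (ΦB : HB →ₗᵢ[ℂ] Qubits n ⊗[ℂ] KB),
      ‖ξ‖ = 1 ∧
      ∀ i : Fin n,
        ‖localOp HP ΦA.toContinuousLinearMap ΦB.toContinuousLinearMap Ψ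
            - withJunk (bellStates n) ξ‖ ≤ 1000 * (n : ℝ) ^ (5 / 2 : ℝ) * √ε ∧
        ‖localOp HP ΦA.toContinuousLinearMap ΦB.toContinuousLinearMap (localOp HP (a.X i) 1 Ψ)
            - withJunk (bellStatesActA pauliX i) ξ‖
          ≤ 1000 * (n : ℝ) ^ (5 / 2 : ℝ) * √ε ∧
        ‖localOp HP ΦA.toContinuousLinearMap ΦB.toContinuousLinearMap (localOp HP (a.Z i) 1 Ψ)
            - withJunk (bellStatesActA pauliZ i) ξ‖
          ≤ 1000 * (n : ℝ) ^ (5 / 2 : ℝ) * √ε ∧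
        ‖localOp HP ΦA.toContinuousLinearMap ΦB.toContinuousLinearMap
              (localOp HP 1 (b.localX i) Ψ)
            - withJunk (bellStatesActB pauliX i) ξ‖
          ≤ 1000 * (n : ℝ) ^ (5 / 2 : ℝ) * √ε ∧
        ‖localOp HP ΦA.toContinuousLinearMap ΦB.toContinuousLinearMap
              (localOp HP 1 (b.localZ (k i) i) Ψ)
            - withJunk (bellStatesActB pauliZ i) ξ‖
          ≤ 1000 * (n : ℝ) ^ (5 / 2 : ℝ) * √ε := by
  obtain ⟨A, B, ξ, hA, hB, hξ, h⟩ := exists_isometries_junk (HP := HP) hΨ h hn h3 hk jA jB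
  have hle : 607 * ((n : ℝ) ^ 2 * √n) * √(2 * ε) ≤ 1000 * (n : ℝ) ^ (5 / 2 : ℝ) * √ε := by
    have e : (n : ℝ) ^ (5 / 2 : ℝ) = (n : ℝ) ^ 2 * √n := by
      rw [Real.sqrt_eq_rpow, ← Real.rpow_natCast, ← Real.rpow_add (by norm_cast; omega)]
      norm_num
    have hs2 : √(2 : ℝ) ≤ 3 / 2 := Real.sqrt_le_iff.mpr (by norm_num)
    rw [e, Real.sqrt_mul (by norm_num)]
    have hp : 0 ≤ (n : ℝ) ^ 2 * √n * √ε := by positivity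
    nlinarith [mul_le_mul_of_nonneg_right hs2 hp]
  refine ⟨ξ, ⟨A.toLinearMap, hA⟩, ⟨B.toLinearMap, hB⟩, hξ, fun i => ?_⟩
  exact ⟨(h i).1.trans hle, (h i).2.1.trans hle, (h i).2.2.1.trans hle, (h i).2.2.2.1.trans hle,
    (h i).2.2.2.2.trans hle⟩

end Main

end BellSelfTest

end

open BellSelfTest in
theorem mainTheorem1 :
    ∃ C : ℝ, ∀ (n : ℕ), n % 4 = 3 → 3 < n →
    ∀ (HA : Type u) (HB : Type v) (HP : Type w)
      [NormedAddCommGroup HA] [InnerProductSpace ℂ HA] [CompleteSpace HA]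
      [NormedAddCommGroup HB] [InnerProductSpace ℂ HB] [CompleteSpace HB]
      [NormedAddCommGroup HP] [InnerProductSpace ℂ HP] [CompleteSpace HP]
      (Ψ : Joint HA HB HP), ‖Ψ‖ = 1 →
    ∀ (a : AliceObservables n HA) (b : BobObservables n HB) (ε₀ ε₁ ε₂ : ℝ),
      GameCorrelations Ψ a b ε₀ →
      LocalCheckCorrelations Ψ a b ε₁ →
      PairCheckCorrelations Ψ a b ε₂ →
    ∀ ε : ℝ, ε = max ε₀ (max ε₁ ε₂) →
    ∀ k : Fin n → Fin n, (∀ i, k i ≠ i) →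
    ∃ (KA : Type u) (_ : NormedAddCommGroup KA) (_ : InnerProductSpace ℂ KA)
      (_ : CompleteSpace KA)
      (KB : Type v) (_ : NormedAddCommGroup KB) (_ : InnerProductSpace ℂ KB)
      (_ : CompleteSpace KB)
      (ξ : Joint KA KB HP)
      (ΦA : HA →ₗᵢ[ℂ] Qubits n ⊗[ℂ] KA) (ΦB : HB →ₗᵢ[ℂ] Qubits n ⊗[ℂ] KB),
      ‖ξ‖ = 1 ∧
      ∀ i : Fin n,
        ‖localOp HP ΦA.toContinuousLinearMap ΦB.toContinuousLinearMap Ψ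
            - withJunk (bellStates n) ξ‖ ≤ C * (n : ℝ) ^ (5 / 2 : ℝ) * √ε ∧
        ‖localOp HP ΦA.toContinuousLinearMap ΦB.toContinuousLinearMap (localOp HP (a.X i) 1 Ψ)
            - withJunk (bellStatesActA pauliX i) ξ‖
          ≤ C * (n : ℝ) ^ (5 / 2 : ℝ) * √ε ∧
        ‖localOp HP ΦA.toContinuousLinearMap ΦB.toContinuousLinearMap (localOp HP (a.Z i) 1 Ψ)
            - withJunk (bellStatesActA pauliZ i) ξ‖
          ≤ C * (n : ℝ) ^ (5 / 2 : ℝ) * √ε ∧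
        ‖localOp HP ΦA.toContinuousLinearMap ΦB.toContinuousLinearMap
              (localOp HP 1 (b.localX i) Ψ)
            - withJunk (bellStatesActB pauliX i) ξ‖
          ≤ C * (n : ℝ) ^ (5 / 2 : ℝ) * √ε ∧
        ‖localOp HP ΦA.toContinuousLinearMap ΦB.toContinuousLinearMap
              (localOp HP 1 (b.localZ (k i) i) Ψ)
            - withJunk (bellStatesActB pauliZ i) ξ‖
          ≤ C * (n : ℝ) ^ (5 / 2 : ℝ) * √ε := by
  refine ⟨1000, fun n hn h3 HA HB HP _ _ _ _ _ _ _ _ _ Ψ hΨ a b ε₀ ε₁ ε₂ h0 h1 h2 ε hε k hk => ?_⟩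
  have hm : HasMirrors (HP := HP) Ψ a b (√(2 * ε)) :=
    hasMirrors (HP := HP) (Ψ := Ψ) hΨ (by omega) (by omega) a b h0 h1 h2 (by simp [hε])
      (by simp [hε]) (by simp [hε])
  exact ⟨UniformSpace.Completion (Qubits n ⊗[ℂ] HA), inferInstance, inferInstance, inferInstance,
    UniformSpace.Completion (Qubits n ⊗[ℂ] HB), inferInstance, inferInstance, inferInstance,
    exists_localOp_withJunk Ψ hΨ hm hn h3 hk (toCompletion (Qubits n ⊗[ℂ] HA))
      (toCompletion (Qubits n ⊗[ℂ] HB))⟩
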